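/- A (generalised) square complex is a complex obtained by gluing vertices, edges and squares $[0,1]^2$ along their faces (each edge is attached at its two endpoints, each square along a closed path of four edges); cells need not be embedded. It is a VH-complex if its edges are partitioned into vertical and horizontal ones so that the boundary of every square alternates between the two classes. It is nonpositively curved if no vertex link contains an embedded combinatorial cycle of length less than $4$. A (generalised) simplicial complex is likewise a set of affine simplices glued along faces, where each face of a simplex is the image of precisely one attaching map; simplices need not be embedded. The link of a vertex $v$ has one simplex for each attaching map of $v$ to a simplex of positive dimension, namely the face opposite to $v$. A simplicial complex is simple if it is a simplicial complex in the usual sense (no edge joins a vertex to itself, and no two simplices have the same boundary), and flag if it is simple and every finite nonempty clique of its $1$-skeleton spans a simplex. It is locally $6$-large if all its vertex links are flag and contain no cycles of length $4$ or $5$ without diagonals, and systolic if moreover it is connected and simply connected. A group is systolic if it acts geometrically, i.e. properly discontinuously and cocompactly by simplicial automorphisms, on a systolic complex. The simplexification $X^*$ of a VH-complex $X$ with vertices $V$, vertical edges $E_V$ and squares $S$ has vertices $v^*$ $(v\in V)$, $e^*$ $(e\in E_V)$ and $s^*$ $(s\in S)$. It is obtained from the triangulation of $X$ in which every vertical edge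 $e$ is divided in two at its midpoint $e^*$ and every square $s$ is coned off from its centre $s^*$ (giving six triangles), by attaching, for each $e\in E_V$ with endpoints $v_+,v_-$, the two simplices spanned by $v_\pm^*$, $e^*$ and $s_1^*,\dots,s_n^*$, where $s_1,\dots,s_n$ are the squares adjacent to $e$, counted with multiplicity; these two simplices share the face spanned by $e^*,s_1^*,\dots,s_n^*$. (If infinitely many squares are adjacent to $e$, all finite-dimensional faces of this kind are attached.) **Theorem.** Let $X$ be a compact connected nonpositively curved square VH-complex. Then $\pi_1(X)$ is systolic. More precisely, let $\tilde X$ be the universal cover of $X$, with the VH-structure lifted from $X$. Then its simplexification $\tilde X^*$ is systolic, and the action of $\pi_1(X)$ on $\tilde X$ by deck transformations (an isomorphism of $\pi_1(X)$ onto the group of deck transformations) extends to a geometric action of $\pi_1(X)$ on $\tilde X^*$. -/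

import Mathlib

universe u

/-! ### Generalised simplicial complexes -/

/-- A generalised simplicial complex: a set of affine simplices (given by their finite nonempty
sets of corners) and a set of attaching maps, closed under composition, which embed simplices onto
faces of simplices (an affine embedding onto a face is an injection of corners), such that every
face of a simplex is the image of precisely one attaching map (the identity for the full face).
Simplices need not be embedded, and several simplices may have the same boundary. -/
structure GenSimplicialComplex : Type (u + 1) where
  Simplex : Type u
  Corner : Simplex → Type u
  finite_corner : ∀ σ, Finite (Corner σ)
  nonempty_corner : ∀ σ, Nonempty (Corner σ)
  Attach : ∀ τ σ, (Corner τ → Corner σ) → Prop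
  injective_of_attach : ∀ {τ σ} {f : Corner τ → Corner σ}, Attach τ σ f → Function.Injective f
  attach_id : ∀ σ, Attach σ σ id
  attach_comp : ∀ {ρ τ σ} {f : Corner ρ → Corner τ} {g : Corner τ → Corner σ},
    Attach ρ τ f → Attach τ σ g → Attach ρ σ (g ∘ f)
  existsUnique_face : ∀ σ (T : Set (Corner σ)), T.Nonempty →
    ∃! p : (τ : Simplex) × (Corner τ → Corner σ), Attach p.1 σ p.2 ∧ Set.range p.2 = T

namespace GenSimplicialComplex

attribute [instance] finite_corner nonempty_corner

noncomputable instance (K : GenSimplicialComplex.{u}) (σ : K.Simplex) : Fintype (K.Corner σ) :=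
  Fintype.ofFinite _

/-- The disjoint union of the affine simplices. -/
abbrev Cells (K : GenSimplicialComplex.{u}) : Type u :=
  (σ : K.Simplex) × stdSimplex ℝ (K.Corner σ)

/-- A point of a simplex is glued to its image under every attaching map. -/
inductive Glue (K : GenSimplicialComplex.{u}) : K.Cells → K.Cells → Prop
  | mk {τ σ : K.Simplex} {f : K.Corner τ → K.Corner σ} (hf : K.Attach τ σ f)
      (x : stdSimplex ℝ (K.Corner τ)) : Glue K ⟨τ, x⟩ ⟨σ, stdSimplex.map f x⟩

/-- The geometric realisation, with the quotient topology. -/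
abbrev Realization (K : GenSimplicialComplex.{u}) : Type u := Quot K.Glue

/-- `τ` is a face of `σ`. -/
def IsFace (K : GenSimplicialComplex.{u}) (τ σ : K.Simplex) : Prop :=
  ∃ f : K.Corner τ → K.Corner σ, K.Attach τ σ f

/-- `v` is a vertex, that is, a simplex of dimension `0`. -/
def IsVertex (K : GenSimplicialComplex.{u}) (v : K.Simplex) : Prop := Subsingleton (K.Corner v)

/-- The set of vertices of a simplex. -/
def vertices (K : GenSimplicialComplex.{u}) (σ : K.Simplex) : Set K.Simplex :=
  {v | K.IsVertex v ∧ K.IsFace v σ}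

/-- The complex is simple, that is, a simplicial complex in the usual sense: the corners of a
simplex are distinct vertices (equivalently no edge joins a vertex to itself), and a simplex is
determined by its set of vertices (equivalently no two simplices have the same boundary). -/
def IsSimple (K : GenSimplicialComplex.{u}) : Prop :=
  (∀ (v σ : K.Simplex) (f g : K.Corner v → K.Corner σ), K.IsVertex v →
    K.Attach v σ f → K.Attach v σ g → f = g) ∧
  ∀ σ τ : K.Simplex, K.vertices σ = K.vertices τ → σ = τ

/-- Adjacency of distinct vertices by an edge. -/
def graph (K : GenSimplicialComplex.{u}) : SimpleGraph {v : K.Simplex // K.IsVertex v} where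
  Adj v w := v ≠ w ∧ ∃ e : K.Simplex, Nat.card (K.Corner e) = 2 ∧ K.IsFace v e ∧ K.IsFace w e
  symm := ⟨fun _ _ ⟨h, e, he, hv, hw⟩ => ⟨h.symm, e, he, hw, hv⟩⟩
  loopless := ⟨fun _ h => h.1 rfl⟩

/-- The complex is simple and every finite nonempty clique of its 1-skeleton spans a simplex. -/
def IsFlag (K : GenSimplicialComplex.{u}) : Prop :=
  K.IsSimple ∧ ∀ S : Finset {v : K.Simplex // K.IsVertex v}, S.Nonempty →
    K.graph.IsClique (S : Set {v : K.Simplex // K.IsVertex v}) →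
    ∃ σ : K.Simplex, K.vertices σ = Subtype.val '' (S : Set {v : K.Simplex // K.IsVertex v})

/-- The link of a simplex `σ`: for each attaching map `φ : σ → τ` (onto a proper face) take the
maximal face of `τ` disjoint from the image of `φ`; the attaching maps are the restrictions of the
attaching maps compatible with the given maps from `σ`. -/
def link (K : GenSimplicialComplex.{u}) (σ : K.Simplex) : GenSimplicialComplex.{u} where
  Simplex := {p : (τ : K.Simplex) × (K.Corner σ → K.Corner τ) //
    K.Attach σ p.1 p.2 ∧ ¬ Function.Surjective p.2}
  Corner p := {y : K.Corner p.1.1 // y ∉ Set.range p.1.2}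
  finite_corner p := inferInstance
  nonempty_corner p := by
    obtain ⟨y, hy⟩ := not_forall.1 p.2.2
    exact ⟨⟨y, fun ⟨x, hx⟩ => hy ⟨x, hx⟩⟩⟩
  Attach p q h := ∃ g : K.Corner p.1.1 → K.Corner q.1.1, K.Attach p.1.1 q.1.1 g ∧
    g ∘ p.1.2 = q.1.2 ∧ ∀ y, (h y).1 = g y.1
  injective_of_attach := by
    rintro p q h ⟨g, hg, -, hh⟩ a b hab
    exact Subtype.ext (K.injective_of_attach hg (by rw [← hh, ← hh, hab]))
  attach_id p := ⟨id, K.attach_id _, rfl, fun _ => rfl⟩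
  attach_comp := by
    rintro p q r h k ⟨g, hg, hgp, hh⟩ ⟨g', hg', hgp', hk⟩
    refine ⟨g' ∘ g, K.attach_comp hg hg', ?_, fun y => ?_⟩
    · rw [Function.comp_assoc, hgp, hgp']
    · simp [hk, hh]
  existsUnique_face := by
    rintro ⟨⟨τ, φ⟩, hφ, hns⟩ T hT
    obtain ⟨⟨ρ, g⟩, ⟨hg, hgr⟩, huniq⟩ := K.existsUnique_face τ (Subtype.val '' T ∪ Set.range φ)
      ((hT.image _).mono Set.subset_union_left)
    dsimp only at hg hgr huniq hφ hns
    -- the face of `ρ` corresponding to `σ`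
    have hsub : Set.range φ ⊆ Set.range g := hgr ▸ Set.subset_union_right
    obtain ⟨⟨σ', ψ⟩, ⟨hψ, hψr⟩, -⟩ := K.existsUnique_face ρ (g ⁻¹' Set.range φ) (by
      obtain ⟨x⟩ := K.nonempty_corner σ
      obtain ⟨z, hz⟩ := hsub ⟨x, rfl⟩
      exact ⟨z, x, hz.symm⟩)
    dsimp only at hψ hψr
    have hgψ₀ : K.Attach σ' τ (g ∘ ψ) ∧ Set.range (g ∘ ψ) = Set.range φ :=
      ⟨K.attach_comp hψ hg, by
        rw [Set.range_comp, hψr, Set.image_preimage_eq_of_subset hsub]⟩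
    have hu := (K.existsUnique_face τ (Set.range φ) (Set.range_nonempty φ)).unique
      (y₁ := ⟨σ', g ∘ ψ⟩) (y₂ := ⟨σ, φ⟩) hgψ₀ ⟨hφ, rfl⟩
    obtain rfl : σ' = σ := congrArg Sigma.fst hu
    have hgψ : g ∘ ψ = φ := eq_of_heq (Sigma.mk.inj hu).2
    have key : ∀ y : K.Corner ρ, y ∉ Set.range ψ → ∃ z ∈ T, z.1 = g y := by
      intro y hy
      have : g y ∈ Subtype.val '' T ∪ Set.range φ := hgr ▸ ⟨y, rfl⟩
      rcases this with ⟨z, hz, hzy⟩ | h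
      · exact ⟨z, hz, hzy⟩
      · exact absurd (hψr.symm ▸ h : y ∈ Set.range ψ) hy
    have hnsψ : ¬ Function.Surjective ψ := by
      intro hs
      obtain ⟨z, hz⟩ := hT
      have : z.1 ∈ Set.range g := hgr ▸ Or.inl ⟨z, hz, rfl⟩
      obtain ⟨y, hy⟩ := this
      obtain ⟨x, rfl⟩ := hs y
      exact z.2 ⟨x, (congrFun hgψ x).symm.trans hy⟩
    refine ⟨⟨⟨⟨ρ, ψ⟩, hψ, hnsψ⟩, fun y => ⟨g y.1, ?_⟩⟩, ⟨⟨g, hg, hgψ, fun _ => rfl⟩, ?_⟩, ?_⟩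
    · rintro ⟨x, hx⟩
      exact y.2 ⟨x, K.injective_of_attach hg ((congrFun hgψ x).trans hx)⟩
    · ext z
      constructor
      · rintro ⟨y, rfl⟩
        obtain ⟨z, hz, hzy⟩ := key y.1 y.2
        exact Set.mem_of_eq_of_mem (Subtype.ext hzy.symm) hz
      · intro hz
        have : z.1 ∈ Set.range g := hgr ▸ Or.inl ⟨z, hz, rfl⟩
        obtain ⟨y, hy⟩ := this
        refine ⟨⟨y, ?_⟩, Subtype.ext hy⟩
        rintro ⟨x, rfl⟩
        exact z.2 ⟨x, (congrFun hgψ x).symm.trans hy⟩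
    · rintro ⟨⟨⟨ρ', ψ'⟩, hψ', hns'⟩, h⟩ ⟨⟨g', hg', hgψ', hh⟩, hr⟩
      dsimp only at hψ' hns' h g' hg' hgψ' hh hr
      have hrange : Set.range g' = Subtype.val '' T ∪ Set.range φ := by
        ext z
        constructor
        · rintro ⟨y, rfl⟩
          by_cases hy : y ∈ Set.range ψ'
          · obtain ⟨x, rfl⟩ := hy
            exact Or.inr ⟨x, (congrFun hgψ' x).symm⟩
          · exact Or.inl ⟨h ⟨y, hy⟩, hr ▸ ⟨_, rfl⟩, hh ⟨y, hy⟩⟩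
        · rintro (⟨w, hw, rfl⟩ | ⟨x, rfl⟩)
          · rw [← hr] at hw
            obtain ⟨y, rfl⟩ := hw
            exact ⟨y.1, (hh y).symm⟩
          · exact ⟨ψ' x, congrFun hgψ' x⟩
      have e := huniq ⟨ρ', g'⟩ ⟨hg', hrange⟩
      obtain rfl : ρ' = ρ := congrArg Sigma.fst e
      obtain rfl : g' = g := eq_of_heq (Sigma.mk.inj e).2
      obtain rfl : ψ' = ψ := funext fun x => K.injective_of_attach hg
        (congrFun (hgψ'.trans hgψ.symm) x)
      have : h = fun y => ⟨g' y.1, fun hx => by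
          obtain ⟨x, hx⟩ := hx
          exact y.2 ⟨x, K.injective_of_attach hg ((congrFun hgψ x).trans hx)⟩⟩ := funext fun y => Subtype.ext (hh y)
      subst this
      rfl

/-- Every vertex link is flag and contains no cycle of length 4 or 5 without diagonals (an embedded
cycle such that nonconsecutive vertices are not joined by an edge, i.e. an induced cycle). -/
def IsLocally6Large (K : GenSimplicialComplex.{u}) : Prop :=
  ∀ v : K.Simplex, K.IsVertex v → (K.link v).IsFlag ∧
    IsEmpty (SimpleGraph.cycleGraph 4 ↪g (K.link v).graph) ∧
    IsEmpty (SimpleGraph.cycleGraph 5 ↪g (K.link v).graph)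

/-- Connected, simply connected and locally 6-large. -/
def IsSystolic (K : GenSimplicialComplex.{u}) : Prop :=
  ConnectedSpace K.Realization ∧ SimplyConnectedSpace K.Realization ∧ K.IsLocally6Large

/-- A nondegenerate simplicial map: it sends simplices to simplices of the same dimension,
through bijections of corners that commute with the attaching maps. -/
@[ext]
structure Hom (K L : GenSimplicialComplex.{u}) : Type u where
  toFun : K.Simplex → L.Simplex
  corner : ∀ σ, K.Corner σ → L.Corner (toFun σ)
  bijective_corner : ∀ σ, Function.Bijective (corner σ)
  map_attach : ∀ {τ σ : K.Simplex} {f : K.Corner τ → K.Corner σ}, K.Attach τ σ f →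
    ∃ g, L.Attach (toFun τ) (toFun σ) g ∧ g ∘ corner τ = corner σ ∘ f

/-- The nondegenerate simplicial self-maps form a monoid under composition; its units are the
simplicial automorphisms, and a monoid homomorphism from a group to it is an action of the group
by simplicial automorphisms. -/
instance (K : GenSimplicialComplex.{u}) : Monoid (K.Hom K) where
  one := ⟨id, fun _ => id, fun _ => Function.bijective_id, fun {_ _} f hf => ⟨f, hf, rfl⟩⟩
  mul a b := ⟨a.toFun ∘ b.toFun, fun σ => a.corner (b.toFun σ) ∘ b.corner σ,
    fun σ => (a.bijective_corner _).comp (b.bijective_corner σ), fun {τ σ f} hf => by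
      obtain ⟨g, hg, hgf⟩ := b.map_attach hf
      obtain ⟨k, hk, hkg⟩ := a.map_attach hg
      refine ⟨k, hk, ?_⟩
      rw [← Function.comp_assoc, hkg, Function.comp_assoc, hgf]
      rfl⟩
  mul_assoc _ _ _ := rfl
  one_mul _ := rfl
  mul_one _ := rfl

/-- The action `ρ` of `G` on `K` by simplicial automorphisms is geometric, that is, properly
discontinuous (for any two simplices `σ`, `τ`, only finitely many translates of `σ` meet `τ`)
and cocompact (there are finitely many simplices whose translates exhaust `K`). -/
def IsGeometric {G : Type*} [Group G] {K : GenSimplicialComplex.{u}} (ρ : G →* K.Hom K) : Prop :=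
  (∀ σ τ : K.Simplex, {g : G | (K.vertices ((ρ g).toFun σ) ∩ K.vertices τ).Nonempty}.Finite) ∧
  ∃ F : Set K.Simplex, F.Finite ∧ ∀ σ : K.Simplex, ∃ g : G, ∃ τ ∈ F, (ρ g).toFun τ = σ

end GenSimplicialComplex

/-- A group is systolic if it acts geometrically on a systolic complex. -/
def IsSystolicGroup (G : Type u) [Group G] : Prop :=
  ∃ (K : GenSimplicialComplex.{u}) (ρ : G →* K.Hom K),
    K.IsSystolic ∧ GenSimplicialComplex.IsGeometric ρ

/-! ### Square complexes -/

/-- A (generalised) square complex. Every edge `e` is parametrised by `[0,1]`, with endpoints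
`endpt e false` (at `0`) and `endpt e true` (at `1`). The pair `(e, false)` is the edge `e`
directed from `0` to `1`, and `(e, true)` is `e` directed from `1` to `0`; so the directed
edge `(e, b)` starts at `endpt e b` and ends at `endpt e !b`. Every square is attached
along a closed path of four directed edges. Cells need not be embedded. -/
structure SquareComplex : Type (u + 1) where
  V : Type u
  E : Type u
  S : Type u
  endpt : E → Bool → V
  bdry : S → Fin 4 → E × Bool
  bdry_closed : ∀ s i, endpt (bdry s i).1 (!(bdry s i).2) =
    endpt (bdry s (i + 1)).1 (bdry s (i + 1)).2

namespace SquareComplex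

/-- The starting vertex of a directed edge. -/
def src (X : SquareComplex.{u}) (d : X.E × Bool) : X.V := X.endpt d.1 d.2

/-- The `i`-th corner of the square `s`; the `i`-th side runs from the `i`-th corner to the
`(i+1)`-st corner. -/
def corner (X : SquareComplex.{u}) (s : X.S) (i : Fin 4) : X.V := X.src (X.bdry s i)

/-- The reversed directed edge. -/
def rev (X : SquareComplex.{u}) (d : X.E × Bool) : X.E × Bool := (d.1, !d.2)

/-- The disjoint union of the vertices, of copies of `[0,1]` and of copies of `[0,1]²`. -/
abbrev Cells (X : SquareComplex.{u}) : Type u :=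
  ((_ : X.V) × PUnit.{1}) ⊕ ((_ : X.E) × unitInterval) ⊕ ((_ : X.S) × (unitInterval × unitInterval))

/-- The point at parameter `t` on the `i`-th side of `[0,1]²`, traversed cyclically. -/
def sidePoint (i : Fin 4) (t : unitInterval) : unitInterval × unitInterval :=
  match i with
  | 0 => (t, 0)
  | 1 => (1, t)
  | 2 => (unitInterval.symm t, 1)
  | 3 => (0, unitInterval.symm t)

/-- Endpoints of edges are glued to vertices, and sides of squares to edges. -/
inductive Glue (X : SquareComplex.{u}) : X.Cells → X.Cells → Prop
  | edge (e : X.E) (b : Bool) :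
      Glue X (Sum.inr (Sum.inl ⟨e, if b then 1 else 0⟩)) (Sum.inl ⟨X.endpt e b, ⟨⟩⟩)
  | square (s : X.S) (i : Fin 4) (t : unitInterval) :
      Glue X (Sum.inr (Sum.inr ⟨s, sidePoint i t⟩))
        (Sum.inr (Sum.inl ⟨(X.bdry s i).1, if (X.bdry s i).2 then unitInterval.symm t else t⟩))

/-- The geometric realisation, with the quotient topology. -/
abbrev Realization (X : SquareComplex.{u}) : Type u := Quot X.Glue

/-- The vertices of the link at a vertex `v` of `X` are the directed edges starting at `v`. The
edges of the link are the corners `(s, i)` of squares at `v`: the corner `(s, i)` joins the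
directed side starting at it to the reverse of the directed side ending at it. -/
def LinkJoins (X : SquareComplex.{u}) (c : X.S × Fin 4) (d d' : X.E × Bool) : Prop :=
  (d = X.bdry c.1 c.2 ∧ d' = X.rev (X.bdry c.1 (c.2 - 1))) ∨
  (d' = X.bdry c.1 c.2 ∧ d = X.rev (X.bdry c.1 (c.2 - 1)))

/-- No vertex link contains an embedded cycle of length `n + 1 < 4`. -/
def NonpositivelyCurved (X : SquareComplex.{u}) : Prop :=
  ∀ (v : X.V) (n : ℕ), n + 1 < 4 →
    ¬ ∃ (d : Fin (n + 1) → X.E × Bool) (c : Fin (n + 1) → X.S × Fin 4),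
      (∀ i, X.src (d i) = v) ∧ Function.Injective d ∧ Function.Injective c ∧
      ∀ i, X.LinkJoins (c i) (d i) (d (i + 1))

/-- A partition of the edges into vertical and horizontal (i.e. not vertical) ones such that the
attaching map of each square alternates between them: a VH-structure. -/
structure VHStructure (X : SquareComplex.{u}) : Type u where
  vertical : X.E → Prop
  alternating : ∀ s i, vertical (X.bdry s (i + 1)).1 ↔ ¬ vertical (X.bdry s i).1

/-- A combinatorial map of square complexes that respects the chosen parametrisations
of the cells. -/
@[ext]
structure Hom (Y X : SquareComplex.{u}) : Type u where
  onV : Y.V → X.V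
  onE : Y.E → X.E
  onS : Y.S → X.S
  endpt_onE : ∀ e b, X.endpt (onE e) b = onV (Y.endpt e b)
  bdry_onS : ∀ s i, X.bdry (onS s) i = (onE (Y.bdry s i).1, (Y.bdry s i).2)

namespace Hom

/-- The composition `p ∘ q`. -/
def comp {Z Y X : SquareComplex.{u}} (p : Y.Hom X) (q : Z.Hom Y) : Z.Hom X where
  onV := p.onV ∘ q.onV
  onE := p.onE ∘ q.onE
  onS := p.onS ∘ q.onS
  endpt_onE e b := by simp [p.endpt_onE, q.endpt_onE]
  bdry_onS s i := by simp [p.bdry_onS, q.bdry_onS]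

instance (Y : SquareComplex.{u}) : Monoid (Y.Hom Y) where
  one := ⟨id, id, id, fun _ _ => rfl, fun _ _ => rfl⟩
  mul a b := a.comp b
  mul_assoc _ _ _ := rfl
  one_mul _ := rfl
  mul_one _ := rfl

/-- The map induced on the disjoint unions of the cells. -/
def onCells {Y X : SquareComplex.{u}} (p : Y.Hom X) : Y.Cells → X.Cells
  | Sum.inl ⟨v, x⟩ => Sum.inl ⟨p.onV v, x⟩
  | Sum.inr (Sum.inl ⟨e, t⟩) => Sum.inr (Sum.inl ⟨p.onE e, t⟩)
  | Sum.inr (Sum.inr ⟨s, z⟩) => Sum.inr (Sum.inr ⟨p.onS s, z⟩)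

/-- The geometric realisation of a combinatorial map. -/
def realize {Y X : SquareComplex.{u}} (p : Y.Hom X) : Y.Realization → X.Realization :=
  Quot.map p.onCells (by
    rintro _ _ (⟨e, b⟩ | ⟨s, i, t⟩)
    · have h := Glue.edge (X := X) (p.onE e) b
      rw [p.endpt_onE] at h
      exact h
    · have h := Glue.square (X := X) (p.onS s) i t
      simp only [p.bdry_onS] at h
      exact h)

/-- `p : Y → X` is the universal cover of (connected) `X`: a covering map with simply connected
total space. -/
def IsUniversalCover {Y X : SquareComplex.{u}} (p : Y.Hom X) : Prop :=
  IsCoveringMap p.realize ∧ SimplyConnectedSpace Y.Realization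

end Hom

namespace VHStructure

/-- The VH-structure pulled back along a combinatorial map. -/
def pullback {Y X : SquareComplex.{u}} (W : X.VHStructure) (p : Y.Hom X) : Y.VHStructure where
  vertical e := W.vertical (p.onE e)
  alternating s i := by
    have h := W.alternating (p.onS s) i
    simpa only [p.bdry_onS] using h

variable {X : SquareComplex.{u}}

/-! ### The simplexification

For a vertical edge `e` let `A_e` be the set of squares adjacent to `e`, counted with multiplicity:
the pairs `(s, i)` such that the `i`-th side of `s` lies along `e`. The closed star `Y*_e` of the
midpoint `e*` is the union of the two simplices with corners `e*`, `s*` for `(s, i) ∈ A_e`, and one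
end of `e`. -/

/-- The corners of the two simplices around the midpoint of a vertical edge `e`: the midpoint `e*`,
the two ends of `e`, and the centres `s*` for `(s, i) ∈ A_e`. -/
inductive Label (X : SquareComplex.{u}) : Type u
  | mid : Label X
  | tip (b : Bool) : Label X
  | sq (s : X.S) (i : Fin 4) : Label X

/-- `F` is the set of corners of a face of one of the two simplices around the midpoint of the
vertical edge `e` (there are faces of arbitrary finite dimension if `A_e` is infinite), other
than a vertex `s*` or an endpoint of `e`. -/
structure IsBlock (W : X.VHStructure) (e : X.E) (F : Set (Label X)) : Prop where
  vertical : W.vertical e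
  finite : F.Finite
  adjacent : ∀ s i, Label.sq s i ∈ F → (X.bdry s i).1 = e
  one_tip : ¬ (Label.tip false ∈ F ∧ Label.tip true ∈ F)
  essential : Label.mid ∈ F ∨ F.Nontrivial

/-- The simplices of the simplexification `X*`: the vertices `v*` and `s*`; the horizontal edges
of `X`; for every square `s` and every horizontal side of it the triangle spanned by `s*` and that
side; and the remaining faces of the simplices around the midpoints of the vertical edges `e`. The
latter include the vertex `e*` (for `F = {mid}`), the halves of `e`, and the edges that join the
centre of a square to its corners (for `F = {sq s i, tip b}`). Each corner of a square lies on
exactly one of its vertical sides, so each edge of the last kind occurs just once. -/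
inductive Cell (W : X.VHStructure) : Type u
  | vtx (v : X.V) : Cell W
  | ctr (s : X.S) : Cell W
  | horiz (h : X.E) (hh : ¬ W.vertical h) : Cell W
  | tri (s : X.S) (j : Fin 4) (hj : ¬ W.vertical (X.bdry s j).1) : Cell W
  | block (e : X.E) (F : Set (Label X)) (hF : W.IsBlock e F) : Cell W

/-- The corners of the simplices. A horizontal edge has two corners, its endpoints `false` and
`true`. The triangle over the `j`-th side of `s` has the corner `none` at `s*`, the corner `false`
at the start of the directed side, and the corner `true` at its end. -/
abbrev CellCorner (W : X.VHStructure) : Cell W → Type u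
  | .vtx _ => PUnit
  | .ctr _ => PUnit
  | .horiz _ _ => ULift Bool
  | .tri _ _ _ => Option (ULift Bool)
  | .block _ F _ => F

/-- The vertices of `X*`: the elements of `V ∪ E_V ∪ S`. -/
inductive Node (X : SquareComplex.{u}) : Type u
  | vtx (v : X.V) : Node X
  | mid (e : X.E) : Node X
  | ctr (s : X.S) : Node X

/-- The vertex of `X*` at a label of the block of the vertical edge `e`. -/
def Label.node (e : X.E) : Label X → Node X
  | .mid => .mid e
  | .tip b => .vtx (X.endpt e b)
  | .sq s _ => .ctr s

/-- The vertex of `X*` at a corner of a simplex. -/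
def cellNode (W : X.VHStructure) : (σ : Cell W) → CellCorner W σ → Node X
  | .vtx v, _ => .vtx v
  | .ctr s, _ => .ctr s
  | .horiz h _, x => .vtx (X.endpt h x.down)
  | .tri s _ _, none => .ctr s
  | .tri s j _, some b => .vtx (X.corner s (if b.down then j + 1 else j))
  | .block e _ _, x => x.1.node e

/-- The vertical side of a square at the start (`c = false`) or the end (`c = true`) of its
horizontal side `j`. -/
def sideAt (j : Fin 4) (c : Bool) : Fin 4 := if c then j + 1 else j - 1

/-- The end of the vertical edge along `sideAt j c` where it meets the horizontal side `j`. -/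
def tipAt (X : SquareComplex.{u}) (s : X.S) (j : Fin 4) (c : Bool) : Bool :=
  if c then (X.bdry s (j + 1)).2 else !(X.bdry s (j - 1)).2

/-- The attaching maps. The faces of the triangle over the `j`-th side of `s` are its vertices,
the horizontal edge along that side, and, for each end `c` of that side, the edge from `s*` to the
end, which belongs to the block of the vertical side at that end. -/
def CellAttach (W : X.VHStructure) :
    (τ σ : Cell W) → (CellCorner W τ → CellCorner W σ) → Prop
  | .vtx v, σ, f => cellNode W σ (f ⟨⟩) = .vtx v
  | .ctr s, σ, f => cellNode W σ (f ⟨⟩) = .ctr s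
  | .horiz h _, .horiz h' _, f => h = h' ∧ ∀ x, f x = x
  | .horiz h _, .tri s j _, f =>
      (X.bdry s j).1 = h ∧ ∀ b, f ⟨b⟩ = some ⟨xor b (X.bdry s j).2⟩
  | .tri s j _, .tri s' j' _, f => s = s' ∧ j = j' ∧ ∀ x, f x = x
  | .block e F _, .tri s j _, f => ∃ c : Bool,
      (X.bdry s (sideAt j c)).1 = e ∧ F = {Label.sq s (sideAt j c), Label.tip (tipAt X s j c)} ∧
      ∀ x : F, (x.1 = Label.sq s (sideAt j c) → f x = none) ∧
        (x.1 = Label.tip (tipAt X s j c) → f x = some ⟨c⟩)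
  | .block e F _, .block e' F' _, f => e = e' ∧ ∀ x : F, ((f x : F') : Label X) = x.1
  | _, _, _ => False

theorem cellNode_of_attach (W : X.VHStructure) :
    ∀ {a b : Cell W} {f : CellCorner W a → CellCorner W b},
    CellAttach W a b f → ∀ x, cellNode W b (f x) = cellNode W a x
  | .vtx _, _, _, h, ⟨⟩ => h
  | .ctr _, _, _, h, ⟨⟩ => h
  | .horiz _ _, .horiz _ _, _, ⟨rfl, h⟩, x => by rw [h x]
  | .horiz _ _, .tri s j _, f, ⟨rfl, h⟩, ⟨b⟩ => by
      have := X.bdry_closed s j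
      rw [h b]
      cases hb : (X.bdry s j).2 <;> cases b <;> simp_all [cellNode, corner, src]
  | .tri _ _ _, .tri _ _ _, _, ⟨rfl, rfl, h⟩, x => by rw [h x]
  | .block _ F _, .tri s j _, f, ⟨c, he, hF, h⟩, x => by
      subst he
      have h4 : j - 1 + 1 = j := sub_add_cancel j 1
      have := X.bdry_closed s (j - 1)
      rw [h4] at this
      rcases (Set.ext_iff.1 hF x.1).1 x.2 with hx | hx
      · rw [(h x).1 hx]; simp [cellNode, hx, Label.node]
      · rw [(h x).2 hx]
        cases c <;> simp_all [cellNode, Label.node, corner, src, tipAt, sideAt]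
  | .block _ _ _, .block _ _ _, f, ⟨rfl, h⟩, x => by
      simp [cellNode, h x]

theorem cellAttach_injective (W : X.VHStructure) :
    ∀ {a b : Cell W} {f : CellCorner W a → CellCorner W b},
    CellAttach W a b f → Function.Injective f
  | .vtx _, _, _, _ => fun _ _ _ => rfl
  | .ctr _, _, _, _ => fun _ _ _ => rfl
  | .horiz _ _, .horiz _ _, _, ⟨rfl, h⟩ => fun x y hxy => by rwa [h x, h y] at hxy
  | .horiz _ _, .tri s j _, f, ⟨rfl, h⟩ => fun ⟨x⟩ ⟨y⟩ hxy => by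
      rw [h x, h y] at hxy
      have := congrArg ULift.down (Option.some.inj hxy)
      exact congrArg ULift.up (by simpa using this)
  | .tri _ _ _, .tri _ _ _, _, ⟨rfl, rfl, h⟩ => fun x y hxy => by rwa [h x, h y] at hxy
  | .block _ F _, .tri s j _, f, ⟨c, he, hF, h⟩ => fun x y hxy => by
      apply Subtype.ext
      rcases (Set.ext_iff.1 hF x.1).1 x.2 with hx | hx <;>
      rcases (Set.ext_iff.1 hF y.1).1 y.2 with hy | hy
      · rw [hx, hy]
      · rw [(h x).1 hx, (h y).2 hy] at hxy; cases hxy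
      · rw [(h x).2 hx, (h y).1 hy] at hxy; cases hxy
      · rw [hx, hy]
  | .block _ _ _, .block _ _ _, f, ⟨rfl, h⟩ => fun x y hxy => by
      apply Subtype.ext
      rw [← h x, ← h y, hxy]

theorem cellAttach_id (W : X.VHStructure) : ∀ a : Cell W, CellAttach W a a id
  | .vtx _ => rfl
  | .ctr _ => rfl
  | .horiz _ _ => ⟨rfl, fun _ => rfl⟩
  | .tri _ _ _ => ⟨rfl, rfl, fun _ => rfl⟩
  | .block _ _ _ => ⟨rfl, fun _ => rfl⟩

theorem cellAttach_comp (W : X.VHStructure) : ∀ {a b c : Cell W}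
    {f : CellCorner W a → CellCorner W b} {g : CellCorner W b → CellCorner W c},
    CellAttach W a b f → CellAttach W b c g → CellAttach W a c (g ∘ f)
  | .vtx _, _, _, _, _, hf, hg => (cellNode_of_attach W hg _).trans hf
  | .ctr _, _, _, _, _, hf, hg => (cellNode_of_attach W hg _).trans hf
  | .horiz _ _, .horiz _ _, .horiz _ _, _, _, ⟨he, hf⟩, ⟨he', hg⟩ =>
      ⟨he.trans he', fun x => (hg _).trans (hf x)⟩
  | .horiz _ _, .horiz _ _, .tri _ _ _, _, g, ⟨he, hf⟩, ⟨he', hg⟩ =>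
      ⟨he'.trans he.symm, fun b => (congrArg g (hf ⟨b⟩)).trans (hg b)⟩
  | .horiz _ _, .tri _ _ _, .tri _ _ _, _, _, ⟨he, hf⟩, ⟨rfl, rfl, hg⟩ =>
      ⟨he, fun b => (hg _).trans (hf b)⟩
  | .tri _ _ _, .tri _ _ _, .tri _ _ _, _, _, ⟨rfl, rfl, hf⟩, ⟨rfl, rfl, hg⟩ =>
      ⟨rfl, rfl, fun x => (hg _).trans (hf x)⟩
  | .block _ _ _, .tri _ _ _, .tri _ _ _, _, _, ⟨c, he, hF, hf⟩, ⟨rfl, rfl, hg⟩ =>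
      ⟨c, he, hF, fun x => ⟨fun h => (hg _).trans ((hf x).1 h), fun h => (hg _).trans ((hf x).2 h)⟩⟩
  | .block _ F hF, .block _ F' _, .tri _ _ _, f, g, ⟨rfl, hf⟩, ⟨c, he, hF', hg⟩ => by
      have hsub : F ⊆ F' := fun x hx =>
        Set.mem_of_eq_of_mem (hf ⟨x, hx⟩).symm (f ⟨x, hx⟩).2
      refine ⟨c, he, ?_, fun x => ?_⟩
      · rw [← hF']
        refine hsub.antisymm fun y hy => ?_
        rcases hF.essential with hm | hn
        · have := hF' ▸ hsub hm
          simp at this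
        · obtain ⟨p, hp, q, hq, hpq⟩ := hn
          have hp' := hF' ▸ hsub hp
          have hq' := hF' ▸ hsub hq
          rw [hF'] at hy
          simp only [Set.mem_insert_iff, Set.mem_singleton_iff] at hp' hq' hy
          rcases hy with rfl | rfl <;> rcases hp' with rfl | rfl <;> rcases hq' with rfl | rfl <;>
            first | assumption | exact absurd rfl hpq
      · have := hg (f x)
        rw [hf x] at this
        exact this
  | .block _ _ _, .block _ _ _, .block _ _ _, f, _, ⟨rfl, hf⟩, ⟨rfl, hg⟩ =>
      ⟨rfl, fun x => (hg (f x)).trans (hf x)⟩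

theorem range_of_block_tri (W : X.VHStructure) {e : X.E} {F : Set (Label X)} {hF : W.IsBlock e F}
    {s : X.S} {j : Fin 4} {hj : ¬ W.vertical (X.bdry s j).1} {c : Bool}
    {f : CellCorner W (.block e F hF) → CellCorner W (.tri s j hj)}
    (hF' : F = {Label.sq s (sideAt j c), Label.tip (tipAt X s j c)})
    (h : ∀ x : F, (x.1 = Label.sq s (sideAt j c) → f x = none) ∧
        (x.1 = Label.tip (tipAt X s j c) → f x = some ⟨c⟩)) :
    Set.range f = {none, some ⟨c⟩} := by
  subst hF'
  ext y
  constructor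
  · rintro ⟨⟨x, hx | hx⟩, rfl⟩
    · exact Or.inl ((h _).1 hx)
    · exact Or.inr ((h _).2 hx)
  · rintro (hy | hy)
    · exact ⟨⟨_, Or.inl rfl⟩, ((h _).1 rfl).trans hy.symm⟩
    · exact ⟨⟨_, Or.inr rfl⟩, ((h _).2 rfl).trans hy.symm⟩

theorem not_range_singleton {W : X.VHStructure} {b c : Cell W} {g : CellCorner W b → CellCorner W c}
    (hg : CellAttach W b c g) {x : CellCorner W c} (h : Set.range g = {x})
    (hx : ∀ e, cellNode W c x ≠ .mid e) : Subsingleton (CellCorner W b) ∧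
      ∀ e F hF, b ≠ .block e F hF := by
  have hs : Subsingleton (CellCorner W b) := by
    refine ⟨fun y z => cellAttach_injective W hg ?_⟩
    have hy : g y ∈ ({x} : Set _) := h ▸ ⟨y, rfl⟩
    have hz : g z ∈ ({x} : Set _) := h ▸ ⟨z, rfl⟩
    exact hy.trans hz.symm
  refine ⟨hs, ?_⟩
  rintro e F hF rfl
  rcases hF.essential with hm | ⟨p, hp, q, hq, hpq⟩
  · have h1 := cellNode_of_attach W hg ⟨_, hm⟩
    have h2 : g ⟨_, hm⟩ ∈ ({x} : Set _) := h ▸ ⟨_, rfl⟩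
    rw [Set.mem_singleton_iff.1 h2] at h1
    exact hx e h1
  · exact hpq (congrArg Subtype.val (hs.elim (⟨p, hp⟩ : F) ⟨q, hq⟩))

theorem cellAttach_unique (W : X.VHStructure) : ∀ {a b c : Cell W}
    {f : CellCorner W a → CellCorner W c} {g : CellCorner W b → CellCorner W c},
    CellAttach W a c f → CellAttach W b c g → Set.range f = Set.range g →
    (⟨a, f⟩ : (τ : Cell W) × (CellCorner W τ → CellCorner W c)) = ⟨b, g⟩ := by
  -- it suffices to treat one of each pair of symmetric cases
  have point : ∀ {a b c : Cell W}
      {f : CellCorner W a → CellCorner W c} {g : CellCorner W b → CellCorner W c},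
      ((∃ v, a = .vtx v) ∨ ∃ s, a = .ctr s) →
      CellAttach W a c f → CellAttach W b c g → Set.range f = Set.range g →
      (⟨a, f⟩ : (τ : Cell W) × (CellCorner W τ → CellCorner W c)) = ⟨b, g⟩ := by
    intro a b c f g ha hf hg h
    have hu : ∃ x, Set.range f = {x} ∧ ∀ e, cellNode W c x ≠ .mid e := by
      rcases ha with ⟨v, rfl⟩ | ⟨s, rfl⟩
      · refine ⟨f ⟨⟩, Set.range_unique, fun e he => ?_⟩
        cases hf.symm.trans he
      · refine ⟨f ⟨⟩, Set.range_unique, fun e he => ?_⟩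
        cases hf.symm.trans he
    obtain ⟨x, hx, hxm⟩ := hu
    obtain ⟨hs, hb⟩ := not_range_singleton hg (h ▸ hx) hxm
    have hfx : ∀ y, f y = x := fun y => by
      have : f y ∈ ({x} : Set _) := hx ▸ ⟨y, rfl⟩
      exact this
    have hgx : ∀ y, g y = x := fun y => by
      have : g y ∈ ({x} : Set _) := hx ▸ h ▸ ⟨y, rfl⟩
      exact this
    cases b with
    | block e F hF => exact absurd rfl (hb e F hF)
    | horiz e he => exact absurd (congrArg ULift.down (hs.elim ⟨false⟩ ⟨true⟩)) (by simp)
    | tri s j hj => exact absurd (hs.elim none (some ⟨true⟩)) (by simp)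
    | vtx v =>
      rcases ha with ⟨w, rfl⟩ | ⟨s, rfl⟩
      · have h1 : cellNode W c (f ⟨⟩) = _ := hf
        have h2 : cellNode W c (g ⟨⟩) = _ := hg
        rw [hfx] at h1
        rw [hgx] at h2
        cases h1.symm.trans h2
        congr 1
        funext y
        rw [hfx, hgx]
      · have h1 : cellNode W c (f ⟨⟩) = _ := hf
        have h2 : cellNode W c (g ⟨⟩) = _ := hg
        rw [hfx] at h1
        rw [hgx] at h2
        cases h1.symm.trans h2
    | ctr t =>
      rcases ha with ⟨w, rfl⟩ | ⟨s, rfl⟩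
      · have h1 : cellNode W c (f ⟨⟩) = _ := hf
        have h2 : cellNode W c (g ⟨⟩) = _ := hg
        rw [hfx] at h1
        rw [hgx] at h2
        cases h1.symm.trans h2
      · have h1 : cellNode W c (f ⟨⟩) = _ := hf
        have h2 : cellNode W c (g ⟨⟩) = _ := hg
        rw [hfx] at h1
        rw [hgx] at h2
        cases h1.symm.trans h2
        congr 1
        funext y
        rw [hfx, hgx]
  have tri_ne : ∀ {s : X.S} {j : Fin 4} {hj : ¬ W.vertical (X.bdry s j).1} {b c : Cell W}
      {f : CellCorner W (.tri s j hj) → CellCorner W c} {g : CellCorner W b → CellCorner W c},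
      CellAttach W (.tri s j hj) c f → CellAttach W b c g → Set.range f = Set.range g →
      ((∃ h hh, b = .horiz h hh) ∨ ∃ e F hF, b = .block e F hF) → False := by
    intro s j hj b c f g hf hg h hb
    cases c with
    | vtx => exact hf
    | ctr => exact hf
    | horiz => exact hf
    | block => exact hf
    | tri s' j' hj' =>
      obtain ⟨rfl, rfl, hf⟩ := hf
      have hall : ∀ y, y ∈ Set.range g := fun y => h ▸ ⟨y, hf y⟩
      rcases hb with ⟨e, he, rfl⟩ | ⟨e, F, hF, rfl⟩
      · obtain ⟨⟨b⟩, hb⟩ := hall none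
        rw [hg.2 b] at hb
        cases hb
      · obtain ⟨c, -, hF', hg⟩ := hg
        have h1 := hall (some ⟨!c⟩)
        rw [range_of_block_tri W hF' hg] at h1
        rcases h1 with h1 | h1
        · cases h1
        · have := congrArg ULift.down (Option.some.inj h1)
          simp at this
  have horiz_block : ∀ {e : X.E} {he : ¬ W.vertical e} {e' : X.E} {F : Set (Label X)}
      {hF : W.IsBlock e' F} {c : Cell W}
      {f : CellCorner W (.horiz e he) → CellCorner W c}
      {g : CellCorner W (.block e' F hF) → CellCorner W c},
      CellAttach W (.horiz e he) c f → CellAttach W (.block e' F hF) c g →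
      Set.range f = Set.range g → False := by
    intro e he e' F hF c f g hf hg h
    cases c with
    | vtx => exact hf
    | ctr => exact hf
    | horiz => exact hg
    | block => exact hf
    | tri s j hj =>
      obtain ⟨c, -, hF', hg⟩ := hg
      rw [range_of_block_tri W hF' hg] at h
      obtain ⟨⟨b⟩, hb⟩ : none ∈ Set.range f := h ▸ Or.inl rfl
      rw [hf.2 b] at hb
      cases hb
  intro a b c f g hf hg h
  match a, b, c, f, g, hf, hg, h with
  | .vtx v, _, _, _, _, hf, hg, h => exact point (Or.inl ⟨v, rfl⟩) hf hg h
  | .ctr s, _, _, _, _, hf, hg, h => exact point (Or.inr ⟨s, rfl⟩) hf hg h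
  | _, .vtx v, _, _, _, hf, hg, h => exact (point (Or.inl ⟨v, rfl⟩) hg hf h.symm).symm
  | _, .ctr s, _, _, _, hf, hg, h => exact (point (Or.inr ⟨s, rfl⟩) hg hf h.symm).symm
  | .tri _ _ _, .horiz _ _, _, _, _, hf, hg, h =>
      exact (tri_ne hf hg h (Or.inl ⟨_, _, rfl⟩)).elim
  | .tri _ _ _, .block _ _ _, _, _, _, hf, hg, h =>
      exact (tri_ne hf hg h (Or.inr ⟨_, _, _, rfl⟩)).elim
  | .horiz _ _, .tri _ _ _, _, _, _, hf, hg, h =>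
      exact (tri_ne hg hf h.symm (Or.inl ⟨_, _, rfl⟩)).elim
  | .block _ _ _, .tri _ _ _, _, _, _, hf, hg, h =>
      exact (tri_ne hg hf h.symm (Or.inr ⟨_, _, _, rfl⟩)).elim
  | .horiz _ _, .block _ _ _, _, _, _, hf, hg, h => exact (horiz_block hf hg h).elim
  | .block _ _ _, .horiz _ _, _, _, _, hf, hg, h => exact (horiz_block hg hf h.symm).elim
  | .tri _ _ _, .tri _ _ _, .tri _ _ _, f, g, hf, hg, _ =>
      obtain ⟨rfl, rfl, hf⟩ := hf
      obtain ⟨rfl, rfl, hg⟩ := hg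
      congr 1
      funext x
      rw [hf x, hg x]
  | .horiz _ _, .horiz _ _, .horiz _ _, f, g, hf, hg, _ =>
      obtain ⟨rfl, hf⟩ := hf
      obtain ⟨rfl, hg⟩ := hg
      congr 1
      funext x
      rw [hf x, hg x]
  | .horiz _ _, .horiz _ _, .tri _ _ _, f, g, hf, hg, _ =>
      obtain ⟨rfl, hf⟩ := hf
      obtain ⟨rfl, hg⟩ := hg
      congr 1
      funext ⟨x⟩
      rw [hf x, hg x]
  | .block _ F _, .block _ G _, .tri _ _ _, f, g, hf, hg, h =>
      obtain ⟨c, rfl, hF, hf⟩ := hf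
      obtain ⟨d, rfl, hG, hg⟩ := hg
      rw [range_of_block_tri W hF hf, range_of_block_tri W hG hg] at h
      obtain rfl : c = d := by
        have : some ⟨c⟩ ∈ ({none, some ⟨d⟩} : Set (Option (ULift.{u} Bool))) := h ▸ Or.inr rfl
        rcases this with h1 | h1
        · cases h1
        · exact congrArg ULift.down (Option.some.inj h1)
      obtain rfl : F = G := hF.trans hG.symm
      congr 1
      funext ⟨x, hx⟩
      rcases (Set.ext_iff.1 hF x).1 hx with h1 | h1
      · rw [(hf ⟨x, hx⟩).1 h1, (hg ⟨x, hx⟩).1 h1]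
      · rw [(hf ⟨x, hx⟩).2 h1, (hg ⟨x, hx⟩).2 h1]
  | .block _ F _, .block _ G _, .block _ _ _, f, g, hf, hg, h =>
      obtain ⟨rfl, hf⟩ := hf
      obtain ⟨rfl, hg⟩ := hg
      have hsub : ∀ (F G : Set (Label X)) (H : Set (Label X)) (f : F → H) (g : G → H),
          (∀ x, (f x).1 = x.1) → (∀ x, (g x).1 = x.1) → Set.range f = Set.range g → F ⊆ G := by
        intro F G H f g hf hg h x hx
        have h1 : f ⟨x, hx⟩ ∈ Set.range g := h ▸ ⟨_, rfl⟩
        obtain ⟨y, hy⟩ := h1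
        have h2 := congrArg Subtype.val hy
        rw [hg, hf] at h2
        exact Set.mem_of_eq_of_mem h2.symm y.2
      obtain rfl : F = G :=
        (hsub F G _ f g hf hg h).antisymm (hsub G F _ g f hg hf h.symm)
      congr 1
      funext x
      exact Subtype.ext ((hf x).trans (hg x).symm)

theorem cellAttach_singleton (W : X.VHStructure) (c : Cell W) (x : CellCorner W c) :
    ∃ (a : Cell W) (f : CellCorner W a → CellCorner W c),
      CellAttach W a c f ∧ Set.range f = {x} := by
  cases hn : cellNode W c x with
  | vtx v => exact ⟨.vtx v, fun _ => x, hn, Set.range_const⟩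
  | ctr s => exact ⟨.ctr s, fun _ => x, hn, Set.range_const⟩
  | mid e =>
    match c, x, hn with
    | .horiz _ _, _, hn => cases hn
    | .tri _ _ _, none, hn => cases hn
    | .tri _ _ _, some _, hn => cases hn
    | .block e' F hF, ⟨.tip _, _⟩, hn => cases hn
    | .block e' F hF, ⟨.sq _ _, _⟩, hn => cases hn
    | .block e' F hF, ⟨.mid, hx⟩, hn =>
      refine ⟨.block e' {Label.mid} ⟨hF.vertical, Set.finite_singleton _, ?_, ?_, Or.inl rfl⟩,
        fun _ => ⟨.mid, hx⟩, ⟨rfl, fun y => y.2.symm⟩, Set.range_const⟩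
      · intro s i h
        cases h
      · rintro ⟨h, -⟩
        cases h

theorem cellAttach_exists (W : X.VHStructure) : ∀ (c : Cell W) (T : Set (CellCorner W c)),
    T.Nonempty → ∃ (a : Cell W) (f : CellCorner W a → CellCorner W c),
      CellAttach W a c f ∧ Set.range f = T := by
  intro c T hT
  by_cases hs : T.Subsingleton
  · obtain ⟨x, rfl⟩ := hs.eq_empty_or_singleton.resolve_left hT.ne_empty
    exact cellAttach_singleton W c x
  by_cases hu : T = Set.univ
  · exact ⟨c, id, cellAttach_id W c, by rw [hu, Set.range_id]⟩
  have hnt : T.Nontrivial := Set.not_subsingleton_iff.1 hs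
  match c, T, hnt, hu with
  | .vtx _, _, ⟨p, _, q, _, h⟩, _ => exact absurd (Subsingleton.elim p q) h
  | .ctr _, _, ⟨p, _, q, _, h⟩, _ => exact absurd (Subsingleton.elim p q) h
  | .horiz _ _, T, ⟨⟨p⟩, hp, ⟨q⟩, hq, h⟩, hu =>
    refine absurd (Set.eq_univ_of_forall fun ⟨x⟩ => ?_) hu
    cases p <;> cases q <;> cases x <;> first | assumption | exact absurd rfl h
  | .block e F hF, T, hT, _ =>
    refine ⟨.block e (Subtype.val '' T) ⟨hF.vertical, hF.finite.subset (by simp), ?_, ?_,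
      Or.inr (hT.image Subtype.val_injective)⟩, fun x => ⟨x.1, ?_⟩, ⟨rfl, fun _ => rfl⟩, ?_⟩
    · rintro s i ⟨x, -, hx⟩
      exact hF.adjacent s i (hx ▸ x.2)
    · rintro ⟨⟨x, -, hx⟩, ⟨y, -, hy⟩⟩
      exact hF.one_tip ⟨hx ▸ x.2, hy ▸ y.2⟩
    · obtain ⟨-, y, -, rfl⟩ := x
      exact y.2
    · ext y
      constructor
      · rintro ⟨⟨-, z, hz, rfl⟩, rfl⟩
        exact hz
      · intro hy
        exact ⟨⟨y.1, y, hy, rfl⟩, rfl⟩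
  | .tri s j hj, T, hT, hu =>
    by_cases h0 : none ∈ T
    · -- the edge from the centre of the square to one end of the horizontal side
      obtain ⟨c, hc⟩ : ∃ c : Bool, some ⟨c⟩ ∈ T := by
        obtain ⟨p, hp, q, hq, h⟩ := hT
        rcases p with _ | ⟨⟨p⟩⟩
        · rcases q with _ | ⟨⟨q⟩⟩
          · exact absurd rfl h
          · exact ⟨q, hq⟩
        · exact ⟨p, hp⟩
      have hc' : some ⟨!c⟩ ∉ T := by
        intro hc'
        refine hu (Set.eq_univ_of_forall fun x => ?_)
        rcases x with _ | ⟨⟨x⟩⟩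
        · exact h0
        · cases c <;> cases x <;> assumption
      have hT' : T = {none, some ⟨c⟩} := by
        ext x
        rcases x with _ | ⟨⟨x⟩⟩
        · simp [h0]
        · cases c <;> cases x <;> simp_all
      have hv : W.vertical (X.bdry s (sideAt j c)).1 := by
        cases c
        · have := W.alternating s (j - 1)
          rw [sub_add_cancel] at this
          by_contra hcon
          exact hj (this.2 hcon)
        · exact (W.alternating s j).2 hj
      classical
      have hF : W.IsBlock (X.bdry s (sideAt j c)).1
          {Label.sq s (sideAt j c), Label.tip (tipAt X s j c)} := by
        refine ⟨hv, by simp, ?_, ?_, Or.inr ⟨_, Or.inl rfl, _, Or.inr rfl, by simp⟩⟩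
        · rintro s' i (h | h)
          · cases h; rfl
          · cases h
        · rintro ⟨h | h, h' | h'⟩
          · cases h
          · cases h
          · cases h'
          · have := h.trans h'.symm
            cases this
      refine ⟨.block _ _ hF, fun x => if x.1 = Label.sq s (sideAt j c) then none else some ⟨c⟩,
        ⟨c, rfl, rfl, fun x => ⟨fun h => if_pos h, fun h => if_neg (by rw [h]; simp)⟩⟩, ?_⟩
      rw [hT']
      exact range_of_block_tri W rfl fun x =>
        ⟨fun h => if_pos h, fun h => if_neg (by rw [h]; simp)⟩
    · -- the horizontal side itself
      have hb : ∀ b : Bool, some ⟨b⟩ ∈ T := by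
        obtain ⟨p, hp, q, hq, h⟩ := hT
        rcases p with _ | ⟨⟨p⟩⟩
        · exact absurd hp h0
        rcases q with _ | ⟨⟨q⟩⟩
        · exact absurd hq h0
        intro b
        cases p <;> cases q <;> cases b <;> first | assumption | exact absurd rfl h
      refine ⟨.horiz _ hj, fun b => some ⟨xor b.down (X.bdry s j).2⟩, ⟨rfl, fun _ => rfl⟩, ?_⟩
      ext x
      constructor
      · rintro ⟨b, rfl⟩
        exact hb _
      · intro hx
        rcases x with _ | ⟨⟨x⟩⟩
        · exact absurd hx h0
        · exact ⟨⟨xor x (X.bdry s j).2⟩, by simp⟩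

theorem finite_cellCorner (W : X.VHStructure) : ∀ c : Cell W, Finite (CellCorner W c)
  | .vtx _ => inferInstanceAs (Finite PUnit)
  | .ctr _ => inferInstanceAs (Finite PUnit)
  | .horiz _ _ => inferInstanceAs (Finite (ULift Bool))
  | .tri _ _ _ => inferInstanceAs (Finite (Option (ULift Bool)))
  | .block _ _ hF => hF.finite

theorem nonempty_cellCorner (W : X.VHStructure) : ∀ c : Cell W, Nonempty (CellCorner W c)
  | .vtx _ => ⟨⟨⟩⟩
  | .ctr _ => ⟨⟨⟩⟩
  | .horiz _ _ => ⟨⟨true⟩⟩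
  | .tri _ _ _ => ⟨none⟩
  | .block _ _ hF => (hF.essential.elim (fun h => ⟨_, h⟩) Set.Nontrivial.nonempty).to_subtype

/-- The simplexification `X*` of a VH-complex `X`. -/
def simplexification (W : X.VHStructure) : GenSimplicialComplex.{u} where
  Simplex := Cell W
  Corner := CellCorner W
  finite_corner := finite_cellCorner W
  nonempty_corner := nonempty_cellCorner W
  Attach := CellAttach W
  injective_of_attach := cellAttach_injective W
  attach_id := cellAttach_id W
  attach_comp := cellAttach_comp W
  existsUnique_face c T hT := by
    obtain ⟨a, f, hf, h⟩ := cellAttach_exists W c T hT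
    exact ⟨⟨a, f⟩, ⟨hf, h⟩, fun ⟨b, g⟩ ⟨hg, h'⟩ => cellAttach_unique W hg hf (h'.trans h.symm)⟩

/-- The map `φ` of `X*` extends the map `f` of `X`: on the vertices `v*`, `s*` and `e*` of `X*` it
is given by the action of `f` on vertices, squares and vertical edges. -/
def Extends (W : X.VHStructure) (φ : W.simplexification.Hom W.simplexification) (f : X.Hom X) :
    Prop :=
  (∀ v, φ.toFun (Cell.vtx v) = Cell.vtx (f.onV v)) ∧
  (∀ s, φ.toFun (Cell.ctr s) = Cell.ctr (f.onS s)) ∧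
  ∀ e he, ∃ he', φ.toFun (Cell.block e {Label.mid} he) = Cell.block (f.onE e) {Label.mid} he'

end VHStructure

end SquareComplex

/-!
The universal cover is built combinatorially. A `LocalSystem` on `X` is a set over the vertices with
bijections along the directed edges that compose to the identity around each square; its total
complex `LocalSystem.total` covers `X`. The local system `universal v₀` consists of the edge paths
starting at `v₀`, modulo having the same transport in every local system. So, by construction, its
total complex has the universal property `HasSections`: whatever can be transported along edges,
without monodromy around squares, can be chosen consistently at all vertices. The automorphisms of
this local system act simply transitively on the fibres (`universal.exists_aut`,
`universal.aut_free`), and the quotient by them is `X`, so that they form the fundamental group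
(`universal.nonempty_fundamentalGroup_mulEquiv`) and are exactly the deck transformations
(`universal.mem_range_deck_iff`).

Both the universal cover and its simplexification are simply connected by the same argument. Path
classes starting at a fixed point are transported along the edges, without monodromy around the
squares, so by the universal property a class ending at each vertex can be chosen consistently. The
choice extends over the cells after composing with a self-map, homotopic to the identity, which
pushes a neighbourhood of each cell into that cell. A loop then leads from the chosen class at its
starting point back to the same class, so it is trivial (`PathClass.simplyConnectedSpace_of_locally`).
For the simplexification (`VHStructure.simplyConnectedSpace_simplexification`), the transport along
an edge of the square complex runs along a path over this edge, and the simplices that have been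
attached create no monodromy because each of them is contractible.

Nonpositive curvature is used only in the following form: since the links of a VH-complex are
bipartite, it says that they have no bigons, a property which passes to coverings. Given this, all
links of the simplexification are flag without induced cycles of length 4 or 5
(`VHStructure.isLocally6Large`), for the following reasons.

* In the link of the midpoint of a vertical edge, the only pair that is not joined is the pair of
  ends of the edge, and the diagonals of a cycle would be two such pairs (`VHStructure.link_mid`).
* The link of the centre of a square consists of two parts like this, for the two vertical sides,
  together with one edge for each horizontal side, which joins two ends of vertical sides. An induced
  cycle in both parts crosses from each end of a side to the other part and has to reach the other
  end of the side in two more steps, so it has length 6 (`VHStructure.link_ctr`).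
* The link of a vertex of the square complex consists of a clique for each vertical edge, made of its
  midpoint and the squares along it, and of the horizontal edges, each joined to the squares it
  bounds. Of three consecutive vertices of an induced cycle exactly one is a horizontal edge, so that
  the length is divisible by 3. A clique is contained in the clique of a vertical edge or, as there
  are no bigons, is a single edge of the link (`VHStructure.link_vtx`).

The simplexification is functorial for maps that are injective on squares, which gives the action
(`LocalSystem.simplicialAction`). It is proper because deck transformations act freely on the nodes
of the square complex, and cocompact because simplices lying over the same simplex data of the
finite complex `X` are in one orbit (`LocalSystem.isGeometric_simplicialAction`).
-/

/-! ### Classes of paths with a fixed starting point -/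

section PathClass

open Topology Path.Homotopic

universe w

instance contractibleSpace_unitInterval : ContractibleSpace unitInterval :=
  (convex_Icc (0 : ℝ) 1).contractibleSpace ⟨0, by simp⟩

variable {Z : Type u} [TopologicalSpace Z]

/-- The homotopy classes of paths that start at `z₀`, each recorded with its end. -/
abbrev PathClass (z₀ : Z) : Type u := (z : Z) × Path.Homotopic.Quotient z₀ z

namespace PathClass

variable {C C' : Type*} [TopologicalSpace C] [TopologicalSpace C']

/-- In the image of a simply connected space `C` there is one class of paths from `f a` to `f b`
coming from `C`. -/
noncomputable def arc [SimplyConnectedSpace C] (f : C(C, Z)) (a b : C) :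
    Path.Homotopic.Quotient (f a) (f b) :=
  (Path.Homotopic.Quotient.mk (PathConnectedSpace.somePath a b)).map f

open Classical in
/-- Prolong a path class that ends at `f a` along the image under `f` of a path from `a` to `b` in
the simply connected space `C`. A class that does not end at `f a` is left alone. -/
noncomputable def move [SimplyConnectedSpace C] {z₀ : Z} (f : C(C, Z)) (a b : C)
    (t : PathClass z₀) : PathClass z₀ :=
  if h : t.1 = f a then ⟨f b, (t.2.cast rfl h.symm).trans (arc f a b)⟩ else t

variable [SimplyConnectedSpace C] [SimplyConnectedSpace C'] {z₀ : Z}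

theorem move_mk (f : C(C, Z)) (a b : C) (c : Path.Homotopic.Quotient z₀ (f a)) :
    move f a b ⟨f a, c⟩ = ⟨f b, c.trans (arc f a b)⟩ := by
  simp [move]

theorem map_eq_arc (f : C(C, Z)) {a b : C} (q : Path.Homotopic.Quotient a b) :
    q.map f = arc f a b :=
  congrArg (fun q : Path.Homotopic.Quotient a b => q.map f) (Subsingleton.elim _ _)

theorem move_fst {f : C(C, Z)} {a b : C} {t : PathClass z₀} (h : t.1 = f a) :
    (move f a b t).1 = f b := by
  simp [move, h]

theorem move_self (f : C(C, Z)) (a : C) (t : PathClass z₀) : move f a a t = t := by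
  by_cases h : t.1 = f a
  · obtain ⟨z, c⟩ := t
    obtain rfl : z = f a := h
    rw [move_mk, ← map_eq_arc f (Path.Homotopic.Quotient.refl a)]
    congr 1
    induction c using Path.Homotopic.Quotient.ind with | mk c => ?_
    change (Path.Homotopic.Quotient.mk c).trans (Path.Homotopic.Quotient.refl _) = _
    simp
  · simp [move, h]

theorem arc_trans_arc (f : C(C, Z)) (a b c : C) : (arc f a b).trans (arc f b c) = arc f a c := by
  rw [← map_eq_arc f ((Path.Homotopic.Quotient.mk (PathConnectedSpace.somePath a b)).trans
    (Path.Homotopic.Quotient.mk (PathConnectedSpace.somePath b c)))]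
  change _ = Path.Homotopic.Quotient.mk (Path.map (Path.trans _ _) _)
  rw [Path.map_trans]
  rfl

theorem move_move (f : C(C, Z)) (a b c : C) {t : PathClass z₀} (h : t.1 = f a) :
    move f b c (move f a b t) = move f a c t := by
  obtain ⟨z, q⟩ := t
  obtain rfl : z = f a := h
  rw [move_mk, move_mk, move_mk, ← arc_trans_arc f a b c]
  congr 1
  simp

theorem move_comp (f : C(C', Z)) (g : C(C, C')) (a b : C) (t : PathClass z₀) :
    move (f.comp g) a b t = move f (g a) (g b) t := by
  by_cases h : t.1 = f (g a)
  · obtain ⟨z, q⟩ := t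
    obtain rfl : z = f (g a) := h
    rw [move_mk f (g a) (g b), ← map_eq_arc f
      ((Path.Homotopic.Quotient.mk (PathConnectedSpace.somePath a b)).map g)]
    exact move_mk (f.comp g) a b q
  · simp [move, h]

theorem move_congr {f g : C(C, Z)} (h : ∀ x, f x = g x) (a b : C) (t : PathClass z₀) :
    move f a b t = move g a b t := by
  rw [ContinuousMap.ext h]

/-- A class that a loop does not change shows that the loop is null-homotopic. -/
theorem homotopic_refl_of_move_eq {z : Z} (γ : Path z z) {t : PathClass z₀} (ht : t.1 = z)
    (h : move γ.toContinuousMap 0 1 t = t) : γ.Homotopic (Path.refl z) := by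
  obtain ⟨_, q⟩ := t
  obtain rfl := ht
  have hcast : ∀ {z a b : Z} (h0 : a = z) (h1 : b = z) (q : Path.Homotopic.Quotient z₀ z)
      (α : Path.Homotopic.Quotient a b), (⟨b, (q.cast rfl h0).trans α⟩ : PathClass z₀) =
        ⟨z, q.trans (α.cast h0.symm h1.symm)⟩ := by
    rintro z _ _ rfl rfl q α
    simp
  have key : move γ.toContinuousMap 0 1 ⟨_, q⟩ = ⟨_, q.trans (Path.Homotopic.Quotient.mk γ)⟩ := by
    have h0 : γ.toContinuousMap 0 = _ := γ.source
    have h1 : γ.toContinuousMap 1 = _ := γ.target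
    have hid : Path.Homotopic.Quotient.mk γ =
        (arc γ.toContinuousMap 0 1).cast h0.symm h1.symm := by
      rw [← map_eq_arc _ (Path.Homotopic.Quotient.mk
        (⟨⟨id, continuous_id⟩, rfl, rfl⟩ : Path (0 : unitInterval) 1))]
      exact congrArg Path.Homotopic.Quotient.mk (by ext; rfl)
    rw [hid]
    unfold move
    rw [dif_pos h0.symm]
    exact hcast h0 h1 q _
  rw [key] at h
  have h2 : q.trans (Path.Homotopic.Quotient.mk γ) = q := eq_of_heq (Sigma.mk.inj h).2
  have h3 : Path.Homotopic.Quotient.mk γ = Path.Homotopic.Quotient.refl _ := by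
    have := congrArg (fun p => q.symm.trans p) h2
    simpa [← Path.Homotopic.Quotient.trans_assoc] using this
  exact Path.Homotopic.Quotient.exact h3

/-- A choice of path classes `q y` ending at `Φ y` is transported along every path `γ` by the class
of `Φ ∘ γ` as soon as this holds locally; locally `Φ` is required to factor through a simply
connected space. -/
theorem eq_move_of_locally {Φ : C(Z, Z)} {q : Z → PathClass z₀} (hq : ∀ y, (q y).1 = Φ y)
    (hloc : ∀ y, ∃ N : Set Z, IsOpen N ∧ y ∈ N ∧ ∃ (C : Type w) (_ : TopologicalSpace C)
      (_ : SimplyConnectedSpace C) (χ : C(C, Z)) (κ : Z → C), ContinuousOn κ N ∧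
        (∀ w ∈ N, Φ w = χ (κ w)) ∧ ∀ w ∈ N, ∀ w' ∈ N, q w' = move χ (κ w) (κ w') (q w))
    (γ : C(unitInterval, Z)) : q (γ 1) = move (Φ.comp γ) 0 1 (q (γ 0)) := by
  set f := Φ.comp γ with hf
  -- transporting `q (γ t)` back to time `0` gives a locally constant function of `t`
  have hlc : IsLocallyConstant fun t => move f t 0 (q (γ t)) := by
    rw [IsLocallyConstant.iff_eventually_eq]
    intro t₀
    obtain ⟨N, hN, ht₀, C, _, _, χ, κ, hκ, hΦ, hqN⟩ := hloc (γ t₀)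
    have hnhds : γ ⁻¹' N ∈ 𝓝 t₀ := (hN.preimage γ.continuous).mem_nhds ht₀
    obtain ⟨ε, hε, hball⟩ := Metric.mem_nhds_iff.1 hnhds
    filter_upwards [Metric.ball_mem_nhds t₀ hε] with t ht
    let J : Set unitInterval := Set.uIcc t₀ t
    have hJ : J ⊆ γ ⁻¹' N := by
      refine fun s hs => hball ?_
      have : dist s t₀ ≤ dist t t₀ := by
        rcases Set.mem_uIcc.1 hs with ⟨h1, h2⟩ | ⟨h1, h2⟩
        · have h1' : (t₀ : ℝ) ≤ s := h1
          have h2' : (s : ℝ) ≤ t := h2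
          rw [Subtype.dist_eq, Subtype.dist_eq, Real.dist_eq, Real.dist_eq,
            abs_of_nonneg (by linarith), abs_of_nonneg (by linarith)]
          linarith
        · have h1' : (t : ℝ) ≤ s := h1
          have h2' : (s : ℝ) ≤ t₀ := h2
          rw [Subtype.dist_eq, Subtype.dist_eq, Real.dist_eq, Real.dist_eq,
            abs_of_nonpos (by linarith), abs_of_nonpos (by linarith)]
          linarith
      exact lt_of_le_of_lt this ht
    -- parametrise the interval between `t₀` and `t` by the convex combinations
    let g : C(unitInterval, unitInterval) :=
      ⟨fun r => ⟨(1 - r) * t₀ + r * t, by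
        have h0 := t₀.2; have h1 := t.2; have h2 := r.2
        constructor
        · have := mul_nonneg (sub_nonneg.2 h2.2) h0.1
          have := mul_nonneg h2.1 h1.1
          linarith
        · nlinarith [h0.1, h0.2, h1.1, h1.2, h2.1, h2.2]⟩, by fun_prop⟩
    have hg0 : g 0 = t₀ := by ext; simp [g]
    have hg1 : g 1 = t := by ext; simp [g]
    have hgJ : ∀ r, g r ∈ J := by
      intro r
      have h2 := r.2
      rcases le_total t₀ t with h | h
      · refine Set.mem_uIcc.2 (Or.inl ⟨?_, ?_⟩)
        · change (t₀ : ℝ) ≤ (1 - r) * t₀ + r * t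
          have h' : (t₀ : ℝ) ≤ t := h
          nlinarith [mul_nonneg h2.1 (sub_nonneg.2 h')]
        · change (1 - r) * t₀ + r * t ≤ (t : ℝ)
          have h' : (t₀ : ℝ) ≤ t := h
          nlinarith [mul_nonneg (sub_nonneg.2 h2.2) (sub_nonneg.2 h')]
      · refine Set.mem_uIcc.2 (Or.inr ⟨?_, ?_⟩)
        · change (t : ℝ) ≤ (1 - r) * t₀ + r * t
          have h' : (t : ℝ) ≤ t₀ := h
          nlinarith [mul_nonneg (sub_nonneg.2 h2.2) (sub_nonneg.2 h')]
        · change (1 - r) * t₀ + r * t ≤ (t₀ : ℝ)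
          have h' : (t : ℝ) ≤ t₀ := h
          nlinarith [mul_nonneg h2.1 (sub_nonneg.2 h')]
    let k : C(unitInterval, C) := ⟨fun r => κ (γ (g r)),
      hκ.comp_continuous (by fun_prop) fun r => hJ (hgJ r)⟩
    have hk : ∀ r, (f.comp g) r = (χ.comp k) r := fun r => hΦ _ (hJ (hgJ r))
    have step : q (γ t) = move f t₀ t (q (γ t₀)) := by
      have h0 : γ t ∈ N := hJ Set.right_mem_uIcc
      rw [hqN _ ht₀ _ h0]
      have e1 := move_comp (z₀ := z₀) f g 0 1 (q (γ t₀))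
      have e2 := move_comp (z₀ := z₀) χ k 0 1 (q (γ t₀))
      rw [move_congr hk, e2, hg0, hg1] at e1
      simp only [k, ContinuousMap.coe_mk, hg0, hg1] at e1
      exact e1
    rw [step, move_move f t₀ t 0 (hq _)]
  have h01 := hlc.apply_eq_of_isPreconnected isPreconnected_univ (Set.mem_univ (1 : unitInterval))
    (Set.mem_univ 0)
  simp only [move_self] at h01
  rw [← h01, move_move f 1 0 1 (hq _), move_self]

/-- A criterion for simple connectedness: a map `Φ` homotopic to the identity, and a choice of path
classes ending at the points `Φ y` which is locally transported by paths. -/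
theorem simplyConnectedSpace_of_locally {Φ : C(Z, Z)}
    (hΦ : (ContinuousMap.id Z).Homotopic Φ) {q : Z → PathClass z₀} (hq : ∀ y, (q y).1 = Φ y)
    (hloc : ∀ y, ∃ N : Set Z, IsOpen N ∧ y ∈ N ∧ ∃ (C : Type w) (_ : TopologicalSpace C)
      (_ : SimplyConnectedSpace C) (χ : C(C, Z)) (κ : Z → C), ContinuousOn κ N ∧
        (∀ w ∈ N, Φ w = χ (κ w)) ∧ ∀ w ∈ N, ∀ w' ∈ N, q w' = move χ (κ w) (κ w') (q w)) :
    SimplyConnectedSpace Z := by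
  obtain ⟨H⟩ := hΦ
  have hj : ∀ y, Joined z₀ y := by
    intro y
    obtain ⟨p⟩ : Nonempty (Path z₀ (q y).1) := ⟨(q y).2.out⟩
    rw [hq] at p
    exact Joined.trans (y := Φ y) ⟨p⟩ ⟨(H.evalAt y).symm⟩
  rw [simply_connected_iff_loops_nullhomotopic]
  refine ⟨⟨⟨z₀⟩, fun x y => (hj x).symm.trans (hj y)⟩, fun y γ => ?_⟩
  have h1 := eq_move_of_locally hq hloc γ.toContinuousMap
  have hγ : (γ.map Φ.continuous).Homotopic (Path.refl (Φ y)) := by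
    refine homotopic_refl_of_move_eq (γ.map Φ.continuous) (hq y) ?_
    have e0 : γ.toContinuousMap 0 = y := γ.source
    have e1 : γ.toContinuousMap 1 = y := γ.target
    rw [e0, e1] at h1
    exact h1.symm
  have h2 := Path.Homotopic.map_trans_evalAt H γ
  have h3 : (Path.Homotopic.Quotient.mk γ).trans (Path.Homotopic.Quotient.mk (H.evalAt y)) =
      Path.Homotopic.Quotient.mk (H.evalAt y) := by
    have e : Path.Homotopic.Quotient.mk (γ.map Φ.continuous) =
      Path.Homotopic.Quotient.refl _ := Path.Homotopic.Quotient.eq.2 hγ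
    have h2' := Path.Homotopic.Quotient.eq.2 h2
    simp only [Path.Homotopic.Quotient.mk_trans] at h2'
    rw [e] at h2'
    simp only [Path.Homotopic.Quotient.trans_refl] at h2'
    exact h2'
  refine Path.Homotopic.Quotient.exact ?_
  have := congrArg (fun p => p.trans (Path.Homotopic.Quotient.mk (H.evalAt y)).symm) h3
  simpa [Path.Homotopic.Quotient.trans_assoc] using this

end PathClass

end PathClass

/-! ### The topology of a square complex -/

open Topology

namespace SquareComplex

/-- The reversal of `[0,1]` for `b = true`, the identity for `b = false`. -/
def flip (b : Bool) (t : unitInterval) : unitInterval := if b then unitInterval.symm t else t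

@[simp] theorem flip_flip (b : Bool) (t : unitInterval) : flip b (flip b t) = t := by
  cases b <;> simp [flip]

@[fun_prop] theorem continuous_flip (b : Bool) : Continuous (flip b) := by
  cases b
  · exact continuous_id
  · exact unitInterval.continuous_symm

/-- The coordinates of a point of the square with respect to its `i`-th side: the parameter along
the side and the distance from it. -/
def rot (i : Fin 4) (z : unitInterval × unitInterval) : unitInterval × unitInterval :=
  match i with
  | 0 => z
  | 1 => (z.2, unitInterval.symm z.1)
  | 2 => (unitInterval.symm z.1, unitInterval.symm z.2)
  | 3 => (unitInterval.symm z.2, z.1)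

@[fun_prop] theorem continuous_rot (i : Fin 4) : Continuous (rot i) := by
  match i with
  | 0 | 1 | 2 | 3 => unfold rot; fun_prop

@[fun_prop] theorem continuous_sidePoint (i : Fin 4) : Continuous (sidePoint i) := by
  match i with
  | 0 | 1 | 2 | 3 => unfold sidePoint; fun_prop

theorem rot_sidePoint (i : Fin 4) (t : unitInterval) : rot i (sidePoint i t) = (t, 0) ∧
    rot (i + 1) (sidePoint i t) = (0, unitInterval.symm t) ∧
    rot (i + 2) (sidePoint i t) = (unitInterval.symm t, 1) ∧
    rot (i + 3) (sidePoint i t) = (1, t) := by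
  match i with
  | 0 | 1 | 2 | 3 => simp [rot, sidePoint]

theorem eq_sidePoint_of_rot {i : Fin 4} {z : unitInterval × unitInterval}
    (h : (rot i z).2 = 0) : z = sidePoint i (rot i z).1 := by
  obtain ⟨x, y⟩ := z
  match i with
  | 0 | 1 | 2 | 3 => simp_all [rot, sidePoint]

theorem fin4_cases (i k : Fin 4) : k = i ∨ k = i + 1 ∨ k = i + 2 ∨ k = i + 3 := by
  revert i k; decide

/-- The homotopy, with time `r`, from the identity of `[0,1]` to the map that is constant on
`[0,1/3]` and on `[2/3,1]`. -/
def push (r t : unitInterval) : unitInterval :=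
  ⟨(1 - (r : ℝ)) * t + r * max 0 (min 1 (3 * (t : ℝ) - 1)), by
    have h1 : (0 : ℝ) ≤ max 0 (min 1 (3 * (t : ℝ) - 1)) := le_max_left _ _
    have h2 : max 0 (min 1 (3 * (t : ℝ) - 1)) ≤ 1 := max_le zero_le_one (min_le_left _ _)
    have hr := r.2
    have ht := t.2
    constructor
    · exact add_nonneg (mul_nonneg (sub_nonneg.2 hr.2) ht.1) (mul_nonneg hr.1 h1)
    · nlinarith [mul_nonneg (sub_nonneg.2 hr.2) (sub_nonneg.2 ht.2),
        mul_nonneg hr.1 (sub_nonneg.2 h2)]⟩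

theorem continuous_push : Continuous fun p : unitInterval × unitInterval => push p.1 p.2 := by
  unfold push; fun_prop

theorem continuous_push_right (r : unitInterval) : Continuous (push r) :=
  continuous_push.comp (Continuous.prodMk_right r)

@[simp] theorem push_zero_left (t : unitInterval) : push 0 t = t := by ext; simp [push]

@[simp] theorem push_zero (r : unitInterval) : push r 0 = 0 := by ext; simp [push]

@[simp] theorem push_one (r : unitInterval) : push r 1 = 1 := by ext; norm_num [push]

theorem push_symm (r t : unitInterval) :
    push r (unitInterval.symm t) = unitInterval.symm (push r t) := by
  ext
  simp only [push, unitInterval.coe_symm_eq]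
  rcases le_total (t : ℝ) (1 / 3) with h | h
  · rw [min_eq_left (by linarith), max_eq_right (by linarith), min_eq_right (by linarith),
      max_eq_left (by linarith)]
    ring
  rcases le_total (t : ℝ) (2 / 3) with h' | h'
  · rw [min_eq_right (by linarith), max_eq_right (by linarith), min_eq_right (by linarith),
      max_eq_right (by linarith)]
    ring
  · rw [min_eq_right (by linarith), max_eq_left (by linarith), min_eq_left (by linarith),
      max_eq_right (by linarith)]
    ring

theorem push_flip (r : unitInterval) (b : Bool) (t : unitInterval) :
    push r (flip b t) = flip b (push r t) := by
  cases b
  · rfl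
  · exact push_symm r t

theorem push_one_of_lt {t : unitInterval} (h : (t : ℝ) < 1 / 3) : push 1 t = 0 := by
  ext
  simp only [push, Set.Icc.coe_one, sub_self, zero_mul, zero_add, one_mul,
    Set.Icc.coe_zero]
  rw [min_eq_right (by linarith), max_eq_left (by linarith)]

theorem push_prod_sidePoint (r : unitInterval) (i : Fin 4) (t : unitInterval) :
    (push r (sidePoint i t).1, push r (sidePoint i t).2) = sidePoint i (push r t) := by
  match i with
  | 0 | 1 | 2 | 3 => simp [sidePoint, push_symm]

theorem rot_push (r : unitInterval) (i : Fin 4) (z : unitInterval × unitInterval) :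
    rot i (push r z.1, push r z.2) = (push r (rot i z).1, push r (rot i z).2) := by
  match i with
  | 0 | 1 | 2 | 3 => simp [rot, push_symm]

variable (X : SquareComplex.{u})

/-- The point of the realisation at a vertex. -/
def pointV (v : X.V) : X.Realization := Quot.mk _ (Sum.inl ⟨v, ⟨⟩⟩)

/-- The characteristic map of an edge. -/
def charE (e : X.E) : C(unitInterval, X.Realization) :=
  ⟨fun t => Quot.mk _ (Sum.inr (Sum.inl ⟨e, t⟩)), continuous_quot_mk.comp
    (continuous_inr.comp (continuous_inl.comp continuous_sigmaMk))⟩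

/-- The characteristic map of a square. -/
def charS (s : X.S) : C(unitInterval × unitInterval, X.Realization) :=
  ⟨fun z => Quot.mk _ (Sum.inr (Sum.inr ⟨s, z⟩)), continuous_quot_mk.comp
    (continuous_inr.comp (continuous_inr.comp continuous_sigmaMk))⟩

variable {X}

theorem charE_end (e : X.E) (b : Bool) :
    X.charE e (if b then 1 else 0) = X.pointV (X.endpt e b) :=
  Quot.sound (Glue.edge e b)

theorem charS_side (s : X.S) (i : Fin 4) (t : unitInterval) :
    X.charS s (sidePoint i t) = X.charE (X.bdry s i).1 (flip (X.bdry s i).2 t) :=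
  Quot.sound (Glue.square s i t)

theorem charE_flip_zero (d : X.E × Bool) : X.charE d.1 (flip d.2 0) = X.pointV (X.src d) := by
  rw [src, ← charE_end]
  cases h : d.2 <;> simp [flip]

theorem charE_flip_one (d : X.E × Bool) :
    X.charE d.1 (flip d.2 1) = X.pointV (X.src (X.rev d)) := by
  rw [src, ← charE_end]
  cases h : d.2 <;> simp [flip, rev, h]

theorem charS_corner (s : X.S) (i : Fin 4) :
    X.charS s (sidePoint i 0) = X.pointV (X.corner s i) := by
  rw [charS_side, charE_flip_zero]; rfl

theorem corner_succ (s : X.S) (i : Fin 4) : X.corner s (i + 1) = X.src (X.rev (X.bdry s i)) :=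
  (X.bdry_closed s i).symm

theorem sidePoint_one (i : Fin 4) : sidePoint i 1 = sidePoint (i + 1) 0 := by
  match i with
  | 0 | 1 | 2 | 3 => simp [sidePoint]

/-! ### Neighbourhoods of the cells -/

/-- The open neighbourhood of a vertex that consists of the corners of size `1/3`, which are the
corners that `push 1` contracts to the vertex. -/
def NearV (v : X.V) : X.Cells → Prop
  | Sum.inl ⟨w, _⟩ => w = v
  | Sum.inr (Sum.inl ⟨e, t⟩) => ∃ b, X.endpt e b = v ∧ (flip b t : ℝ) < 1 / 3
  | Sum.inr (Sum.inr ⟨s, z⟩) =>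
      ∃ i, X.corner s i = v ∧ ((rot i z).1 : ℝ) < 1 / 3 ∧ ((rot i z).2 : ℝ) < 1 / 3

/-- The open neighbourhood of the middle part of an edge that consists of strips of width `1/4`.
They have to be narrower than `1/3`, so that `push 1` takes them into the edge, and narrow enough
for the strips at different sides of a square to be disjoint; together with the corners of
size `1/3` they cover the edge. -/
def NearE (e : X.E) : X.Cells → Prop
  | Sum.inl _ => False
  | Sum.inr (Sum.inl ⟨e', t⟩) => e' = e ∧ 1 / 4 < (t : ℝ) ∧ (t : ℝ) < 3 / 4
  | Sum.inr (Sum.inr ⟨s, z⟩) => ∃ i, (X.bdry s i).1 = e ∧ 1 / 4 < ((rot i z).1 : ℝ) ∧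
      ((rot i z).1 : ℝ) < 3 / 4 ∧ ((rot i z).2 : ℝ) < 1 / 4

/-- The interior of a square. -/
def NearS (s : X.S) : X.Cells → Prop
  | Sum.inl _ => False
  | Sum.inr (Sum.inl _) => False
  | Sum.inr (Sum.inr ⟨s', z⟩) =>
      s' = s ∧ 0 < (z.1 : ℝ) ∧ (z.1 : ℝ) < 1 ∧ 0 < (z.2 : ℝ) ∧ (z.2 : ℝ) < 1

/-- The neighbourhood of a cell. -/
def Near : X.V ⊕ X.E ⊕ X.S → X.Cells → Prop
  | Sum.inl v => NearV v
  | Sum.inr (Sum.inl e) => NearE e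
  | Sum.inr (Sum.inr s) => NearS s

theorem nearV_glue (v : X.V) {c c' : X.Cells} (h : X.Glue c c') : NearV v c ↔ NearV v c' := by
  cases h with
  | edge e b =>
    simp only [NearV]
    constructor
    · rintro ⟨b', h, h'⟩
      cases b <;> cases b' <;> simp_all [flip] <;> linarith
    · intro h
      exact ⟨b, h, by cases b <;> simp [flip]⟩
  | square s i t =>
    obtain ⟨h0, h1, h2, h3⟩ := rot_sidePoint i t
    simp only [NearV]
    constructor
    · rintro ⟨k, hk, hk1, hk2⟩
      rcases fin4_cases i k with rfl | rfl | rfl | rfl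
      · rw [h0] at hk1
        refine ⟨(X.bdry s k).2, hk, ?_⟩
        exact lt_of_eq_of_lt (congrArg _ (flip_flip _ t)) hk1
      · rw [h1] at hk2
        refine ⟨!(X.bdry s i).2, (X.bdry_closed s i).trans hk, lt_of_eq_of_lt ?_ hk2⟩
        cases (X.bdry s i).2 <;> simp [flip]
      · rw [h2] at hk2
        norm_num at hk2
      · rw [h3] at hk1
        norm_num at hk1
    · rintro ⟨b, hb, hb'⟩
      by_cases h : b = (X.bdry s i).2
      · subst h
        refine ⟨i, hb, ?_⟩
        rw [h0]
        refine ⟨lt_of_eq_of_lt (congrArg _ (flip_flip _ t).symm) hb', by norm_num⟩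
      · obtain rfl : b = !(X.bdry s i).2 := by
          cases b <;> cases h' : (X.bdry s i).2 <;> simp_all
        refine ⟨i + 1, (X.bdry_closed s i).symm.trans hb, ?_⟩
        rw [h1]
        refine ⟨by norm_num, lt_of_eq_of_lt ?_ hb'⟩
        cases (X.bdry s i).2 <;> simp [flip]

theorem nearE_glue (e : X.E) {c c' : X.Cells} (h : X.Glue c c') : NearE e c ↔ NearE e c' := by
  cases h with
  | edge e b =>
    simp only [NearE, iff_false, not_and]
    rintro - h h'
    cases b <;> simp at h h' <;> linarith
  | square s i t =>
    obtain ⟨h0, h1, h2, h3⟩ := rot_sidePoint i t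
    simp only [NearE]
    have hf : ∀ b, (1 / 4 < (flip b t : ℝ) ∧ (flip b t : ℝ) < 3 / 4) ↔
        1 / 4 < (t : ℝ) ∧ (t : ℝ) < 3 / 4 := by
      rintro (_ | _)
      · rfl
      · simp only [flip, if_true, unitInterval.coe_symm_eq]
        constructor <;> rintro ⟨h, h'⟩ <;> constructor <;> linarith
    change _ ↔ _ ∧ 1 / 4 < (flip _ t : ℝ) ∧ (flip _ t : ℝ) < 3 / 4
    rw [hf]
    constructor
    · rintro ⟨k, hk, hk1, hk2, hk3⟩
      rcases fin4_cases i k with rfl | rfl | rfl | rfl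
      · rw [h0] at hk1 hk2
        exact ⟨hk, hk1, hk2⟩
      · rw [h1] at hk1
        norm_num at hk1
      · rw [h2] at hk3
        norm_num at hk3
      · rw [h3] at hk2
        norm_num at hk2
    · rintro ⟨h, h'⟩
      refine ⟨i, h, ?_⟩
      rw [h0]
      exact ⟨h'.1, h'.2, by norm_num⟩

theorem nearS_glue (s : X.S) {c c' : X.Cells} (h : X.Glue c c') : NearS s c ↔ NearS s c' := by
  cases h with
  | edge e b => rfl
  | square s i t =>
    simp only [NearS, iff_false, not_and]
    rintro - h1 h2 h3 h4
    match i with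
    | 0 | 1 | 2 | 3 => simp [sidePoint] at h1 h2 h3 h4

theorem near_glue (a : X.V ⊕ X.E ⊕ X.S) {c c' : X.Cells} (h : X.Glue c c') :
    Near a c ↔ Near a c' :=
  match a with
  | Sum.inl v => nearV_glue v h
  | Sum.inr (Sum.inl e) => nearE_glue e h
  | Sum.inr (Sum.inr s) => nearS_glue s h

/-- The neighbourhood of a cell in the realisation. -/
def nbhd (a : X.V ⊕ X.E ⊕ X.S) : Set X.Realization :=
  {y | Quot.lift (Near a) (fun _ _ h => propext (near_glue a h)) y}

theorem mk_mem_nbhd {a : X.V ⊕ X.E ⊕ X.S} {c : X.Cells} :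
    (Quot.mk _ c : X.Realization) ∈ nbhd a ↔ Near a c := Iff.rfl

theorem isOpen_near (a : X.V ⊕ X.E ⊕ X.S) : IsOpen {c : X.Cells | Near a c} := by
  refine isOpen_sum_iff.2 ⟨isOpen_sigma_iff.2 fun w => isOpen_discrete _,
    isOpen_sum_iff.2 ⟨isOpen_sigma_iff.2 fun e => ?_, isOpen_sigma_iff.2 fun s => ?_⟩⟩
  · rcases a with v | e' | s
    · change IsOpen {t | ∃ b, X.endpt e b = v ∧ (flip b t : ℝ) < 1 / 3}
      simp only [Set.ofPred_exists]
      exact isOpen_iUnion fun b => isOpen_const.and (isOpen_lt (by fun_prop) (by fun_prop))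
    · change IsOpen {t : unitInterval | e = e' ∧ 1 / 4 < (t : ℝ) ∧ (t : ℝ) < 3 / 4}
      exact isOpen_const.and ((isOpen_lt (by fun_prop) (by fun_prop)).and
        (isOpen_lt (by fun_prop) (by fun_prop)))
    · exact isOpen_const
  · rcases a with v | e' | s'
    · change IsOpen {z | ∃ i, X.corner s i = v ∧ ((rot i z).1 : ℝ) < 1 / 3 ∧
        ((rot i z).2 : ℝ) < 1 / 3}
      simp only [Set.ofPred_exists]
      exact isOpen_iUnion fun i => isOpen_const.and
        ((isOpen_lt (by fun_prop) (by fun_prop)).and (isOpen_lt (by fun_prop) (by fun_prop)))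
    · change IsOpen {z | ∃ i, (X.bdry s i).1 = e' ∧ 1 / 4 < ((rot i z).1 : ℝ) ∧
        ((rot i z).1 : ℝ) < 3 / 4 ∧ ((rot i z).2 : ℝ) < 1 / 4}
      simp only [Set.ofPred_exists]
      exact isOpen_iUnion fun i => isOpen_const.and
        ((isOpen_lt (by fun_prop) (by fun_prop)).and
        ((isOpen_lt (by fun_prop) (by fun_prop)).and (isOpen_lt (by fun_prop) (by fun_prop))))
    · change IsOpen {z : unitInterval × unitInterval |
        s = s' ∧ 0 < (z.1 : ℝ) ∧ (z.1 : ℝ) < 1 ∧ 0 < (z.2 : ℝ) ∧ (z.2 : ℝ) < 1}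
      exact isOpen_const.and ((isOpen_lt (by fun_prop) (by fun_prop)).and
        ((isOpen_lt (by fun_prop) (by fun_prop)).and
        ((isOpen_lt (by fun_prop) (by fun_prop)).and (isOpen_lt (by fun_prop) (by fun_prop)))))

theorem isOpen_nbhd (a : X.V ⊕ X.E ⊕ X.S) : IsOpen (nbhd a) :=
  isQuotientMap_quot_mk.isOpen_preimage.1 (isOpen_near a)

theorem quadrant_unique {i k : Fin 4} {z : unitInterval × unitInterval}
    (h : ((rot i z).1 : ℝ) < 1 / 3 ∧ ((rot i z).2 : ℝ) < 1 / 3)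
    (h' : ((rot k z).1 : ℝ) < 1 / 3 ∧ ((rot k z).2 : ℝ) < 1 / 3) : i = k := by
  match i, k with
  | 0, 0 | 1, 1 | 2, 2 | 3, 3 => rfl
  | 0, 1 | 0, 2 | 0, 3 | 1, 0 | 1, 2 | 1, 3 | 2, 0 | 2, 1 | 2, 3 | 3, 0 | 3, 1 | 3, 2 =>
    simp only [rot, unitInterval.coe_symm_eq] at h h'
    linarith [h.1, h.2, h'.1, h'.2]

theorem strip_unique {i k : Fin 4} {z : unitInterval × unitInterval}
    (h : 1 / 4 < ((rot i z).1 : ℝ) ∧ ((rot i z).1 : ℝ) < 3 / 4 ∧ ((rot i z).2 : ℝ) < 1 / 4)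
    (h' : 1 / 4 < ((rot k z).1 : ℝ) ∧ ((rot k z).1 : ℝ) < 3 / 4 ∧ ((rot k z).2 : ℝ) < 1 / 4) :
    i = k := by
  match i, k with
  | 0, 0 | 1, 1 | 2, 2 | 3, 3 => rfl
  | 0, 1 | 0, 2 | 0, 3 | 1, 0 | 1, 2 | 1, 3 | 2, 0 | 2, 1 | 2, 3 | 3, 0 | 3, 1 | 3, 2 =>
    simp only [rot, unitInterval.coe_symm_eq] at h h'
    linarith [h.1, h.2.1, h.2.2, h'.1, h'.2.1, h'.2.2]

theorem flip_unique {b b' : Bool} {t : unitInterval} (h : (flip b t : ℝ) < 1 / 3)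
    (h' : (flip b' t : ℝ) < 1 / 3) : b = b' := by
  cases b <;> cases b' <;> simp [flip] at h h' ⊢ <;> linarith

/-- The neighbourhoods of two different cells of the same dimension are disjoint. -/
theorem near_unique {c : X.Cells} :
    (∀ v v' : X.V, NearV v c → NearV v' c → v = v') ∧
    (∀ e e' : X.E, NearE e c → NearE e' c → e = e') ∧
    ∀ s s' : X.S, NearS s c → NearS s' c → s = s' := by
  refine ⟨fun v v' h h' => ?_, fun e e' h h' => ?_, fun s s' h h' => ?_⟩
  · rcases c with ⟨w, _⟩ | ⟨e, t⟩ | ⟨s, z⟩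
    · exact h.symm.trans h'
    · obtain ⟨b, rfl, hb⟩ := h
      obtain ⟨b', rfl, hb'⟩ := h'
      rw [flip_unique hb hb']
    · obtain ⟨i, rfl, hi⟩ := h
      obtain ⟨k, rfl, hk⟩ := h'
      rw [quadrant_unique hi hk]
  · rcases c with ⟨w, _⟩ | ⟨e, t⟩ | ⟨s, z⟩
    · exact h.elim
    · exact h.1.symm.trans h'.1
    · obtain ⟨i, rfl, hi⟩ := h
      obtain ⟨k, rfl, hk⟩ := h'
      rw [strip_unique hi hk]
  · rcases c with ⟨w, _⟩ | ⟨e, t⟩ | ⟨s, z⟩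
    · exact h.elim
    · exact h.elim
    · exact h.1.symm.trans h'.1

theorem exists_near_edge (e : X.E) (t : unitInterval) :
    ∃ a, Near a (Sum.inr (Sum.inl ⟨e, t⟩) : X.Cells) := by
  rcases lt_or_ge (t : ℝ) (1 / 3) with h | h
  · exact ⟨Sum.inl (X.endpt e false), false, rfl, h⟩
  rcases lt_or_ge (2 / 3 : ℝ) t with h' | h'
  · refine ⟨Sum.inl (X.endpt e true), true, rfl, ?_⟩
    simp only [flip, if_true, unitInterval.coe_symm_eq]
    linarith
  · exact ⟨Sum.inr (Sum.inl e), rfl, by linarith, by linarith⟩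

theorem exists_near (c : X.Cells) : ∃ a, Near a c := by
  rcases c with ⟨w, x⟩ | ⟨e, t⟩ | ⟨s, z⟩
  · exact ⟨Sum.inl w, rfl⟩
  · exact exists_near_edge e t
  · by_cases h : ∃ i, (rot i z).2 = 0
    · obtain ⟨i, hi⟩ := h
      obtain ⟨a, ha⟩ := exists_near_edge (X.bdry s i).1 (flip (X.bdry s i).2 (rot i z).1)
      refine ⟨a, ?_⟩
      have := (near_glue a (Glue.square s i (rot i z).1)).2 ha
      rwa [← eq_sidePoint_of_rot hi] at this
    · push Not at h
      refine ⟨Sum.inr (Sum.inr s), rfl, ?_, ?_, ?_, ?_⟩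
      · exact unitInterval.pos_iff_ne_zero.2 (h 3)
      · exact unitInterval.lt_one_iff_ne_one.2 fun hz => h 1 (by simp [rot, hz])
      · exact unitInterval.pos_iff_ne_zero.2 (h 0)
      · exact unitInterval.lt_one_iff_ne_one.2 fun hz => h 2 (by simp [rot, hz])

/-- The map of cells induced by a combinatorial map. -/
def Hom.onIndex {Y X : SquareComplex.{u}} (p : Y.Hom X) : Y.V ⊕ Y.E ⊕ Y.S → X.V ⊕ X.E ⊕ X.S :=
  Sum.map p.onV (Sum.map p.onE p.onS)

theorem Hom.corner_onS {Y X : SquareComplex.{u}} (p : Y.Hom X) (s : Y.S) (i : Fin 4) :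
    X.corner (p.onS s) i = p.onV (Y.corner s i) := by
  rw [corner, src, p.bdry_onS, p.endpt_onE]; rfl

theorem near_onCells {Y X : SquareComplex.{u}} (p : Y.Hom X) {a : Y.V ⊕ Y.E ⊕ Y.S} {c : Y.Cells}
    (h : Near a c) : Near (p.onIndex a) (p.onCells c) := by
  rcases a with v | e | s <;> rcases c with ⟨w, _⟩ | ⟨e', t⟩ | ⟨s', z⟩
  · exact congrArg _ h
  · obtain ⟨b, rfl, hb⟩ := h
    exact ⟨b, p.endpt_onE _ _, hb⟩
  · obtain ⟨i, rfl, hi⟩ := h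
    exact ⟨i, p.corner_onS _ _, hi⟩
  · exact h
  · obtain ⟨rfl, h⟩ := h
    exact ⟨rfl, h⟩
  · obtain ⟨i, rfl, hi⟩ := h
    exact ⟨i, by rw [p.bdry_onS], hi⟩
  · exact h
  · exact h
  · obtain ⟨rfl, h⟩ := h
    exact ⟨rfl, h⟩

end SquareComplex

/-! ### Simple connectedness of a square complex from transport along its edges -/

open Topology

/-- A homotopy on a quotient space may be given by a continuous family of paths. -/
theorem continuous_quot_lift_path {α γ : Type*} [TopologicalSpace α] [TopologicalSpace γ]
    {r : α → α → Prop} (F : α → C(unitInterval, γ)) (hF : Continuous F)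
    (h : ∀ a b, r a b → F a = F b) :
    Continuous fun p : unitInterval × Quot r => Quot.lift F h p.2 p.1 := by
  have : Continuous (Quot.lift F h) := continuous_quot_lift h hF
  fun_prop

namespace SquareComplex

variable {X : SquareComplex.{u}}

/-- The paths in the realisation along which the cells are pushed onto their faces. -/
def pushPath : X.Cells → C(unitInterval, X.Realization)
  | Sum.inl ⟨v, _⟩ => ContinuousMap.const _ (X.pointV v)
  | Sum.inr (Sum.inl ⟨e, t⟩) =>
      ⟨fun r => X.charE e (push r t), (X.charE e).continuous.comp
        (continuous_push.comp (Continuous.prodMk_left t))⟩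
  | Sum.inr (Sum.inr ⟨s, z⟩) =>
      ⟨fun r => X.charS s (push r z.1, push r z.2), (X.charS s).continuous.comp
        ((continuous_push.comp (Continuous.prodMk_left z.1)).prodMk
          (continuous_push.comp (Continuous.prodMk_left z.2)))⟩

theorem continuous_pushPath : Continuous (pushPath (X := X)) := by
  refine continuous_sum_dom.2 ⟨continuous_sigma fun v => continuous_of_discreteTopology,
    continuous_sum_dom.2 ⟨continuous_sigma fun e => ?_, continuous_sigma fun s => ?_⟩⟩
  · exact (ContinuousMap.curry ⟨fun p : unitInterval × unitInterval => X.charE e (push p.2 p.1),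
      (X.charE e).continuous.comp (continuous_push.comp continuous_swap)⟩).continuous
  · exact (ContinuousMap.curry ⟨fun p : (unitInterval × unitInterval) × unitInterval =>
      X.charS s (push p.2 p.1.1, push p.2 p.1.2), (X.charS s).continuous.comp
        ((continuous_push.comp (by fun_prop : Continuous fun p : (unitInterval × unitInterval) ×
          unitInterval => (p.2, p.1.1))).prodMk (continuous_push.comp (by fun_prop :
          Continuous fun p : (unitInterval × unitInterval) × unitInterval =>
            (p.2, p.1.2))))⟩).continuous

theorem pushPath_glue (c c' : X.Cells) (h : X.Glue c c') : pushPath c = pushPath c' := by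
  ext r
  cases h with
  | edge e b =>
    change X.charE e (push r _) = X.pointV _
    rw [← charE_end]
    cases b <;> simp
  | square s i t =>
    change X.charS s (push r _, push r _) = X.charE _ (push r (flip _ t))
    rw [push_prod_sidePoint, charS_side, push_flip]

theorem isOpenEmbedding_edge (e : X.E) :
    IsOpenEmbedding fun t : unitInterval => (Sum.inr (Sum.inl ⟨e, t⟩) : X.Cells) :=
  IsOpenEmbedding.inr.comp (IsOpenEmbedding.inl.comp
    (IsOpenEmbedding.sigmaMk (σ := fun _ : X.E => unitInterval) (i := e)))

theorem isOpenEmbedding_square (s : X.S) : IsOpenEmbedding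
    fun z : unitInterval × unitInterval => (Sum.inr (Sum.inr ⟨s, z⟩) : X.Cells) :=
  IsOpenEmbedding.inr.comp (IsOpenEmbedding.inr.comp
    (IsOpenEmbedding.sigmaMk (σ := fun _ : X.S => unitInterval × unitInterval) (i := s)))

/-- The homotopy from the identity of the realisation to the map that pushes the neighbourhood of
each cell into that cell. -/
def pushHomotopy (X : SquareComplex.{u}) : C(unitInterval × X.Realization, X.Realization) :=
  ⟨fun p => Quot.lift pushPath pushPath_glue p.2 p.1,
    continuous_quot_lift_path _ continuous_pushPath _⟩

/-- The map that pushes the neighbourhood of each cell into that cell. -/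
def pushMap (X : SquareComplex.{u}) : C(X.Realization, X.Realization) :=
  X.pushHomotopy.comp ⟨fun y => (1, y), by fun_prop⟩

theorem id_homotopic_pushMap (X : SquareComplex.{u}) :
    (ContinuousMap.id X.Realization).Homotopic X.pushMap := by
  refine ⟨⟨X.pushHomotopy, fun y => ?_, fun _ => rfl⟩⟩
  induction y using Quot.ind with | mk c => ?_
  rcases c with ⟨w, _⟩ | ⟨e, t⟩ | ⟨s, z⟩
  · rfl
  · change X.charE e (push 0 t) = X.charE e t
    rw [push_zero_left]
  · change X.charS s (push 0 z.1, push 0 z.2) = X.charS s z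
    rw [push_zero_left, push_zero_left]

instance contractibleSpace_unitSquare : ContractibleSpace (unitInterval × unitInterval) :=
  inferInstance

/-- A choice of path classes ending at the vertices that is transported along the edges. -/
structure Transported {z₀ : X.Realization} (w : X.V → PathClass z₀) : Prop where
  fst : ∀ v, (w v).1 = X.pointV v
  move : ∀ e, w (X.endpt e true) = PathClass.move (X.charE e) 0 1 (w (X.endpt e false))

namespace Transported

open PathClass

variable {z₀ : X.Realization} {w : X.V → PathClass z₀}

/-- The transported classes at the points of an edge. -/
noncomputable def onE (w : X.V → PathClass z₀) (e : X.E) (t : unitInterval) : PathClass z₀ :=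
  PathClass.move (X.charE e) 0 t (w (X.endpt e false))

/-- The transported classes at the points of a square. -/
noncomputable def onS (w : X.V → PathClass z₀) (s : X.S) (z : unitInterval × unitInterval) :
    PathClass z₀ :=
  PathClass.move (X.charS s) (sidePoint 0 0) z (w (X.corner s 0))

variable (hw : Transported w)
include hw

theorem fst_false (e : X.E) : (w (X.endpt e false)).1 = X.charE e 0 :=
  (hw.fst _).trans (charE_end e false).symm

theorem fst_corner (s : X.S) (i : Fin 4) : (w (X.corner s i)).1 = X.charS s (sidePoint i 0) :=
  (hw.fst _).trans (charS_corner s i).symm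

theorem onE_fst (e : X.E) (t : unitInterval) : (onE w e t).1 = X.charE e t :=
  move_fst (hw.fst_false e)

theorem onS_fst (s : X.S) (z : unitInterval × unitInterval) : (onS w s z).1 = X.charS s z :=
  move_fst (hw.fst_corner s 0)

theorem move_onE (e : X.E) (t t' : unitInterval) :
    PathClass.move (X.charE e) t t' (onE w e t) = onE w e t' :=
  move_move _ _ _ _ (hw.fst_false e)

theorem move_onS (s : X.S) (z z' : unitInterval × unitInterval) :
    PathClass.move (X.charS s) z z' (onS w s z) = onS w s z' :=
  move_move _ _ _ _ (hw.fst_corner s 0)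

theorem onE_end (e : X.E) (b : Bool) : onE w e (if b then 1 else 0) = w (X.endpt e b) := by
  cases b
  · exact move_self _ _ _
  · exact (hw.move e).symm

theorem onE_dart (d : X.E × Bool) : onE w d.1 (flip d.2 0) = w (X.src d) := by
  rw [src, ← hw.onE_end]
  cases h : d.2 <;> simp [flip]

theorem onE_dart_one (d : X.E × Bool) : onE w d.1 (flip d.2 1) = w (X.src (X.rev d)) := by
  rw [← hw.onE_dart]
  cases h : d.2 <;> simp [flip, rev, h]

omit hw in
/-- Transport along a side of a square, computed in the square and in the edge. -/
theorem move_side (s : X.S) (i : Fin 4) (t t' : unitInterval) (c : PathClass z₀) :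
    PathClass.move (X.charS s) (sidePoint i t) (sidePoint i t') c =
      PathClass.move (X.charE (X.bdry s i).1) (flip (X.bdry s i).2 t)
        (flip (X.bdry s i).2 t') c := by
  refine (move_comp (X.charS s) ⟨sidePoint i, continuous_sidePoint i⟩ t t' c).symm.trans
    (Eq.trans ?_ (move_comp (X.charE _) ⟨flip (X.bdry s i).2, continuous_flip _⟩ t t' c))
  exact move_congr (fun t => charS_side s i t) _ _ _

theorem onS_corner (s : X.S) (i : Fin 4) : onS w s (sidePoint i 0) = w (X.corner s i) := by
  have step : ∀ i, onS w s (sidePoint i 0) = w (X.corner s i) →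
      onS w s (sidePoint (i + 1) 0) = w (X.corner s (i + 1)) := by
    intro i hi
    rw [← sidePoint_one, ← hw.move_onS s (sidePoint i 0), hi, move_side, corner, ← hw.onE_dart,
      hw.move_onE, hw.onE_dart_one, corner_succ]
  have h0 : onS w s (sidePoint 0 0) = w (X.corner s 0) := move_self _ _ _
  match i with
  | 0 => exact h0
  | 1 => exact step 0 h0
  | 2 => exact step 1 (step 0 h0)
  | 3 => exact step 2 (step 1 (step 0 h0))

theorem onS_side (s : X.S) (i : Fin 4) (t : unitInterval) :
    onS w s (sidePoint i t) = onE w (X.bdry s i).1 (flip (X.bdry s i).2 t) := by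
  rw [← hw.move_onS s (sidePoint i 0), hw.onS_corner, move_side, corner, ← hw.onE_dart,
    hw.move_onE]

omit hw in
/-- The transported classes at the images under `pushMap` of the points of the cells. -/
noncomputable def onCells (w : X.V → PathClass z₀) : X.Cells → PathClass z₀
  | Sum.inl ⟨v, _⟩ => w v
  | Sum.inr (Sum.inl ⟨e, t⟩) => onE w e (push 1 t)
  | Sum.inr (Sum.inr ⟨s, z⟩) => onS w s (push 1 z.1, push 1 z.2)

theorem onCells_glue (c c' : X.Cells) (h : X.Glue c c') : onCells w c = onCells w c' := by
  cases h with
  | edge e b =>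
    refine Eq.trans ?_ (hw.onE_end e b)
    cases b <;> simp [onCells]
  | square s i t =>
    change onS w s (push 1 _, push 1 _) = onE w _ (push 1 (flip _ t))
    rw [push_prod_sidePoint, hw.onS_side, push_flip]

omit hw in
open Classical in
/-- The coordinate along the edge `e` of the images under `pushMap` of the points near `e`. -/
noncomputable def edgeCoord (e : X.E) : X.Cells → unitInterval
  | Sum.inl _ => 0
  | Sum.inr (Sum.inl ⟨_, t⟩) => push 1 t
  | Sum.inr (Sum.inr ⟨s, z⟩) =>
      if h : ∃ i, (X.bdry s i).1 = e ∧ 1 / 4 < ((rot i z).1 : ℝ) ∧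
          ((rot i z).1 : ℝ) < 3 / 4 ∧ ((rot i z).2 : ℝ) < 1 / 4
      then push 1 (flip (X.bdry s h.choose).2 (rot h.choose z).1) else 0

omit hw in
theorem edgeCoord_square {e : X.E} {s : X.S} {i : Fin 4} {z : unitInterval × unitInterval}
    (he : (X.bdry s i).1 = e) (h : 1 / 4 < ((rot i z).1 : ℝ) ∧
      ((rot i z).1 : ℝ) < 3 / 4 ∧ ((rot i z).2 : ℝ) < 1 / 4) :
    edgeCoord e (Sum.inr (Sum.inr ⟨s, z⟩)) = push 1 (flip (X.bdry s i).2 (rot i z).1) := by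
  have hex : ∃ i, (X.bdry s i).1 = e ∧ 1 / 4 < ((rot i z).1 : ℝ) ∧
      ((rot i z).1 : ℝ) < 3 / 4 ∧ ((rot i z).2 : ℝ) < 1 / 4 := ⟨i, he, h⟩
  have hi : hex.choose = i := strip_unique hex.choose_spec.2 h
  simp only [edgeCoord, dif_pos hex, hi]

omit hw in
theorem edgeCoord_glue {e : X.E} {c c' : X.Cells} (h : X.Glue c c') (hc : NearE e c) :
    edgeCoord e c = edgeCoord e c' := by
  have hc' := (nearE_glue e h).1 hc
  cases h with
  | edge e b => exact hc'.elim
  | square s i t =>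
    obtain ⟨k, hk, h⟩ := hc
    obtain rfl : k = i := by
      obtain ⟨he, h'⟩ := hc'
      obtain ⟨h0, h1, h2, h3⟩ := rot_sidePoint i t
      rcases fin4_cases i k with rfl | rfl | rfl | rfl
      · rfl
      · rw [h1] at h; norm_num at h
      · rw [h2] at h; norm_num at h
      · rw [h3] at h; norm_num at h
    rw [edgeCoord_square hk h, (rot_sidePoint k t).1]
    rfl

omit hw in
theorem continuousOn_edgeCoord (e : X.E) : ContinuousOn (edgeCoord e) {c | NearE e c} := by
  intro c hc
  refine ContinuousAt.continuousWithinAt ?_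
  rcases c with ⟨w, _⟩ | ⟨e', t⟩ | ⟨s, z⟩
  · exact hc.elim
  · refine ((isOpenEmbedding_edge e').continuousAt_iff (x := t)).1 ?_
    exact (continuous_push_right 1).continuousAt
  · refine ((isOpenEmbedding_square s).continuousAt_iff (x := z)).1 ?_
    obtain ⟨i, hi, h⟩ := hc
    have hopen : IsOpen {z : unitInterval × unitInterval | 1 / 4 < ((rot i z).1 : ℝ) ∧
        ((rot i z).1 : ℝ) < 3 / 4 ∧ ((rot i z).2 : ℝ) < 1 / 4} :=
      (isOpen_lt (by fun_prop) (by fun_prop)).and ((isOpen_lt (by fun_prop) (by fun_prop)).and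
        (isOpen_lt (by fun_prop) (by fun_prop)))
    have hcont : Continuous fun z => push 1 (flip (X.bdry s i).2 (rot i z).1) :=
      (continuous_push_right 1).comp (by fun_prop)
    refine hcont.continuousAt.congr ?_
    filter_upwards [hopen.mem_nhds h] with z' hz'
    exact (edgeCoord_square hi hz').symm

omit hw in
open Classical in
/-- The coordinate along `e` as a function on the realisation, with the junk value `0` away from
the neighbourhood of `e`. -/
noncomputable def edgeCoordMap (e : X.E) : X.Realization → unitInterval :=
  Quot.lift (fun c => if NearE e c then edgeCoord e c else 0) fun c c' h => by
    by_cases hc : NearE e c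
    · rw [if_pos hc, if_pos ((nearE_glue e h).1 hc), edgeCoord_glue h hc]
    · rw [if_neg hc, if_neg fun h' => hc ((nearE_glue e h).2 h')]

omit hw in
theorem continuousOn_edgeCoordMap (e : X.E) :
    ContinuousOn (edgeCoordMap e) (nbhd (Sum.inr (Sum.inl e))) := by
  rw [isQuotientMap_quot_mk.continuousOn_isOpen_iff (isOpen_nbhd _)]
  exact (continuousOn_edgeCoord e).congr fun c hc => if_pos hc

omit hw in
open Classical in
/-- The coordinates in the interior of the square `s` of the images under `pushMap` of the points
of `s`, with a junk value elsewhere. -/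
noncomputable def squareCoordMap (s : X.S) : X.Realization → unitInterval × unitInterval :=
  Quot.lift (fun c => if NearS s c then
      match c with
      | Sum.inr (Sum.inr ⟨_, z⟩) => (push 1 z.1, push 1 z.2)
      | _ => 0 else 0) fun c c' h => by
    by_cases hc : NearS s c
    · have hc' := (nearS_glue s h).1 hc
      cases h with
      | edge => exact hc.elim
      | square => exact hc'.elim
    · rw [if_neg hc, if_neg fun h' => hc ((nearS_glue s h).2 h')]

omit hw in
theorem continuousOn_squareCoordMap (s : X.S) :
    ContinuousOn (squareCoordMap s) (nbhd (Sum.inr (Sum.inr s))) := by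
  rw [isQuotientMap_quot_mk.continuousOn_isOpen_iff (isOpen_nbhd _)]
  intro c hc
  refine ContinuousAt.continuousWithinAt ?_
  have hcn : NearS s c := hc
  rcases c with ⟨w, _⟩ | ⟨e', t⟩ | ⟨s', z⟩
  · exact hcn.elim
  · exact hcn.elim
  · refine ((isOpenEmbedding_square s').continuousAt_iff (x := z)).1 ?_
    have hcont : Continuous fun z : unitInterval × unitInterval => (push 1 z.1, push 1 z.2) :=
      ((continuous_push_right 1).comp continuous_fst).prodMk
        ((continuous_push_right 1).comp continuous_snd)
    refine hcont.continuousAt.congr ?_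
    have hopen := (isOpen_near (X := X) (Sum.inr (Sum.inr s))).preimage
      (continuous_inr.comp (continuous_inr.comp (continuous_sigmaMk (σ := fun _ : X.S => unitInterval × unitInterval) (i := s'))))
    filter_upwards [hopen.mem_nhds hcn] with z' hz'
    exact (if_pos hz').symm

/-- A square complex is simply connected if path classes ending at its vertices can be chosen
consistently along its edges. -/
theorem simplyConnectedSpace : SimplyConnectedSpace X.Realization := by
  refine simplyConnectedSpace_of_locally X.id_homotopic_pushMap
    (q := Quot.lift (onCells w) hw.onCells_glue) ?_ ?_
  · intro y
    induction y using Quot.ind with | mk c => ?_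
    rcases c with ⟨v, _⟩ | ⟨e, t⟩ | ⟨s, z⟩
    · exact hw.fst v
    · exact hw.onE_fst e _
    · exact hw.onS_fst s _
  intro y
  induction y using Quot.ind with | mk c => ?_
  obtain ⟨a, ha⟩ := exists_near c
  refine ⟨nbhd a, isOpen_nbhd a, ha, ?_⟩
  rcases a with v | e | s
  · have hnear : ∀ y ∈ nbhd (Sum.inl v), X.pushMap y = X.pointV v ∧
        Quot.lift (onCells w) hw.onCells_glue y = w v := by
      intro y hy
      induction y using Quot.ind with | mk c => ?_
      rcases c with ⟨v', _⟩ | ⟨e, t⟩ | ⟨s, z⟩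
      · obtain rfl : v' = v := hy
        exact ⟨rfl, rfl⟩
      · obtain ⟨b, hb, hlt⟩ := hy
        have ht : push 1 t = if b then 1 else 0 := by
          have := push_one_of_lt hlt
          rw [push_flip] at this
          have h2 := congrArg (flip b) this
          rw [flip_flip] at h2
          rw [h2]
          cases b <;> simp [flip]
        subst hb
        constructor
        · change X.charE e (push 1 t) = _
          rw [ht, charE_end]
        · change onE w e (push 1 t) = _
          rw [ht, hw.onE_end]
      · obtain ⟨i, hi, h1, h2⟩ := hy
        subst hi
        have hr := rot_push 1 i z
        rw [push_one_of_lt h1, push_one_of_lt h2] at hr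
        have hz := eq_sidePoint_of_rot (congrArg Prod.snd hr)
        rw [hr] at hz
        constructor
        · change X.charS s (push 1 z.1, push 1 z.2) = _
          rw [hz, charS_corner]
        · change onS w s (push 1 z.1, push 1 z.2) = _
          rw [hz, hw.onS_corner]
    refine ⟨PUnit, inferInstance, inferInstance, ContinuousMap.const _ (X.pointV v),
      fun _ => ⟨⟩, continuousOn_const, fun y hy => (hnear y hy).1, fun y hy y' hy' => ?_⟩
    rw [(hnear y hy).2, (hnear y' hy').2, move_self]
  · have hnear : ∀ y ∈ nbhd (Sum.inr (Sum.inl e)), X.pushMap y = X.charE e (edgeCoordMap e y) ∧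
        Quot.lift (onCells w) hw.onCells_glue y = onE w e (edgeCoordMap e y) := by
      intro y hy
      induction y using Quot.ind with | mk c => ?_
      have hk : edgeCoordMap e (Quot.mk _ c) = edgeCoord e c := if_pos hy
      rw [hk]
      rcases c with ⟨v', _⟩ | ⟨e', t⟩ | ⟨s, z⟩
      · exact False.elim hy
      · obtain ⟨rfl, -⟩ := hy
        exact ⟨rfl, rfl⟩
      · obtain ⟨i, hi, h⟩ := hy
        rw [edgeCoord_square hi h]
        subst hi
        have hr := rot_push 1 i z
        rw [push_one_of_lt (t := (rot i z).2) (by linarith [h.2.2])] at hr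
        have hz := eq_sidePoint_of_rot (congrArg Prod.snd hr)
        rw [hr] at hz
        constructor
        · change X.charS s (push 1 z.1, push 1 z.2) = _
          rw [hz, charS_side, push_flip]
        · change onS w s (push 1 z.1, push 1 z.2) = _
          rw [hz, hw.onS_side, push_flip]
    refine ⟨unitInterval, inferInstance, inferInstance, X.charE e, edgeCoordMap e,
      continuousOn_edgeCoordMap e, fun y hy => (hnear y hy).1, fun y hy y' hy' => ?_⟩
    rw [(hnear y hy).2, (hnear y' hy').2, hw.move_onE]
  · have hnear : ∀ y ∈ nbhd (Sum.inr (Sum.inr s)), X.pushMap y = X.charS s (squareCoordMap s y) ∧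
        Quot.lift (onCells w) hw.onCells_glue y = onS w s (squareCoordMap s y) := by
      intro y hy
      induction y using Quot.ind with | mk c => ?_
      rcases c with ⟨v', _⟩ | ⟨e', t⟩ | ⟨s', z⟩
      · exact False.elim hy
      · exact False.elim hy
      · have hk : squareCoordMap s (Quot.mk _ (Sum.inr (Sum.inr ⟨s', z⟩))) =
          (push 1 z.1, push 1 z.2) := if_pos hy
        rw [hk]
        obtain ⟨rfl, -⟩ := hy
        exact ⟨rfl, rfl⟩
    refine ⟨unitInterval × unitInterval, inferInstance, inferInstance, X.charS s,
      squareCoordMap s, continuousOn_squareCoordMap s, fun y hy => (hnear y hy).1,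
      fun y hy y' hy' => ?_⟩
    rw [(hnear y hy).2, (hnear y' hy').2, hw.move_onS]

end Transported

/-! ### Finiteness and connectedness -/

/-- A compact square complex has finitely many cells. -/
theorem finite_index [CompactSpace X.Realization] : Finite (X.V ⊕ X.E ⊕ X.S) := by
  -- the centre of a cell lies in no other neighbourhood of a cell
  let half : unitInterval := ⟨1 / 2, by norm_num, by norm_num⟩
  have hhalf : (half : ℝ) = 1 / 2 := rfl
  let centre : X.V ⊕ X.E ⊕ X.S → X.Cells
    | Sum.inl v => Sum.inl ⟨v, ⟨⟩⟩
    | Sum.inr (Sum.inl e) => Sum.inr (Sum.inl ⟨e, half⟩)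
    | Sum.inr (Sum.inr s) => Sum.inr (Sum.inr ⟨s, (half, half)⟩)
  have hrot : ∀ i, rot i (half, half) = (half, half) := by
    have hs : unitInterval.symm half = half := by
      ext
      rw [unitInterval.coe_symm_eq, hhalf]
      norm_num
    intro i
    match i with
    | 0 | 1 | 2 | 3 => simp [rot, hs]
  have hflip : ∀ b, (flip b half : ℝ) = 1 / 2 := by
    rintro (_ | _)
    · rfl
    · simp only [flip, if_true, unitInterval.coe_symm_eq, hhalf]
      norm_num
  have huniq : ∀ a b, Near a (centre b) → a = b := by
    rintro (v | e | s) (v' | e' | s') h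
    · exact congrArg Sum.inl (Eq.symm h)
    · obtain ⟨b, -, h⟩ := h
      rw [hflip] at h
      norm_num at h
    · obtain ⟨i, -, h, -⟩ := h
      rw [hrot, hhalf] at h
      norm_num at h
    · exact False.elim h
    · exact congrArg _ (congrArg _ (Eq.symm h.1))
    · obtain ⟨i, -, -, -, h⟩ := h
      rw [hrot, hhalf] at h
      norm_num at h
    · exact False.elim h
    · exact False.elim h
    · exact congrArg _ (congrArg _ (Eq.symm h.1))
  obtain ⟨T, hT⟩ := isCompact_univ.elim_finite_subcover (fun a => nbhd (X := X) a) isOpen_nbhd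
    (fun y _ => by
      induction y using Quot.ind with | mk c => ?_
      obtain ⟨a, ha⟩ := exists_near c
      exact Set.mem_iUnion.2 ⟨a, ha⟩)
  refine Set.finite_univ_iff.1 (T.finite_toSet.subset fun b _ => ?_)
  obtain ⟨a, ha, hb⟩ := Set.mem_iUnion₂.1 (hT (Set.mem_univ (Quot.mk _ (centre b))))
  rwa [huniq a b hb] at ha

/-- In a connected square complex the vertices are connected by the edges. -/
theorem vertex_induction [PreconnectedSpace X.Realization] {P : X.V → Prop}
    (hP : ∀ e, P (X.endpt e false) ↔ P (X.endpt e true)) {v : X.V} (hv : P v) (w : X.V) :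
    P w := by
  have hsrc : ∀ d : X.E × Bool, P (X.src d) ↔ P (X.endpt d.1 false) := by
    rintro ⟨e, _ | _⟩
    · rfl
    · exact (hP e).symm
  have hcorner : ∀ s i, P (X.corner s i) ↔ P (X.corner s 0) := by
    intro s i
    have step : ∀ i, P (X.corner s (i + 1)) ↔ P (X.corner s i) := fun i => by
      rw [corner_succ, hsrc, corner, hsrc]
      rfl
    match i with
    | 0 => rfl
    | 1 => exact step 0
    | 2 => exact (step 1).trans (step 0)
    | 3 => exact (step 2).trans ((step 1).trans (step 0))
  let Q : X.Cells → Prop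
    | Sum.inl ⟨v, _⟩ => P v
    | Sum.inr (Sum.inl ⟨e, _⟩) => P (X.endpt e false)
    | Sum.inr (Sum.inr ⟨s, _⟩) => P (X.corner s 0)
  have hQ : ∀ c c', X.Glue c c' → Q c = Q c' := by
    rintro _ _ (⟨e, b⟩ | ⟨s, i, t⟩)
    · refine propext ?_
      cases b
      · rfl
      · exact hP e
    · exact propext ((hcorner s i).symm.trans (hsrc _))
  have hQo : ∀ R : Prop → Prop, IsOpen {c | R (Q c)} := fun R =>
    isOpen_sum_iff.2 ⟨isOpen_sigma_iff.2 fun v => isOpen_const (p := R (P v)),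
      isOpen_sum_iff.2 ⟨isOpen_sigma_iff.2 fun e => isOpen_const (p := R (P (X.endpt e false))),
        isOpen_sigma_iff.2 fun s => isOpen_const (p := R (P (X.corner s 0)))⟩⟩
  have hclopen : IsClopen {y : X.Realization | Quot.lift Q hQ y} := by
    constructor
    · rw [← isOpen_compl_iff]
      exact isQuotientMap_quot_mk.isOpen_preimage.1 (hQo Not)
    · exact isQuotientMap_quot_mk.isOpen_preimage.1 (hQo id)
  have huniv := hclopen.eq_univ ⟨X.pointV v, hv⟩
  have hw : X.pointV w ∈ {y : X.Realization | Quot.lift Q hQ y} := huniv ▸ Set.mem_univ _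
  exact hw

end SquareComplex

/-! ### Simple connectedness of a simplicial complex from transport along its simplices -/

open Topology

namespace StdSimplexPush

variable {ι κ : Type*} [Fintype ι] [Fintype κ]

/-- The sum of the squares of the barycentric coordinates. Like the largest coordinate, it is
positive, depends continuously on the point and does not change when the point is regarded as a
point of a larger simplex. -/
noncomputable def sq (b : stdSimplex ℝ ι) : ℝ := ∑ i, b i ^ 2

theorem sq_pos (b : stdSimplex ℝ ι) : 0 < sq b := by
  have h : 0 ≤ sq b := Finset.sum_nonneg fun i _ => sq_nonneg _
  refine h.lt_of_ne fun h0 => ?_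
  have h1 : ∀ i, b i = 0 := fun i => by
    have := (Finset.sum_eq_zero_iff_of_nonneg (fun i _ => sq_nonneg (b i))).1 h0.symm i
      (Finset.mem_univ i)
    exact pow_eq_zero_iff two_ne_zero |>.1 this
  have h2 := stdSimplex.sum_eq_one b
  simp [h1] at h2

/-- The coordinates cut off at half of `sq`, not normalised. -/
noncomputable def weight (b : stdSimplex ℝ ι) (i : ι) : ℝ := max 0 (b i - sq b / 2)

theorem sum_weight_pos (b : stdSimplex ℝ ι) : 0 < ∑ i, weight b i := by
  have h : ∀ i, 0 ≤ weight b i := fun i => le_max_left _ _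
  refine (Finset.sum_nonneg fun i _ => h i).lt_of_ne fun h0 => ?_
  have h1 : ∀ i, b i ≤ sq b / 2 := fun i => by
    have := (Finset.sum_eq_zero_iff_of_nonneg (fun i _ => h i)).1 h0.symm i (Finset.mem_univ i)
    have h2 : b i - sq b / 2 ≤ weight b i := le_max_right _ _
    linarith
  have h2 : sq b ≤ ∑ i, sq b / 2 * b i := Finset.sum_le_sum fun i _ => by
    rw [pow_two]
    exact mul_le_mul_of_nonneg_right (h1 i) (stdSimplex.zero_le b i)
  rw [← Finset.mul_sum, stdSimplex.sum_eq_one] at h2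
  linarith [sq_pos b]

/-- The homotopy from the identity of the simplex to the map that cuts off the coordinates that
are at most half of `sq`. -/
noncomputable def push (r : unitInterval) (b : stdSimplex ℝ ι) : stdSimplex ℝ ι :=
  ⟨fun i => (1 - r) * b i + r * (weight b i / ∑ k, weight b k), fun i =>
    add_nonneg (mul_nonneg (sub_nonneg.2 r.2.2) (stdSimplex.zero_le b i))
      (mul_nonneg r.2.1 (div_nonneg (le_max_left _ _) (sum_weight_pos b).le)), by
    rw [Finset.sum_add_distrib, ← Finset.mul_sum, ← Finset.mul_sum, ← Finset.sum_div,
      div_self (sum_weight_pos b).ne', stdSimplex.sum_eq_one]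
    ring⟩

theorem push_apply (r : unitInterval) (b : stdSimplex ℝ ι) (i : ι) :
    push r b i = (1 - r) * b i + r * (weight b i / ∑ k, weight b k) := rfl

theorem continuous_apply_stdSimplex (i : ι) : Continuous fun b : stdSimplex ℝ ι => b i :=
  (continuous_apply i).comp continuous_subtype_val

theorem continuous_sq : Continuous (sq (ι := ι)) :=
  continuous_finsetSum _ fun i _ => (continuous_apply_stdSimplex i).pow 2

theorem continuous_weight (i : ι) : Continuous fun b : stdSimplex ℝ ι => weight b i :=
  continuous_const.max ((continuous_apply_stdSimplex i).sub (continuous_sq.div_const 2))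

theorem continuous_push :
    Continuous fun p : unitInterval × stdSimplex ℝ ι => push p.1 p.2 := by
  refine Continuous.subtype_mk (continuous_pi fun i => ?_) _
  have h1 := (continuous_apply_stdSimplex i).comp (continuous_snd (X := unitInterval))
  have h2 := (continuous_weight i).comp (continuous_snd (X := unitInterval))
  have h3 := (continuous_finsetSum Finset.univ fun (k : ι) _ => continuous_weight k).comp
    (continuous_snd (X := unitInterval))
  refine Continuous.add (Continuous.mul (by fun_prop) h1) (Continuous.mul (by fun_prop) ?_)
  exact h2.div h3 fun p => (sum_weight_pos p.2).ne'

theorem push_zero (b : stdSimplex ℝ ι) : push 0 b = b := by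
  ext i
  simp [push_apply]

theorem push_one_eq_zero {b : stdSimplex ℝ ι} {i : ι} (h : b i ≤ sq b / 2) : push 1 b i = 0 := by
  simp [push_apply, weight, h]

variable {f : ι → κ} (hf : Function.Injective f)
include hf

theorem map_apply (b : stdSimplex ℝ ι) (i : ι) : stdSimplex.map f b (f i) = b i := by
  classical
  rw [stdSimplex.map_coe, FunOnFinite.linearMap_apply_apply, Finset.sum_eq_single i]
  · intro k hk hki
    exact absurd (hf (Finset.mem_filter.1 hk).2) hki
  · intro h
    exact absurd (by simp) h

omit hf in
theorem map_apply_of_notMem (b : stdSimplex ℝ ι) {k : κ} (hk : k ∉ Set.range f) :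
    stdSimplex.map f b k = 0 := by
  classical
  rw [stdSimplex.map_coe, FunOnFinite.linearMap_apply_apply]
  refine Finset.sum_eq_zero fun i hi => absurd ⟨i, (Finset.mem_filter.1 hi).2⟩ hk

theorem sq_map (b : stdSimplex ℝ ι) : sq (stdSimplex.map f b) = sq b :=
  (Fintype.sum_of_injective f hf _ _ (fun k hk => by simp [map_apply_of_notMem b hk])
    fun i => by rw [map_apply hf]).symm

theorem weight_map (b : stdSimplex ℝ ι) (i : ι) :
    weight (stdSimplex.map f b) (f i) = weight b i := by
  rw [weight, weight, sq_map hf, map_apply hf]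

theorem weight_map_of_notMem (b : stdSimplex ℝ ι) {k : κ} (hk : k ∉ Set.range f) :
    weight (stdSimplex.map f b) k = 0 := by
  rw [weight, sq_map hf, map_apply_of_notMem b hk]
  exact max_eq_left (by linarith [sq_pos b])

theorem push_map (r : unitInterval) (b : stdSimplex ℝ ι) :
    push r (stdSimplex.map f b) = stdSimplex.map f (push r b) := by
  have hs : ∑ k, weight (stdSimplex.map f b) k = ∑ i, weight b i :=
    (Fintype.sum_of_injective f hf _ _ (fun k hk => weight_map_of_notMem hf b hk)
      fun i => (weight_map hf b i).symm).symm
  ext k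
  by_cases hk : k ∈ Set.range f
  · obtain ⟨i, rfl⟩ := hk
    rw [map_apply hf, push_apply, push_apply, hs, map_apply hf, weight_map hf]
  · rw [map_apply_of_notMem _ hk, push_apply, map_apply_of_notMem _ hk,
      weight_map_of_notMem hf b hk]
    simp

/-- A point whose coordinates outside the range of `f` vanish, as a point of the face. -/
theorem restrict_mem {b : stdSimplex ℝ κ} (h : ∀ k ∉ Set.range f, b k = 0) :
    (fun i => b (f i)) ∈ stdSimplex ℝ ι :=
  ⟨fun _ => stdSimplex.zero_le b _,
    (Fintype.sum_of_injective f hf _ _ h fun _ => rfl).trans (stdSimplex.sum_eq_one b)⟩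

theorem map_restrict {b : stdSimplex ℝ κ} (h : ∀ k ∉ Set.range f, b k = 0) :
    stdSimplex.map f ⟨fun i => b (f i), restrict_mem hf h⟩ = b := by
  ext k
  by_cases hk : k ∈ Set.range f
  · obtain ⟨i, rfl⟩ := hk
    rw [map_apply hf]
    rfl
  · rw [map_apply_of_notMem _ hk, h k hk]

end StdSimplexPush

namespace GenSimplicialComplex

open StdSimplexPush

variable {K : GenSimplicialComplex.{u}}

instance contractibleSpace_cell (σ : K.Simplex) : ContractibleSpace (stdSimplex ℝ (K.Corner σ)) :=
  (convex_stdSimplex ℝ (K.Corner σ)).contractibleSpace Set.Nonempty.of_subtype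

/-- The characteristic map of a simplex. -/
def char (K : GenSimplicialComplex.{u}) (σ : K.Simplex) :
    C(stdSimplex ℝ (K.Corner σ), K.Realization) :=
  ⟨fun b => Quot.mk _ ⟨σ, b⟩, continuous_quot_mk.comp continuous_sigmaMk⟩

theorem char_map {τ σ : K.Simplex} {f : K.Corner τ → K.Corner σ} (hf : K.Attach τ σ f)
    (b : stdSimplex ℝ (K.Corner τ)) : K.char σ (stdSimplex.map f b) = K.char τ b :=
  (Quot.sound (Glue.mk hf b)).symm

open Classical in
/-- The corner `i` as a point of the simplex `σ`. -/
noncomputable def vert (σ : K.Simplex) (i : K.Corner σ) : stdSimplex ℝ (K.Corner σ) :=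
  stdSimplex.vertex i

theorem map_vert {τ σ : K.Simplex} (f : K.Corner τ → K.Corner σ) (i : K.Corner τ) :
    stdSimplex.map f (vert τ i) = vert σ (f i) := by
  classical
  exact stdSimplex.map_vertex f i

/-- The paths along which the points of the simplices are pushed onto faces. -/
noncomputable def pushPath (c : K.Cells) : C(unitInterval, K.Realization) :=
  ⟨fun r => K.char c.1 (push r c.2), (K.char c.1).continuous.comp
    (continuous_push.comp (Continuous.prodMk_left c.2))⟩

theorem continuous_pushPath : Continuous (pushPath (K := K)) :=
  continuous_sigma fun σ => (ContinuousMap.curry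
    ⟨fun p : stdSimplex ℝ (K.Corner σ) × unitInterval => K.char σ (push p.2 p.1),
      (K.char σ).continuous.comp (continuous_push.comp continuous_swap)⟩).continuous

theorem pushPath_glue (c c' : K.Cells) (h : K.Glue c c') : pushPath c = pushPath c' := by
  ext r
  cases h with
  | mk hf x =>
    change K.char _ (push r x) = K.char _ (push r (stdSimplex.map _ x))
    rw [push_map (K.injective_of_attach hf), char_map hf]

/-- The homotopy from the identity that pushes the points of the simplices onto faces. -/
noncomputable def pushHomotopy (K : GenSimplicialComplex.{u}) :
    C(unitInterval × K.Realization, K.Realization) :=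
  ⟨fun p => Quot.lift pushPath pushPath_glue p.2 p.1,
    continuous_quot_lift_path _ continuous_pushPath _⟩

/-- The end of the homotopy `pushHomotopy`. -/
noncomputable def pushMap (K : GenSimplicialComplex.{u}) : C(K.Realization, K.Realization) :=
  K.pushHomotopy.comp ⟨fun y => (1, y), by fun_prop⟩

theorem id_homotopic_pushMap (K : GenSimplicialComplex.{u}) :
    (ContinuousMap.id K.Realization).Homotopic K.pushMap := by
  refine ⟨⟨K.pushHomotopy, fun y => ?_, fun _ => rfl⟩⟩
  induction y using Quot.ind with | mk c => ?_
  change K.char c.1 (push 0 c.2) = K.char c.1 c.2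
  rw [push_zero]

/-- The face `f` of `τ` consists of the corners where the coordinates of `b` are large, and all
other coordinates are small, the threshold being `δ * sq b`. -/
def IsLarge (δ : ℝ) {σ τ : K.Simplex} (f : K.Corner σ → K.Corner τ)
    (b : stdSimplex ℝ (K.Corner τ)) : Prop :=
  K.Attach σ τ f ∧ (∀ i, δ * sq b < b (f i)) ∧ ∀ k, k ∉ Set.range f → b k < δ * sq b

/-- The open neighbourhood of (a compact part of the interior of) the simplex `σ`: the points at
which the large coordinates are those of a face glued to `σ`. -/
def Near (σ : K.Simplex) (δ : ℝ) (c : K.Cells) : Prop :=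
  ∃ f : K.Corner σ → K.Corner c.1, IsLarge δ f c.2

theorem IsLarge.unique {δ : ℝ} {σ τ : K.Simplex} {f f' : K.Corner σ → K.Corner τ}
    {b : stdSimplex ℝ (K.Corner τ)} (h : IsLarge δ f b) (h' : IsLarge δ f' b) : f = f' := by
  have hsub : ∀ {f f' : K.Corner σ → K.Corner τ}, IsLarge δ f b → IsLarge δ f' b →
      Set.range f ⊆ Set.range f' := by
    rintro f f' h h' _ ⟨i, rfl⟩
    by_contra hi
    exact lt_asymm (h.2.1 i) (h'.2.2 _ hi)
  have := (K.existsUnique_face τ (Set.range f) (Set.range_nonempty f)).unique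
    (y₁ := ⟨σ, f⟩) (y₂ := ⟨σ, f'⟩) ⟨h.1, rfl⟩ ⟨h'.1, (hsub h' h).antisymm (hsub h h')⟩
  exact eq_of_heq (Sigma.mk.inj this).2

theorem IsLarge.map {δ : ℝ} (hδ : 0 < δ) {σ τ ρ : K.Simplex} {f : K.Corner σ → K.Corner τ}
    {g : K.Corner τ → K.Corner ρ} (hg : K.Attach τ ρ g) {b : stdSimplex ℝ (K.Corner τ)}
    (h : IsLarge δ f b) : IsLarge δ (g ∘ f) (stdSimplex.map g b) := by
  have hi := K.injective_of_attach hg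
  refine ⟨K.attach_comp h.1 hg, fun i => ?_, fun k hk => ?_⟩
  · rw [sq_map hi, Function.comp_apply, map_apply hi]
    exact h.2.1 i
  · rw [sq_map hi]
    by_cases hk' : k ∈ Set.range g
    · obtain ⟨j, rfl⟩ := hk'
      rw [map_apply hi]
      exact h.2.2 j fun ⟨i, hi⟩ => hk ⟨i, congrArg g hi⟩
    · rw [map_apply_of_notMem _ hk']
      exact mul_pos hδ (sq_pos b)

/-- If an attaching map into `ρ` has its range in that of `g : τ → ρ`, then it factors through
`g`. -/
theorem exists_attach_factor {σ τ ρ : K.Simplex} {f : K.Corner σ → K.Corner ρ}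
    {g : K.Corner τ → K.Corner ρ} (hf : K.Attach σ ρ f) (hg : K.Attach τ ρ g)
    (h : Set.range f ⊆ Set.range g) : ∃ k, K.Attach σ τ k ∧ g ∘ k = f := by
  obtain ⟨⟨σ', ψ⟩, ⟨hψ, hψr⟩, -⟩ := K.existsUnique_face τ (g ⁻¹' Set.range f) (by
    obtain ⟨x⟩ := K.nonempty_corner σ
    obtain ⟨z, hz⟩ := h ⟨x, rfl⟩
    exact ⟨z, x, hz.symm⟩)
  dsimp only at hψ hψr
  have hgψ : K.Attach σ' ρ (g ∘ ψ) ∧ Set.range (g ∘ ψ) = Set.range f :=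
    ⟨K.attach_comp hψ hg, by rw [Set.range_comp, hψr, Set.image_preimage_eq_of_subset h]⟩
  have hu := (K.existsUnique_face ρ (Set.range f) (Set.range_nonempty f)).unique
    (y₁ := ⟨σ', g ∘ ψ⟩) (y₂ := ⟨σ, f⟩) hgψ ⟨hf, rfl⟩
  obtain rfl : σ' = σ := congrArg Sigma.fst hu
  exact ⟨ψ, hψ, eq_of_heq (Sigma.mk.inj hu).2⟩

theorem near_glue {σ : K.Simplex} {δ : ℝ} (hδ : 0 < δ) {c c' : K.Cells} (h : K.Glue c c') :
    Near σ δ c ↔ Near σ δ c' := by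
  cases h with
  | @mk τ ρ g hg b =>
    constructor
    · rintro ⟨f, hf⟩
      exact ⟨g ∘ f, hf.map hδ hg⟩
    · rintro ⟨f, hf, h1, h2⟩
      have hi := K.injective_of_attach hg
      have hsub : Set.range f ⊆ Set.range g := by
        rintro _ ⟨i, rfl⟩
        by_contra hk
        have h3 := h1 i
        rw [map_apply_of_notMem _ hk] at h3
        exact lt_asymm h3 (mul_pos hδ (sq_pos _))
      obtain ⟨k, hk, rfl⟩ := exists_attach_factor hf hg hsub
      refine ⟨k, hk, fun i => ?_, fun j hj => ?_⟩
      · have := h1 i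
        rwa [sq_map hi, Function.comp_apply, map_apply hi] at this
      · have := h2 (g j) fun ⟨i, hij⟩ => hj ⟨i, hi hij⟩
        rwa [sq_map hi, map_apply hi] at this

theorem isOpen_isLarge (δ : ℝ) {σ τ : K.Simplex} (f : K.Corner σ → K.Corner τ) :
    IsOpen {b | IsLarge δ f b} := by
  refine isOpen_const.and (IsOpen.and ?_ ?_)
  · simp only [Set.ofPred_forall]
    exact isOpen_iInter_of_finite fun i => isOpen_lt (continuous_const.mul continuous_sq)
      (continuous_apply_stdSimplex _)
  · simp only [Set.ofPred_forall]
    exact isOpen_iInter_of_finite fun k => isOpen_iInter_of_finite fun _ =>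
      isOpen_lt (continuous_apply_stdSimplex _) (continuous_const.mul continuous_sq)

theorem isOpen_near (σ : K.Simplex) (δ : ℝ) : IsOpen {c : K.Cells | Near σ δ c} := by
  refine isOpen_sigma_iff.2 fun τ => ?_
  change IsOpen {b | ∃ f : K.Corner σ → K.Corner τ, IsLarge δ f b}
  simp only [Set.ofPred_exists]
  exact isOpen_iUnion fun f => isOpen_isLarge δ f

theorem exists_near (c : K.Cells) : ∃ (σ : K.Simplex) (δ : ℝ), 0 < δ ∧ δ ≤ 1 / 2 ∧ Near σ δ c := by
  obtain ⟨τ, b⟩ := c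
  have hne : {k | b k ≠ 0}.Nonempty := by
    by_contra h
    have h0 : ∀ k, b k = 0 := fun k => by
      by_contra hk
      exact h ⟨k, hk⟩
    have h2 := stdSimplex.sum_eq_one b
    simp [h0] at h2
  obtain ⟨⟨σ, f⟩, ⟨hf, hr⟩, -⟩ := K.existsUnique_face τ _ hne
  dsimp only at hf hr
  have hpos : ∀ i, 0 < b (f i) := fun i => by
    have : f i ∈ {k | b k ≠ 0} := hr ▸ ⟨i, rfl⟩
    exact (stdSimplex.zero_le b _).lt_of_ne' this
  obtain ⟨i₀, hi₀⟩ := Finite.exists_min fun i => b (f i)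
  have hs := sq_pos b
  refine ⟨σ, min (1 / 2) (b (f i₀) / (2 * sq b)), lt_min (by norm_num)
    (div_pos (hpos _) (by linarith)), min_le_left _ _, f, hf, fun i => ?_, fun k hk => ?_⟩
  · calc _ ≤ b (f i₀) / (2 * sq b) * sq b := mul_le_mul_of_nonneg_right (min_le_right _ _) hs.le
      _ = b (f i₀) / 2 := by field_simp
      _ < b (f i₀) := by linarith [hpos i₀]
      _ ≤ b (f i) := hi₀ i
  · have : b k = 0 := by
      by_contra h
      exact hk (hr.symm ▸ h : k ∈ Set.range f)
    rw [this]
    exact mul_pos (lt_min (by norm_num) (div_pos (hpos _) (by linarith))) hs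

theorem IsLarge.push_eq_zero {δ : ℝ} (hδ : δ ≤ 1 / 2) {σ τ : K.Simplex}
    {f : K.Corner σ → K.Corner τ} {b : stdSimplex ℝ (K.Corner τ)} (h : IsLarge δ f b) :
    ∀ k ∉ Set.range f, push 1 b k = 0 := fun k hk => push_one_eq_zero (by
  have h1 := h.2.2 k hk
  have h2 := mul_le_mul_of_nonneg_right hδ (sq_pos b).le
  linarith)

open Classical in
/-- The coordinates in `σ` of the image under `pushMap` of a point near `σ`, with a junk value
elsewhere. -/
noncomputable def nearCoord (σ : K.Simplex) {δ : ℝ} (hδ : δ ≤ 1 / 2) (c : K.Cells) :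
    stdSimplex ℝ (K.Corner σ) :=
  if h : Near σ δ c then
    ⟨fun i => push 1 c.2 (h.choose i), restrict_mem (K.injective_of_attach h.choose_spec.1)
      (h.choose_spec.push_eq_zero hδ)⟩
  else vert σ (Classical.arbitrary _)

theorem IsLarge.nearCoord_eq {δ : ℝ} (hδ : δ ≤ 1 / 2) {σ τ : K.Simplex}
    {f : K.Corner σ → K.Corner τ} {b : stdSimplex ℝ (K.Corner τ)} (h : IsLarge δ f b) :
    nearCoord σ hδ ⟨τ, b⟩ = ⟨fun i => push 1 b (f i),
      restrict_mem (K.injective_of_attach h.1) (h.push_eq_zero hδ)⟩ := by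
  have hn : Near σ δ ⟨τ, b⟩ := ⟨f, h⟩
  rw [nearCoord, dif_pos hn]
  refine Subtype.ext (funext fun i => ?_)
  dsimp only
  rw [hn.choose_spec.unique h]

theorem IsLarge.map_nearCoord {δ : ℝ} (hδ : δ ≤ 1 / 2) {σ τ : K.Simplex}
    {f : K.Corner σ → K.Corner τ} {b : stdSimplex ℝ (K.Corner τ)} (h : IsLarge δ f b) :
    stdSimplex.map f (nearCoord σ hδ ⟨τ, b⟩) = push 1 b := by
  rw [h.nearCoord_eq hδ]
  exact map_restrict (K.injective_of_attach h.1) (h.push_eq_zero hδ)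

theorem nearCoord_glue {σ : K.Simplex} {δ : ℝ} (hδ₀ : 0 < δ) (hδ : δ ≤ 1 / 2) (c c' : K.Cells)
    (h : K.Glue c c') : nearCoord σ hδ c = nearCoord σ hδ c' := by
  by_cases hc : Near σ δ c
  · cases h with
    | @mk τ ρ g hg b =>
      obtain ⟨f, hf⟩ := hc
      rw [hf.nearCoord_eq hδ, (hf.map hδ₀ hg).nearCoord_eq hδ]
      refine Subtype.ext (funext fun i => ?_)
      change push 1 b (f i) = push 1 (stdSimplex.map g b) (g (f i))
      rw [push_map (K.injective_of_attach hg), map_apply (K.injective_of_attach hg)]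
  · rw [nearCoord, dif_neg hc, nearCoord, dif_neg fun h' => hc ((near_glue hδ₀ h).2 h')]

theorem continuousOn_nearCoord (σ : K.Simplex) {δ : ℝ} (hδ : δ ≤ 1 / 2) :
    ContinuousOn (nearCoord σ hδ) {c : K.Cells | Near σ δ c} := by
  rintro ⟨τ, b⟩ ⟨f, hf⟩
  refine ContinuousAt.continuousWithinAt ?_
  refine ((IsOpenEmbedding.sigmaMk (σ := fun σ : K.Simplex => stdSimplex ℝ (K.Corner σ))
    (i := τ)).continuousAt_iff (x := b)).1 ?_
  rw [IsInducing.subtypeVal.continuousAt_iff]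
  have hc : Continuous fun (b : stdSimplex ℝ (K.Corner τ)) i => push 1 b (f i) :=
    continuous_pi fun i => (continuous_apply_stdSimplex (f i)).comp
      (continuous_push.comp (Continuous.prodMk_right 1))
  refine hc.continuousAt.congr ?_
  filter_upwards [(isOpen_isLarge δ f).mem_nhds hf] with b' hb'
  exact (congrArg Subtype.val (hb'.nearCoord_eq hδ)).symm

/-- A choice of path classes ending at the corners of the simplices that is transported along the
simplices. -/
structure Transported {z₀ : K.Realization} (w : ∀ σ : K.Simplex, K.Corner σ → PathClass z₀) :
    Prop where
  fst : ∀ σ i, (w σ i).1 = K.char σ (vert σ i)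
  attach : ∀ {τ σ f}, K.Attach τ σ f → ∀ i, w σ (f i) = w τ i
  move : ∀ σ i j, w σ j = PathClass.move (K.char σ) (vert σ i) (vert σ j) (w σ i)

namespace Transported

open PathClass

variable {z₀ : K.Realization} {w : ∀ σ : K.Simplex, K.Corner σ → PathClass z₀}

/-- The transported classes at the points of a simplex. -/
noncomputable def at_ (w : ∀ σ : K.Simplex, K.Corner σ → PathClass z₀) (σ : K.Simplex)
    (b : stdSimplex ℝ (K.Corner σ)) : PathClass z₀ :=
  PathClass.move (K.char σ) (vert σ (Classical.arbitrary _)) b (w σ (Classical.arbitrary _))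

variable (hw : Transported w)
include hw

theorem at_fst (σ : K.Simplex) (b : stdSimplex ℝ (K.Corner σ)) : (at_ w σ b).1 = K.char σ b :=
  move_fst (hw.fst _ _)

theorem move_at (σ : K.Simplex) (b b' : stdSimplex ℝ (K.Corner σ)) :
    PathClass.move (K.char σ) b b' (at_ w σ b) = at_ w σ b' :=
  move_move _ _ _ _ (hw.fst _ _)

theorem at_eq (σ : K.Simplex) (i : K.Corner σ) (b : stdSimplex ℝ (K.Corner σ)) :
    at_ w σ b = PathClass.move (K.char σ) (vert σ i) b (w σ i) := by
  rw [hw.move σ (Classical.arbitrary _) i, move_move _ _ _ _ (hw.fst _ _)]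
  rfl

theorem at_map {τ σ : K.Simplex} {f : K.Corner τ → K.Corner σ} (hf : K.Attach τ σ f)
    (b : stdSimplex ℝ (K.Corner τ)) : at_ w σ (stdSimplex.map f b) = at_ w τ b := by
  obtain ⟨i⟩ := K.nonempty_corner τ
  rw [hw.at_eq σ (f i), hw.at_eq τ i, hw.attach hf, ← map_vert]
  refine (move_comp (K.char σ) ⟨stdSimplex.map f, stdSimplex.continuous_map f⟩ _ _ _).symm.trans ?_
  exact move_congr (fun x => char_map hf x) _ _ _

/-- A simplicial complex is simply connected if path classes ending at its vertices can be chosen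
consistently along its simplices. -/
theorem simplyConnectedSpace : SimplyConnectedSpace K.Realization := by
  have hglue : ∀ c c' : K.Cells, K.Glue c c' →
      at_ w c.1 (push 1 c.2) = at_ w c'.1 (push 1 c'.2) := by
    intro c c' h
    cases h with
    | @mk τ ρ g hg b =>
      change at_ w τ (push 1 b) = at_ w ρ (push 1 (stdSimplex.map g b))
      rw [push_map (K.injective_of_attach hg), hw.at_map hg]
  refine simplyConnectedSpace_of_locally K.id_homotopic_pushMap
    (q := Quot.lift (fun c => at_ w c.1 (push 1 c.2)) hglue) ?_ ?_
  · intro y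
    induction y using Quot.ind with | mk c => ?_
    exact hw.at_fst c.1 _
  intro y
  induction y using Quot.ind with | mk c => ?_
  obtain ⟨σ, δ, hδ₀, hδ, hc⟩ := exists_near c
  let N : Set K.Realization :=
    {y | Quot.lift (Near σ δ) (fun _ _ h => propext (near_glue hδ₀ h)) y}
  have hN : IsOpen N := isQuotientMap_quot_mk.isOpen_preimage.1 (isOpen_near σ δ)
  let κ : K.Realization → stdSimplex ℝ (K.Corner σ) :=
    Quot.lift (nearCoord σ hδ) (nearCoord_glue hδ₀ hδ)
  have hκ : ContinuousOn κ N := by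
    rw [isQuotientMap_quot_mk.continuousOn_isOpen_iff hN]
    exact continuousOn_nearCoord σ hδ
  have hnear : ∀ y ∈ N, K.pushMap y = K.char σ (κ y) ∧
      Quot.lift (fun c => at_ w c.1 (push 1 c.2)) hglue y = at_ w σ (κ y) := by
    intro y hy
    induction y using Quot.ind with | mk c => ?_
    obtain ⟨τ, b⟩ := c
    obtain ⟨f, hf⟩ := hy
    change K.char τ (push 1 b) = K.char σ (nearCoord σ hδ ⟨τ, b⟩) ∧
      at_ w τ (push 1 b) = at_ w σ (nearCoord σ hδ ⟨τ, b⟩)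
    rw [← char_map hf.1, ← hw.at_map hf.1, hf.map_nearCoord hδ]
    exact ⟨rfl, rfl⟩
  refine ⟨N, hN, hc, stdSimplex ℝ (K.Corner σ), inferInstance, inferInstance, K.char σ, κ, hκ,
    fun y hy => (hnear y hy).1, fun y hy y' hy' => ?_⟩
  rw [(hnear y hy).2, (hnear y' hy').2, hw.move_at]

end Transported

end GenSimplicialComplex

/-! ### Local systems on a square complex and their total complexes -/

open Topology

namespace SquareComplex

@[simp] theorem rev_rev (X : SquareComplex.{u}) (d : X.E × Bool) : X.rev (X.rev d) = d := by
  simp [rev]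

theorem Hom.realize_comp {Z Y X : SquareComplex.{u}} (p : Y.Hom X) (q : Z.Hom Y)
    (z : Z.Realization) : (p.comp q).realize z = p.realize (q.realize z) := by
  induction z using Quot.ind with | mk c => ?_
  rcases c with _ | _ | _ <;> rfl

theorem continuous_onCells {Y X : SquareComplex.{u}} (p : Y.Hom X) : Continuous p.onCells :=
  continuous_sum_dom.2 ⟨continuous_sigma fun _ => continuous_of_discreteTopology,
    continuous_sum_dom.2 ⟨continuous_sigma fun _ => continuous_inr.comp
      (continuous_inl.comp continuous_sigmaMk), continuous_sigma fun _ => continuous_inr.comp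
      (continuous_inr.comp continuous_sigmaMk)⟩⟩

theorem continuous_realize {Y X : SquareComplex.{u}} (p : Y.Hom X) : Continuous p.realize :=
  continuous_quot_lift _ (continuous_quot_mk.comp (continuous_onCells p))

/-- A combinatorial local system of sets on `X`: a set `T` over the set of vertices, and for each
directed edge `d` a bijection from the fibre over the start of `d` onto the fibre over its end
(the function `act d` on `T` has irrelevant values away from the former fibre), such that the
bijections of a directed edge and of its reverse are mutually inverse and the bijections along the
boundary of a square compose to the identity. -/
structure LocalSystem (X : SquareComplex.{u}) : Type (u + 1) where
  T : Type u
  pr : T → X.V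
  act : X.E × Bool → T → T
  pr_act : ∀ {d x}, pr x = X.src d → pr (act d x) = X.src (X.rev d)
  act_rev : ∀ {d x}, pr x = X.src d → act (X.rev d) (act d x) = x
  act_bdry : ∀ {s x}, pr x = X.corner s 0 →
    act (X.bdry s 3) (act (X.bdry s 2) (act (X.bdry s 1) (act (X.bdry s 0) x))) = x

namespace LocalSystem

variable {X : SquareComplex.{u}} (L : LocalSystem X)

theorem act_act_rev {d : X.E × Bool} {x : L.T} (h : L.pr x = X.src (X.rev d)) :
    L.act d (L.act (X.rev d) x) = x := by
  have := L.act_rev h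
  rwa [rev_rev] at this

theorem pr_act_rev {d : X.E × Bool} {x : L.T} (h : L.pr x = X.src (X.rev d)) :
    L.pr (L.act (X.rev d) x) = X.src d := by
  rw [L.pr_act h, rev_rev]

/-- The image of the element `x` over the `0`-th corner of `s` at the `i`-th corner. -/
def cornerPt (s : X.S) (x : L.T) : Fin 4 → L.T
  | 0 => x
  | 1 => L.act (X.bdry s 0) x
  | 2 => L.act (X.bdry s 1) (L.act (X.bdry s 0) x)
  | 3 => L.act (X.bdry s 2) (L.act (X.bdry s 1) (L.act (X.bdry s 0) x))

variable {L}

theorem act_cornerPt {s : X.S} {x : L.T} (h : L.pr x = X.corner s 0) (i : Fin 4) :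
    L.act (X.bdry s i) (L.cornerPt s x i) = L.cornerPt s x (i + 1) := by
  match i with
  | 0 | 1 | 2 => rfl
  | 3 => exact L.act_bdry h

theorem fin4_induction {P : Fin 4 → Prop} (h0 : P 0) (h : ∀ i, P i → P (i + 1)) (i : Fin 4) :
    P i := by
  have h1 := h 0 h0
  have h2 := h 1 h1
  match i with
  | 0 => exact h0
  | 1 => exact h1
  | 2 => exact h2
  | 3 => exact h 2 h2

theorem pr_cornerPt {s : X.S} {x : L.T} (h : L.pr x = X.corner s 0) (i : Fin 4) :
    L.pr (L.cornerPt s x i) = X.src (X.bdry s i) := by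
  refine fin4_induction (P := fun i => L.pr (L.cornerPt s x i) = X.src (X.bdry s i)) h
    (fun i hi => ?_) i
  rw [← act_cornerPt h, L.pr_act hi, ← corner_succ, corner]

theorem exists_cornerPt (s : X.S) (i : Fin 4) : ∀ y, L.pr y = X.corner s i →
    ∃ x, L.pr x = X.corner s 0 ∧ L.cornerPt s x i = y := by
  refine fin4_induction (P := fun i => ∀ y, L.pr y = X.corner s i →
    ∃ x, L.pr x = X.corner s 0 ∧ L.cornerPt s x i = y) (fun y hy => ⟨y, hy, rfl⟩)
    (fun i hi y hy => ?_) i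
  rw [corner_succ] at hy
  obtain ⟨x, hx, hxy⟩ := hi (L.act (X.rev (X.bdry s i)) y) (L.pr_act_rev hy)
  exact ⟨x, hx, by rw [← act_cornerPt hx, hxy, L.act_act_rev hy]⟩

variable (L) in
/-- The data of the directed edge over `d` that starts at the element `x`. -/
def dartOver (d : X.E × Bool) (x : L.T) (h : L.pr x = X.src d) :
    {p : X.E × L.T // L.pr p.2 = X.endpt p.1 false} × Bool :=
  (⟨(d.1, if d.2 then L.act d x else x), by
    obtain ⟨e, b⟩ := d
    cases b
    · exact h
    · exact L.pr_act h⟩, d.2)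

variable (L) in
/-- The endpoints of the edges over `X`. -/
def liftEndpt (e : {p : X.E × L.T // L.pr p.2 = X.endpt p.1 false}) (b : Bool) : L.T :=
  if b then L.act (e.1.1, false) e.1.2 else e.1.2

theorem liftEndpt_dartOver (d : X.E × Bool) (x : L.T) (h : L.pr x = X.src d) :
    L.liftEndpt (L.dartOver d x h).1 (L.dartOver d x h).2 = x ∧
      L.liftEndpt (L.dartOver d x h).1 (!(L.dartOver d x h).2) = L.act d x := by
  obtain ⟨e, b⟩ := d
  cases b
  · exact ⟨rfl, rfl⟩
  · exact ⟨L.act_rev h, rfl⟩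

variable (L) in
/-- The square complex over `X` with the set of vertices `T`: the covering of `X` defined by the
local system. Its edges and squares are encoded by the cell of `X` together with the element at the
endpoint `false`, respectively at the `0`-th corner. -/
abbrev total : SquareComplex.{u} where
  V := L.T
  E := {p : X.E × L.T // L.pr p.2 = X.endpt p.1 false}
  S := {p : X.S × L.T // L.pr p.2 = X.corner p.1 0}
  endpt := L.liftEndpt
  bdry s i := L.dartOver (X.bdry s.1.1 i) (L.cornerPt s.1.1 s.1.2 i) (pr_cornerPt s.2 i)
  bdry_closed s i := (liftEndpt_dartOver _ _ _).2.trans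
    ((act_cornerPt s.2 i).trans (liftEndpt_dartOver _ _ _).1.symm)

variable (L) in
/-- The projection of the total complex. -/
def proj : L.total.Hom X where
  onV := L.pr
  onE e := e.1.1
  onS s := s.1.1
  endpt_onE e b := by
    cases b
    · exact e.2.symm
    · exact (L.pr_act (d := (e.1.1, false)) e.2).symm
  bdry_onS _ _ := rfl

variable (L) in
/-- The directed edge over `d` that starts at the element `x`. -/
def liftDart (d : X.E × Bool) (x : L.T) (h : L.pr x = X.src d) : L.total.E × Bool :=
  L.dartOver d x h

theorem src_liftDart (d : X.E × Bool) (x : L.T) (h : L.pr x = X.src d) :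
    L.total.src (L.liftDart d x h) = x := (liftEndpt_dartOver d x h).1

theorem src_rev_liftDart (d : X.E × Bool) (x : L.T) (h : L.pr x = X.src d) :
    L.total.src (L.total.rev (L.liftDart d x h)) = L.act d x := (liftEndpt_dartOver d x h).2

theorem pr_src (D : L.total.E × Bool) : L.pr (L.total.src D) = X.src (D.1.1.1, D.2) :=
  (L.proj.endpt_onE D.1 D.2).symm

theorem liftDart_congr {d d' : X.E × Bool} {x x' : L.T} (hd : d = d') (hx : x = x')
    (h : L.pr x = X.src d) : L.liftDart d x h = L.liftDart d' x' (hd ▸ hx ▸ h) := by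
  subst hd hx
  rfl

theorem eq_liftDart (D : L.total.E × Bool) :
    L.liftDart (D.1.1.1, D.2) (L.total.src D) (pr_src D) = D := by
  obtain ⟨⟨⟨e, x⟩, hx⟩, b⟩ := D
  refine Prod.ext (Subtype.ext (Prod.ext rfl ?_)) rfl
  cases b
  · rfl
  · exact L.act_rev (d := (e, false)) hx

theorem src_rev (D : L.total.E × Bool) :
    L.total.src (L.total.rev D) = L.act (D.1.1.1, D.2) (L.total.src D) :=
  (congrArg (fun D => L.total.src (L.total.rev D)) (eq_liftDart D).symm).trans
    (src_rev_liftDart _ _ _)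

theorem rev_liftDart (d : X.E × Bool) (x : L.T) (h : L.pr x = X.src d) :
    L.total.rev (L.liftDart d x h) = L.liftDart (X.rev d) (L.act d x) (L.pr_act h) := by
  rw [← eq_liftDart (L.total.rev (L.liftDart d x h))]
  exact liftDart_congr rfl (src_rev_liftDart d x h) _

theorem total_bdry (s : L.total.S) (i : Fin 4) : L.total.bdry s i =
    L.liftDart (X.bdry s.1.1 i) (L.cornerPt s.1.1 s.1.2 i) (pr_cornerPt s.2 i) := rfl

theorem total_corner (s : L.total.S) (i : Fin 4) :
    L.total.corner s i = L.cornerPt s.1.1 s.1.2 i := src_liftDart _ _ (pr_cornerPt s.2 i)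

/-! ### The automorphisms of a local system as deck transformations -/

variable (L) in
/-- The group of automorphisms of a local system. -/
def aut : Subgroup (Equiv.Perm L.T) where
  carrier := {g | (∀ x, L.pr (g x) = L.pr x) ∧
    ∀ d x, L.pr x = X.src d → g (L.act d x) = L.act d (g x)}
  mul_mem' := fun {g g'} h h' => ⟨fun x => (h.1 _).trans (h'.1 x), fun d x hx => by
    rw [Equiv.Perm.mul_apply, h'.2 d x hx, h.2 d _ ((h'.1 x).trans hx), Equiv.Perm.mul_apply]⟩
  one_mem' := ⟨fun _ => rfl, fun _ _ _ => rfl⟩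
  inv_mem' := fun {g} h => by
    have h1 : ∀ x, L.pr (g⁻¹ x) = L.pr x := fun x => by
      rw [← h.1 (g⁻¹ x)]
      simp
    refine ⟨h1, fun d x hx => ?_⟩
    rw [Equiv.Perm.inv_eq_iff_eq, h.2 d _ ((h1 x).trans hx)]
    simp

theorem pr_aut (g : L.aut) (x : L.T) : L.pr (g.1 x) = L.pr x := g.2.1 x

theorem aut_act (g : L.aut) {d : X.E × Bool} {x : L.T} (h : L.pr x = X.src d) :
    g.1 (L.act d x) = L.act d (g.1 x) := g.2.2 d x h

theorem aut_cornerPt (g : L.aut) {s : X.S} {x : L.T} (h : L.pr x = X.corner s 0) (i : Fin 4) :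
    g.1 (L.cornerPt s x i) = L.cornerPt s (g.1 x) i := by
  refine fin4_induction (P := fun i => g.1 (L.cornerPt s x i) = L.cornerPt s (g.1 x) i) rfl
    (fun i hi => ?_) i
  rw [← act_cornerPt h, aut_act g (pr_cornerPt h i), hi, act_cornerPt ((pr_aut g x).trans h)]

/-- The deck transformation defined by an automorphism of the local system. -/
def deckHom (g : L.aut) : L.total.Hom L.total where
  onV := g.1
  onE e := ⟨(e.1.1, g.1 e.1.2), (pr_aut g _).trans e.2⟩
  onS s := ⟨(s.1.1, g.1 s.1.2), (pr_aut g _).trans s.2⟩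
  endpt_onE e b := by
    cases b
    · rfl
    · exact (aut_act g (d := (e.1.1, false)) e.2).symm
  bdry_onS s i := by
    refine Prod.ext (Subtype.ext (Prod.ext rfl ?_)) rfl
    change (if _ then L.act _ (L.cornerPt _ _ i) else L.cornerPt _ _ i) =
      g.1 (if _ then L.act _ (L.cornerPt _ _ i) else L.cornerPt _ _ i)
    rw [← aut_cornerPt g s.2, ← aut_act g (pr_cornerPt s.2 i), apply_ite g.1]

variable (L) in
/-- The automorphisms of a local system act on the total complex as deck transformations. -/
def deck : L.aut →* L.total.Hom L.total where
  toFun := deckHom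
  map_one' := rfl
  map_mul' _ _ := rfl

theorem deck_injective : Function.Injective L.deck := fun _ _ h =>
  Subtype.ext (Equiv.ext fun x => congrFun (congrArg Hom.onV h) x)

theorem proj_comp_deck (g : L.aut) : L.proj.comp (L.deck g) = L.proj :=
  Hom.ext (funext (pr_aut g)) rfl rfl

instance : MulAction L.aut L.total.Realization where
  smul g := (L.deck g).realize
  one_smul y := by
    induction y using Quot.ind with | mk c => ?_
    rcases c with _ | _ | _ <;> rfl
  mul_smul g g' y := Hom.realize_comp (L.deck g) (L.deck g') y

theorem isQuotientMap_realize_proj (h : Function.Surjective L.pr) :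
    IsQuotientMap L.proj.realize := by
  choose r hr using h
  let r' : X.Cells → L.total.Cells
    | Sum.inl ⟨v, x⟩ => Sum.inl ⟨r v, x⟩
    | Sum.inr (Sum.inl ⟨e, t⟩) =>
        Sum.inr (Sum.inl ⟨⟨(e, r (X.endpt e false)), hr _⟩, t⟩)
    | Sum.inr (Sum.inr ⟨s, z⟩) => Sum.inr (Sum.inr ⟨⟨(s, r (X.corner s 0)), hr _⟩, z⟩)
  have hr' : Continuous r' := continuous_sum_dom.2
    ⟨continuous_sigma fun _ => continuous_of_discreteTopology,
    continuous_sum_dom.2 ⟨continuous_sigma fun e => continuous_inr.comp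
      (continuous_inl.comp (continuous_sigmaMk (σ := fun _ : L.total.E => unitInterval)
        (i := (⟨(e, r (X.endpt e false)), hr _⟩ : L.total.E)))),
      continuous_sigma fun s => continuous_inr.comp (continuous_inr.comp
        (continuous_sigmaMk (σ := fun _ : L.total.S => unitInterval × unitInterval)
          (i := (⟨(s, r (X.corner s 0)), hr _⟩ : L.total.S))))⟩⟩
  have hq : IsQuotientMap L.proj.onCells := IsQuotientMap.of_inverse hr' (continuous_onCells _) (by
    rintro (⟨v, x⟩ | ⟨e, t⟩ | ⟨s, z⟩)
    · exact congrArg (fun v => (Sum.inl ⟨v, x⟩ : X.Cells)) (hr v)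
    · rfl
    · rfl)
  exact IsQuotientMap.of_comp continuous_quot_mk (continuous_realize _)
    (isQuotientMap_quot_mk.comp hq)

/-- The points of the total space in the cells over the cell of `a`, at the point `a`. -/
def overCell (a : X.Cells) : Set L.total.Realization :=
  {y | ∃ c, L.proj.onCells c = a ∧ Quot.mk _ c = y}

theorem overCell_glue (a a' : X.Cells) (h : X.Glue a a') :
    overCell (L := L) a = overCell a' := by
  cases h with
  | edge e b =>
    ext y
    constructor
    · rintro ⟨c, hc, rfl⟩
      rcases c with ⟨v, _⟩ | ⟨e', t⟩ | ⟨s, z⟩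
      · cases hc
      · cases hc
        refine ⟨Sum.inl ⟨L.total.endpt e' b, ⟨⟩⟩, ?_, (Quot.sound (Glue.edge e' b)).symm⟩
        exact congrArg (fun v => (Sum.inl ⟨v, ⟨⟩⟩ : X.Cells)) (L.proj.endpt_onE e' b).symm
      · cases hc
    · rintro ⟨c, hc, rfl⟩
      rcases c with ⟨v, _⟩ | ⟨e', t⟩ | ⟨s, z⟩
      · have hv : L.pr v = X.src (e, b) := congrArg Sigma.fst (Sum.inl.inj hc)
        refine ⟨Sum.inr (Sum.inl ⟨(L.liftDart (e, b) v hv).1, if b then 1 else 0⟩), rfl, ?_⟩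
        refine (Quot.sound (Glue.edge _ b)).trans ?_
        exact congrArg L.total.pointV (src_liftDart _ v hv)
      · cases hc
      · cases hc
  | square s i t =>
    ext y
    constructor
    · rintro ⟨c, hc, rfl⟩
      rcases c with ⟨v, _⟩ | ⟨e', t⟩ | ⟨s', z⟩
      · cases hc
      · cases hc
      · cases hc
        exact ⟨_, rfl, (Quot.sound (Glue.square s' i t)).symm⟩
    · rintro ⟨c, hc, rfl⟩
      rcases c with ⟨v, _⟩ | ⟨e', t'⟩ | ⟨s', z⟩
      · cases hc
      · have h1 := Sum.inl.inj (Sum.inr.inj hc)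
        have he : e'.1.1 = (X.bdry s i).1 := congrArg Sigma.fst h1
        obtain rfl : t' = flip (X.bdry s i).2 t := eq_of_heq (Sigma.mk.inj h1).2
        have hd : (e'.1.1, (X.bdry s i).2) = X.bdry s i := Prod.ext he rfl
        have hpr : L.pr (L.total.src (e', (X.bdry s i).2)) = X.corner s i :=
          (pr_src _).trans (congrArg X.src hd)
        obtain ⟨x, hx, hxi⟩ := exists_cornerPt s i _ hpr
        have hb : L.total.bdry ⟨(s, x), hx⟩ i = (e', (X.bdry s i).2) := by
          rw [← eq_liftDart (e', (X.bdry s i).2)]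
          exact liftDart_congr hd.symm hxi (pr_cornerPt hx i)
        refine ⟨Sum.inr (Sum.inr ⟨⟨(s, x), hx⟩, sidePoint i t⟩), rfl,
          (charS_side (X := L.total) ⟨(s, x), hx⟩ i t).trans ?_⟩
        rw [hb]
        rfl
      · cases hc

/-- If the automorphisms act simply transitively on the (nonempty) fibres of a local system, then
its total complex covers `X` with the group of automorphisms as a group of deck transformations. -/
theorem isQuotientCoveringMap (hs : Function.Surjective L.pr)
    (ht : ∀ x y, L.pr x = L.pr y → ∃ g : L.aut, g.1 x = y)
    (hf : ∀ (g : L.aut) x, g.1 x = x → g = 1) :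
    IsQuotientCoveringMap L.proj.realize L.aut where
  toIsQuotientMap := isQuotientMap_realize_proj hs
  continuous_const_smul g := continuous_realize (L.deck g)
  apply_eq_iff_mem_orbit {y y'} := by
    constructor
    · intro h
      induction y using Quot.ind with | mk c => ?_
      induction y' using Quot.ind with | mk c' => ?_
      have h1 : overCell (L := L) (L.proj.onCells c) = overCell (L.proj.onCells c') :=
        congrArg (Quot.lift overCell overCell_glue) h
      have h2 : (Quot.mk _ c : L.total.Realization) ∈ overCell (L.proj.onCells c) := ⟨c, rfl, rfl⟩
      rw [h1] at h2
      obtain ⟨c'', hc, hcc⟩ := h2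
      rw [← hcc]
      rcases c'' with ⟨v, _⟩ | ⟨⟨⟨e, x⟩, hx⟩, t⟩ | ⟨⟨⟨s, x⟩, hx⟩, z⟩ <;>
        rcases c' with ⟨v', _⟩ | ⟨⟨⟨e', x'⟩, hx'⟩, t'⟩ | ⟨⟨⟨s', x'⟩, hx'⟩, z'⟩
      · obtain ⟨g, rfl⟩ := ht v' v (congrArg Sigma.fst (Sum.inl.inj hc)).symm
        exact ⟨g, rfl⟩
      · cases hc
      · cases hc
      · cases hc
      · cases hc
        obtain ⟨g, rfl⟩ := ht x' x (hx'.trans hx.symm)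
        exact ⟨g, rfl⟩
      · cases hc
      · cases hc
      · cases hc
      · cases hc
        obtain ⟨g, rfl⟩ := ht x' x (hx'.trans hx.symm)
        exact ⟨g, rfl⟩
    · rintro ⟨g, rfl⟩
      change L.proj.realize ((L.deck g).realize y') = _
      rw [← Hom.realize_comp, proj_comp_deck]
  disjoint y := by
    induction y using Quot.ind with | mk c => ?_
    obtain ⟨a, ha⟩ := exists_near c
    refine ⟨nbhd a, (isOpen_nbhd a).mem_nhds (mk_mem_nbhd.2 ha), fun g hg => ?_⟩
    obtain ⟨_, ⟨y, hy, rfl⟩, hgy⟩ := hg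
    induction y using Quot.ind with | mk c => ?_
    have h1 : Near ((L.deck g).onIndex a) ((L.deck g).onCells c) := near_onCells _ hy
    have h2 : Near a ((L.deck g).onCells c) := hgy
    have hu := near_unique (c := (L.deck g).onCells c)
    rcases a with v | e | s
    · exact hf g v (hu.1 _ _ h1 h2)
    · exact hf g e.1.2 (congrArg (fun e => e.1.2) (hu.2.1 _ _ h1 h2))
    · exact hf g s.1.2 (congrArg (fun s => s.1.2) (hu.2.2 _ _ h1 h2))

/-- If the automorphisms of a connected local system act transitively on its fibres, then every
deck transformation of the total complex comes from an automorphism: the one that agrees with it at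
one vertex agrees with it everywhere. -/
theorem mem_range_deck_iff (ht : ∀ x y, L.pr x = L.pr y → ∃ g : L.aut, g.1 x = y)
    (hc : ∀ (P : L.T → Prop), (∀ d x, L.pr x = X.src d → (P x ↔ P (L.act d x))) →
      ∀ x y, P x → P y) (x₀ : L.T) (f : L.total.Hom L.total) :
    f ∈ Set.range L.deck ↔ L.proj.comp f = L.proj := by
  constructor
  · rintro ⟨g, rfl⟩
    exact proj_comp_deck g
  intro h
  have hV : ∀ x, L.pr (f.onV x) = L.pr x := fun x => congrFun (congrArg Hom.onV h) x
  have hE : ∀ e : L.total.E, (f.onE e).1.1 = e.1.1 := fun e => congrFun (congrArg Hom.onE h) e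
  have hS : ∀ s : L.total.S, (f.onS s).1.1 = s.1.1 := fun s => congrFun (congrArg Hom.onS h) s
  have hact : ∀ d x, L.pr x = X.src d → f.onV (L.act d x) = L.act d (f.onV x) := by
    intro d x hx
    have h1 := f.endpt_onE (L.liftDart d x hx).1 (L.liftDart d x hx).2
    have h2 := f.endpt_onE (L.liftDart d x hx).1 (!(L.liftDart d x hx).2)
    have h5 : L.total.src (f.onE (L.liftDart d x hx).1, d.2) = f.onV x :=
      h1.trans (congrArg f.onV (src_liftDart d x hx))
    have h6 : L.total.src (L.total.rev (f.onE (L.liftDart d x hx).1, d.2)) =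
        f.onV (L.act d x) := h2.trans (congrArg f.onV (src_rev_liftDart d x hx))
    rw [← h6, ← h5, src_rev]
    exact congrArg (fun e => L.act (e, d.2) _) (hE _)
  obtain ⟨g, hg⟩ := ht x₀ (f.onV x₀) (hV x₀).symm
  have hgf : ∀ x, g.1 x = f.onV x := by
    refine fun x => hc (fun x => g.1 x = f.onV x) (fun d x hx => ?_) x₀ x hg
    rw [hact d x hx, aut_act g hx]
    refine ⟨fun h => by rw [h], fun h => ?_⟩
    rw [← L.act_rev ((pr_aut g x).trans hx), h, L.act_rev ((hV x).trans hx)]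
  refine ⟨g, Hom.ext (funext hgf) (funext fun e => ?_) (funext fun s => ?_)⟩
  · refine Subtype.ext (Prod.ext (hE e).symm ((hgf _).trans ?_))
    exact (f.endpt_onE e false).symm
  · refine Subtype.ext (Prod.ext (hS s).symm ((hgf _).trans ?_))
    have h1 := f.corner_onS s 0
    rw [total_corner, total_corner] at h1
    exact h1.symm

end LocalSystem

end SquareComplex

/-! ### The universal local system and the universal cover -/

open Topology

namespace SquareComplex

variable {X : SquareComplex.{u}}

/-- The universal property of a complex without nontrivial coverings: elements of a set `A`,
subject to a condition `q` depending on a vertex, that can be transported along the directed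
edges, compatibly with reversal and with the squares, can be chosen consistently at all vertices
as soon as there is one at the vertex `v₀`. -/
def HasSections (X : SquareComplex.{u}) (v₀ : X.V) : Prop :=
  ∀ {A : Type u} (q : X.V → A → Prop) (τ : X.E × Bool → A → A),
    (∀ d a, q (X.src d) a → q (X.src (X.rev d)) (τ d a)) →
    (∀ d a, q (X.src d) a → τ (X.rev d) (τ d a) = a) →
    (∀ s a, q (X.corner s 0) a →
      τ (X.bdry s 3) (τ (X.bdry s 2) (τ (X.bdry s 1) (τ (X.bdry s 0) a))) = a) →
    ∀ {a₀}, q v₀ a₀ →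
    ∃ u : X.V → A, (∀ v, q v (u v)) ∧ ∀ d, u (X.src (X.rev d)) = τ d (u (X.src d))

theorem HasSections.simplyConnectedSpace {v₀ : X.V} (h : X.HasSections v₀) :
    SimplyConnectedSpace X.Realization := by
  obtain ⟨u, hu, hu'⟩ := h (A := PathClass (X.pointV v₀)) (fun v t => t.1 = X.pointV v)
    (fun d t => PathClass.move (X.charE d.1) (flip d.2 0) (flip d.2 1) t)
    (fun d t ht => by
      rw [← charE_flip_zero] at ht
      rw [← charE_flip_one]
      exact PathClass.move_fst ht)
    (fun d t ht => by
      rw [← charE_flip_zero] at ht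
      have h1 : ∀ b, flip (!b) 0 = flip b 1 ∧ flip (!b) 1 = flip b 0 := by
        rintro (_ | _) <;> simp [flip]
      change PathClass.move (X.charE d.1) (flip (!d.2) 0) (flip (!d.2) 1) _ = _
      rw [(h1 _).1, (h1 _).2, PathClass.move_move _ _ _ _ ht, PathClass.move_self])
    (fun s t ht => by
      rw [← charS_corner] at ht
      simp only [← Transported.move_side, sidePoint_one, show (0 + 1 : Fin 4) = 1 from rfl,
        show (1 + 1 : Fin 4) = 2 from rfl, show (2 + 1 : Fin 4) = 3 from rfl,
        show (3 + 1 : Fin 4) = 0 from rfl]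
      rw [PathClass.move_move _ _ _ _ ht, PathClass.move_move _ _ _ _ ht,
        PathClass.move_move _ _ _ _ ht]
      exact PathClass.move_self _ _ _)
    (a₀ := ⟨_, Path.Homotopic.Quotient.refl _⟩) rfl
  have hw : Transported u := ⟨hu, fun e => by
    simpa [flip, src, rev] using hu' (e, false)⟩
  exact hw.simplyConnectedSpace

/-- The end of the edge path from `v₀` given by a list of directed edges, the last one first. -/
def wordEnd (v₀ : X.V) : List (X.E × Bool) → X.V
  | [] => v₀
  | d :: _ => X.src (X.rev d)

/-- The list of directed edges, the last one first, is an edge path starting at `v₀`. -/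
def IsWord (v₀ : X.V) : List (X.E × Bool) → Prop
  | [] => True
  | d :: w => wordEnd v₀ w = X.src d ∧ IsWord v₀ w

/-- The transport along an edge path. -/
def LocalSystem.run (L : LocalSystem X) (x : L.T) (w : List (X.E × Bool)) : L.T :=
  w.foldr L.act x

namespace LocalSystem

variable {v₀ : X.V} {L : LocalSystem X}

theorem pr_run {x : L.T} (hx : L.pr x = v₀) : ∀ {w}, IsWord v₀ w → L.pr (L.run x w) = wordEnd v₀ w
  | [], _ => hx
  | _ :: _, h => L.pr_act ((pr_run hx h.2).trans h.1)

theorem exists_run_eq : ∀ {w}, IsWord v₀ w → ∀ y, L.pr y = wordEnd v₀ w →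
    ∃ x, L.pr x = v₀ ∧ L.run x w = y
  | [], _, y, hy => ⟨y, hy, rfl⟩
  | d :: w, h, y, hy => by
    obtain ⟨x, hx, hxy⟩ := exists_run_eq h.2 (L.act (X.rev d) y) ((L.pr_act_rev hy).trans h.1.symm)
    exact ⟨x, hx, (congrArg (L.act d) hxy).trans (L.act_act_rev hy)⟩

end LocalSystem

/-- Edge paths from `v₀` are identified if they have the same end and the same transport in every
local system. -/
def wordSetoid (v₀ : X.V) : Setoid {w : List (X.E × Bool) // IsWord v₀ w} where
  r w w' := wordEnd v₀ w.1 = wordEnd v₀ w'.1 ∧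
    ∀ (L : LocalSystem X) (x : L.T), L.pr x = v₀ → L.run x w.1 = L.run x w'.1
  iseqv := ⟨fun _ => ⟨rfl, fun _ _ _ => rfl⟩, fun h => ⟨h.1.symm, fun L x hx => (h.2 L x hx).symm⟩,
    fun h h' => ⟨h.1.trans h'.1, fun L x hx => (h.2 L x hx).trans (h'.2 L x hx)⟩⟩

open Classical in
/-- Appending a directed edge to a class of edge paths, if it starts at their end. -/
noncomputable def appendDart (v₀ : X.V) (d : X.E × Bool) :
    Quotient (wordSetoid v₀) → Quotient (wordSetoid v₀) :=
  Quotient.map (fun w => if h : wordEnd v₀ w.1 = X.src d then ⟨d :: w.1, h, w.2⟩ else w) (by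
    intro w w' h
    by_cases hd : wordEnd v₀ w.1 = X.src d
    · have hd' := h.1.symm.trans hd
      simp only [dif_pos hd, dif_pos hd']
      exact ⟨rfl, fun L x hx => congrArg (L.act d) (h.2 L x hx)⟩
    · have hd' : ¬ wordEnd v₀ w'.1 = X.src d := fun hd' => hd (h.1.trans hd')
      simp only [dif_neg hd, dif_neg hd']
      exact h)

theorem appendDart_mk {v₀ : X.V} {d : X.E × Bool} {w : List (X.E × Bool)} (hw : IsWord v₀ w)
    (h : wordEnd v₀ w = X.src d) :
    appendDart v₀ d (Quotient.mk _ ⟨w, hw⟩) = Quotient.mk _ ⟨d :: w, h, hw⟩ := by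
  rw [appendDart, Quotient.map_mk]
  simp only [dif_pos h]

/-- The universal local system: the classes of edge paths starting at `v₀`. -/
noncomputable def universal (v₀ : X.V) : LocalSystem X where
  T := Quotient (wordSetoid v₀)
  pr := Quotient.lift (fun w => wordEnd v₀ w.1) fun _ _ h => h.1
  act := appendDart v₀
  pr_act {d x} h := by
    induction x using Quotient.inductionOn with | h w => ?_
    obtain ⟨w, hw⟩ := w
    rw [appendDart_mk hw h]
    rfl
  act_rev {d x} h := by
    induction x using Quotient.inductionOn with | h w => ?_
    obtain ⟨w, hw⟩ := w
    have h1 : IsWord v₀ (d :: w) := ⟨h, hw⟩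
    rw [appendDart_mk hw h, appendDart_mk h1 rfl]
    refine Quotient.sound ⟨?_, fun L x hx => ?_⟩
    · exact (congrArg X.src (X.rev_rev d)).trans h.symm
    · exact L.act_rev ((LocalSystem.pr_run hx hw).trans h)
  act_bdry {s x} h := by
    induction x using Quotient.inductionOn with | h w => ?_
    obtain ⟨w, hw⟩ := w
    have h0 : IsWord v₀ (X.bdry s 0 :: w) := ⟨h, hw⟩
    have e1 : X.src (X.rev (X.bdry s 0)) = X.src (X.bdry s 1) := X.bdry_closed s 0
    have e2 : X.src (X.rev (X.bdry s 1)) = X.src (X.bdry s 2) := X.bdry_closed s 1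
    have e3 : X.src (X.rev (X.bdry s 2)) = X.src (X.bdry s 3) := X.bdry_closed s 2
    have h1 : IsWord v₀ (X.bdry s 1 :: X.bdry s 0 :: w) := ⟨e1, h0⟩
    have h2 : IsWord v₀ (X.bdry s 2 :: X.bdry s 1 :: X.bdry s 0 :: w) := ⟨e2, h1⟩
    rw [appendDart_mk hw h, appendDart_mk h0 e1, appendDart_mk h1 e2, appendDart_mk h2 e3]
    refine Quotient.sound ⟨(X.bdry_closed s 3).trans h.symm, fun L x hx => ?_⟩
    exact L.act_bdry ((LocalSystem.pr_run hx hw).trans h)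

namespace universal

open LocalSystem

variable (v₀ : X.V)

/-- The class of the constant edge path. -/
noncomputable def base : (universal v₀).T := Quotient.mk _ ⟨[], trivial⟩

variable {v₀}

theorem pr_base : (universal v₀).pr (base v₀) = v₀ := rfl

theorem act_mk {d : X.E × Bool} {w : List (X.E × Bool)} (hw : IsWord v₀ w)
    (h : wordEnd v₀ w = X.src d) :
    (universal v₀).act d (Quotient.mk _ ⟨w, hw⟩) = Quotient.mk _ ⟨d :: w, h, hw⟩ :=
  appendDart_mk hw h

/-- Any two elements of the universal local system are joined by an edge path. -/
theorem connected {P : (universal v₀).T → Prop}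
    (hP : ∀ d x, (universal v₀).pr x = X.src d → (P x ↔ P ((universal v₀).act d x)))
    (x y : (universal v₀).T) (hx : P x) : P y := by
  have key : ∀ w (hw : IsWord v₀ w), P (Quotient.mk _ ⟨w, hw⟩) ↔ P (base v₀) := by
    intro w
    induction w with
    | nil => exact fun _ => Iff.rfl
    | cons d w ih =>
      intro hw
      rw [← ih hw.2, hP d (Quotient.mk _ ⟨w, hw.2⟩) hw.1, act_mk hw.2 hw.1]
  have key' : ∀ x, P x ↔ P (base v₀) := fun x => by
    induction x using Quotient.inductionOn with | h w => exact key w.1 w.2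
  exact (key' y).2 ((key' x).1 hx)

/-- The map from the universal local system to another one that maps `base` to `x`. -/
noncomputable def toSystem (L : LocalSystem X) {x : L.T} (hx : L.pr x = v₀) :
    (universal v₀).T → L.T :=
  Quotient.lift (fun w => L.run x w.1) fun _ _ h => h.2 L x hx

section

variable {L : LocalSystem X} {x : L.T} (hx : L.pr x = v₀)

theorem toSystem_base : toSystem L hx (base v₀) = x := rfl

theorem pr_toSystem (h : (universal v₀).T) : L.pr (toSystem L hx h) = (universal v₀).pr h := by
  induction h using Quotient.inductionOn with | h w => exact pr_run hx w.2

theorem toSystem_act {d : X.E × Bool} {h : (universal v₀).T} (hd : (universal v₀).pr h = X.src d) :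
    toSystem L hx ((universal v₀).act d h) = L.act d (toSystem L hx h) := by
  induction h using Quotient.inductionOn with | h w => ?_
  obtain ⟨w, hw⟩ := w
  rw [act_mk hw hd]
  rfl

end

theorem toSystem_comp {x y : (universal v₀).T} (hx : (universal v₀).pr x = v₀)
    (hy : (universal v₀).pr y = v₀) (hxy : toSystem _ hx y = base v₀) (h : (universal v₀).T) :
    toSystem _ hx (toSystem _ hy h) = h := by
  refine connected (P := fun h => toSystem _ hx (toSystem _ hy h) = h) (fun d h hd => ?_)
    (base v₀) h hxy
  have hd' := (pr_toSystem hy h).trans hd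
  rw [toSystem_act hy hd, toSystem_act hx hd']
  refine ⟨fun h => by rw [h], fun h' => ?_⟩
  rw [← LocalSystem.act_rev _ ((pr_toSystem hx _).trans hd'), h', LocalSystem.act_rev _ hd]

/-- The automorphisms of the universal local system act transitively on its fibres. -/
theorem exists_aut (x y : (universal v₀).T) (h : (universal v₀).pr x = (universal v₀).pr y) :
    ∃ g : (universal v₀).aut, g.1 x = y := by
  induction x using Quotient.inductionOn with | h w => ?_
  obtain ⟨w, hw⟩ := w
  obtain ⟨a, ha, hay⟩ := exists_run_eq hw y h.symm
  -- the inverse map is determined by its value at `a`, which has to be `base`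
  obtain ⟨b, hb, hba⟩ : ∃ b, ∃ hb : (universal v₀).pr b = v₀, toSystem _ hb a = base v₀ := by
    induction a using Quotient.inductionOn with | h w' => ?_
    obtain ⟨b, hb, hbw⟩ := exists_run_eq w'.2 (base v₀) ha.symm
    exact ⟨b, hb, hbw⟩
  have hab : toSystem _ ha b = base v₀ := by
    obtain ⟨c, hc, hcb⟩ : ∃ c, ∃ hc : (universal v₀).pr c = v₀, toSystem _ hc b = base v₀ := by
      induction b using Quotient.inductionOn with | h w' => ?_
      obtain ⟨c, hc, hcw⟩ := exists_run_eq w'.2 (base v₀) hb.symm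
      exact ⟨c, hc, hcw⟩
    have h1 := toSystem_comp hc hb hcb a
    rw [hba, toSystem_base] at h1
    subst h1
    exact hcb
  exact ⟨⟨⟨toSystem _ ha, toSystem _ hb, toSystem_comp hb ha hba, toSystem_comp ha hb hab⟩,
    pr_toSystem ha, fun _ _ hd => toSystem_act ha hd⟩, hay⟩

/-- The automorphisms of the universal local system act freely. -/
theorem aut_free (g : (universal v₀).aut) (x : (universal v₀).T) (h : g.1 x = x) : g = 1 := by
  refine Subtype.ext (Equiv.ext fun y => ?_)
  refine connected (P := fun y => g.1 y = y) (fun d y hd => ?_) x y h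
  rw [aut_act g hd]
  refine ⟨fun h => by rw [h], fun h => ?_⟩
  rw [← LocalSystem.act_rev _ ((pr_aut g y).trans hd), h, LocalSystem.act_rev _ hd]

theorem pr_surjective [PreconnectedSpace X.Realization] :
    Function.Surjective (universal v₀).pr := by
  refine vertex_induction (P := fun v => ∃ h, (universal v₀).pr h = v) (fun e => ?_)
    (v := v₀) ⟨base v₀, rfl⟩
  constructor
  · rintro ⟨h, hh⟩
    exact ⟨_, (universal v₀).pr_act (d := (e, false)) hh⟩
  · rintro ⟨h, hh⟩
    exact ⟨_, (universal v₀).pr_act (d := (e, true)) hh⟩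

/-- The universal property of the total complex of the universal local system. -/
theorem hasSections : HasSections (universal v₀).total (base v₀) := by
  classical
  intro A q τ hτ hrev hbdry a₀ ha₀
  let act : X.E × Bool → {p : (universal v₀).T × A // q p.1 p.2} →
      {p : (universal v₀).T × A // q p.1 p.2} := fun d p =>
    if h : (universal v₀).pr p.1.1 = X.src d then
      ⟨((universal v₀).act d p.1.1, τ ((universal v₀).liftDart d p.1.1 h) p.1.2), by
        have h1 := hτ ((universal v₀).liftDart d p.1.1 h) p.1.2 (by
          rw [src_liftDart]; exact p.2)
        rwa [src_rev_liftDart] at h1⟩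
    else p
  have act_pos : ∀ {d} {p : {p : (universal v₀).T × A // q p.1 p.2}}
      (h : (universal v₀).pr p.1.1 = X.src d), (act d p).1 =
      ((universal v₀).act d p.1.1, τ ((universal v₀).liftDart d p.1.1 h) p.1.2) := fun {d p} h => by
    simp only [act, dif_pos h]
  let L : LocalSystem X :=
    { T := {p : (universal v₀).T × A // q p.1 p.2}
      pr := fun p => (universal v₀).pr p.1.1
      act := act
      pr_act := fun {d p} h => by rw [act_pos h]; exact (universal v₀).pr_act h
      act_rev := fun {d p} h => by
        have h1 : (universal v₀).pr (act d p).1.1 = X.src (X.rev d) := by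
          rw [act_pos h]; exact (universal v₀).pr_act h
        refine Subtype.ext ?_
        rw [act_pos h1]
        refine Prod.ext ?_ ?_
        · dsimp only
          rw [act_pos h]
          exact (universal v₀).act_rev h
        · dsimp only
          rw [liftDart_congr rfl (congrArg Prod.fst (act_pos h)) h1, ← rev_liftDart _ _ h,
            act_pos h]
          exact hrev _ _ (by rw [src_liftDart]; exact p.2)
      act_bdry := fun {s p} h => by
        have key : ∀ (i : Fin 4) (p' : {p : (universal v₀).T × A // q p.1 p.2}),
            p'.1.1 = (universal v₀).cornerPt s p.1.1 i →
            (act (X.bdry s i) p').1 = ((universal v₀).cornerPt s p.1.1 (i + 1),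
              τ ((universal v₀).total.bdry ⟨(s, p.1.1), h⟩ i) p'.1.2) := by
          intro i p' hp'
          have h1 : (universal v₀).pr p'.1.1 = X.src (X.bdry s i) := by
            rw [hp']; exact pr_cornerPt h i
          rw [act_pos h1, ← act_cornerPt h, ← hp', total_bdry, liftDart_congr rfl hp' h1]
        have h0 := key 0 p rfl
        have h1 := key 1 _ (congrArg Prod.fst h0)
        have h2 := key 2 _ (congrArg Prod.fst h1)
        have h3 := key 3 _ (congrArg Prod.fst h2)
        refine Subtype.ext ?_
        rw [h3, h2, h1, h0]
        exact Prod.ext rfl (hbdry _ _ (by rw [total_corner]; exact p.2)) }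
  have hx : L.pr ⟨(base v₀, a₀), ha₀⟩ = v₀ := pr_base
  have hfst : ∀ h, (toSystem L hx h).1.1 = h := by
    intro h
    induction h using Quotient.inductionOn with | h w => ?_
    obtain ⟨w, hw⟩ := w
    induction w with
    | nil => rfl
    | cons d w ih =>
      rw [← act_mk hw.2 hw.1, toSystem_act hx (h := Quotient.mk _ ⟨w, hw.2⟩) hw.1]
      have h1 : (universal v₀).pr (toSystem L hx (Quotient.mk _ ⟨w, hw.2⟩)).1.1 = X.src d := by
        rw [ih hw.2]; exact hw.1
      refine (congrArg Prod.fst (act_pos h1)).trans ?_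
      dsimp only
      rw [ih hw.2]
  refine ⟨fun h => (toSystem L hx h).1.2, fun h => ?_, fun D => ?_⟩
  · have := (toSystem L hx h).2
    rwa [hfst] at this
  · have h1 : (universal v₀).pr ((universal v₀).total.src D) = X.src (D.1.1.1, D.2) := pr_src D
    have h2 : (universal v₀).pr (toSystem L hx ((universal v₀).total.src D)).1.1 =
        X.src (D.1.1.1, D.2) := by rw [hfst]; exact h1
    rw [src_rev]
    dsimp only
    rw [toSystem_act hx h1]
    refine (congrArg Prod.snd (act_pos h2)).trans ?_
    dsimp only
    rw [liftDart_congr rfl (hfst _) h2, eq_liftDart]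

/-- The total complex of the universal local system is simply connected. -/
instance simplyConnectedSpace : SimplyConnectedSpace (universal v₀).total.Realization :=
  hasSections.simplyConnectedSpace

theorem isQuotientCoveringMap [PreconnectedSpace X.Realization] :
    IsQuotientCoveringMap (universal v₀).proj.realize (universal v₀).aut :=
  LocalSystem.isQuotientCoveringMap pr_surjective exists_aut aut_free

theorem isUniversalCover [PreconnectedSpace X.Realization] :
    (universal v₀).proj.IsUniversalCover :=
  ⟨isQuotientCoveringMap.isCoveringMap, simplyConnectedSpace⟩

theorem mem_range_deck_iff (f : (universal v₀).total.Hom (universal v₀).total) :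
    f ∈ Set.range (universal v₀).deck ↔ (universal v₀).proj.comp f = (universal v₀).proj :=
  LocalSystem.mem_range_deck_iff exists_aut (fun _ hP x y hx => connected hP x y hx) (base v₀) f

/-- The fundamental group is isomorphic to the group of automorphisms of the universal local
system. -/
theorem nonempty_fundamentalGroup_mulEquiv [PreconnectedSpace X.Realization]
    (x : X.Realization) : Nonempty (FundamentalGroup X.Realization x ≃* (universal v₀).aut) := by
  have h := isQuotientCoveringMap (v₀ := v₀)
  obtain ⟨e, he⟩ := h.surjective x
  exact ⟨(h.fundamentalGroupEquiv ⟨e, he⟩).trans (MulEquiv.inv' _).symm⟩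

end universal

end SquareComplex

/-! ### The simplexification is simply connected -/

namespace GenSimplicialComplex

variable {K : GenSimplicialComplex.{u}} {z₀ : K.Realization}

/-- Transport of path classes along the edge between two corners of a simplex. -/
noncomputable def edgeMove (σ : K.Simplex) (x y : K.Corner σ) (t : PathClass z₀) : PathClass z₀ :=
  PathClass.move (K.char σ) (vert σ x) (vert σ y) t

theorem char_vert {τ σ : K.Simplex} {f : K.Corner τ → K.Corner σ} (hf : K.Attach τ σ f)
    (x : K.Corner τ) : K.char σ (vert σ (f x)) = K.char τ (vert τ x) := by
  rw [← map_vert, char_map hf]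

theorem edgeMove_attach {τ σ : K.Simplex} {f : K.Corner τ → K.Corner σ} (hf : K.Attach τ σ f)
    (x y : K.Corner τ) (t : PathClass z₀) : edgeMove σ (f x) (f y) t = edgeMove τ x y t := by
  rw [edgeMove, ← map_vert, ← map_vert]
  refine (PathClass.move_comp (K.char σ) ⟨stdSimplex.map f, stdSimplex.continuous_map f⟩
    _ _ _).symm.trans ?_
  exact PathClass.move_congr (fun b => char_map hf b) _ _ _

theorem edgeMove_self (σ : K.Simplex) (x : K.Corner σ) (t : PathClass z₀) :
    edgeMove σ x x t = t := PathClass.move_self _ _ _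

theorem edgeMove_fst {σ : K.Simplex} {x : K.Corner σ} {t : PathClass z₀}
    (h : t.1 = K.char σ (vert σ x)) (y : K.Corner σ) :
    (edgeMove σ x y t).1 = K.char σ (vert σ y) := PathClass.move_fst h

theorem edgeMove_trans {σ : K.Simplex} {x : K.Corner σ} {t : PathClass z₀}
    (h : t.1 = K.char σ (vert σ x)) (y z : K.Corner σ) :
    edgeMove σ y z (edgeMove σ x y t) = edgeMove σ x z t := PathClass.move_move _ _ _ _ h

end GenSimplicialComplex

namespace SquareComplex.VHStructure

open GenSimplicialComplex

variable {X : SquareComplex.{u}} {W : X.VHStructure}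

theorem IsBlock.mono {e : X.E} {F G : Set (Label X)} (hF : W.IsBlock e F) (h : G ⊆ F)
    (hG : Label.mid ∈ G ∨ G.Nontrivial) : W.IsBlock e G :=
  ⟨hF.vertical, hF.finite.subset h, fun s i hi => hF.adjacent s i (h hi),
    fun ht => hF.one_tip ⟨h ht.1, h ht.2⟩, hG⟩

theorem IsBlock.insert_mid {e : X.E} {F : Set (Label X)} (hF : W.IsBlock e F) :
    W.IsBlock e (insert .mid F) :=
  ⟨hF.vertical, hF.finite.insert _, fun s i hi => hF.adjacent s i (hi.resolve_left (by simp)),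
    fun ht => hF.one_tip ⟨ht.1.resolve_left (by simp), ht.2.resolve_left (by simp)⟩,
    Or.inl (Set.mem_insert _ _)⟩

theorem isBlock_mid {e : X.E} (he : W.vertical e) : W.IsBlock e {.mid} :=
  ⟨he, Set.finite_singleton _, fun _ _ h => by simp at h, fun h => by simp at h, Or.inl rfl⟩

theorem isBlock_tip {e : X.E} (he : W.vertical e) (b : Bool) : W.IsBlock e {.mid, .tip b} :=
  ⟨he, by simp, fun _ _ h => by simp at h, fun h => by cases b <;> simp at h, Or.inl (Or.inl rfl)⟩

theorem isBlock_sq_tip {s : X.S} {i : Fin 4} (hi : W.vertical (X.bdry s i).1) (b : Bool) :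
    W.IsBlock (X.bdry s i).1 {.sq s i, .tip b} :=
  ⟨hi, by simp, fun s' i' h => by
      simp only [Set.mem_insert_iff, Label.sq.injEq, Set.mem_singleton_iff, reduceCtorEq,
        or_false] at h
      rw [h.1, h.2], fun h => by cases b <;> simp at h,
    Or.inr ⟨_, Or.inl rfl, _, Or.inr rfl, by simp⟩⟩

/-- The inclusion of blocks as an attaching map. -/
theorem attach_inclusion {e : X.E} {F G : Set (Label X)} (hF : W.IsBlock e F) (hG : W.IsBlock e G)
    (h : F ⊆ G) :
    W.simplexification.Attach (.block e F hF) (.block e G hG) (Set.inclusion h) :=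
  ⟨rfl, fun _ => rfl⟩

theorem sideAt_true (k : Fin 4) : sideAt (k - 1) true = k := sub_add_cancel k 1

theorem sideAt_false (k : Fin 4) : sideAt (k + 1) false = k := add_sub_cancel_right k 1

theorem tipAt_true (s : X.S) (k : Fin 4) : tipAt X s (k - 1) true = (X.bdry s k).2 :=
  congrArg (fun i => (X.bdry s i).2) (sub_add_cancel k 1)

theorem tipAt_false (s : X.S) (k : Fin 4) : tipAt X s (k + 1) false = !(X.bdry s k).2 :=
  congrArg (fun i => !(X.bdry s i).2) (add_sub_cancel_right k 1)

/-- The edge that joins the centre of `s` to one end of the horizontal side `j`, as a face of the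
triangle over that side and as a block. -/
theorem exists_attach_tri {s : X.S} {j : Fin 4} (hj : ¬ W.vertical (X.bdry s j).1) {c : Bool}
    {i : Fin 4} (hi : sideAt j c = i) {b : Bool} (hb : tipAt X s j c = b)
    (hF : W.IsBlock (X.bdry s i).1 {.sq s i, .tip b}) :
    ∃ f, W.simplexification.Attach (.block (X.bdry s i).1 {.sq s i, .tip b} hF) (.tri s j hj) f ∧
      f ⟨.sq s i, Or.inl rfl⟩ = none ∧ f ⟨.tip b, Or.inr rfl⟩ = some ⟨c⟩ := by
  classical
  subst hi hb
  refine ⟨fun x => if x.1 = Label.sq s (sideAt j c) then none else some ⟨c⟩,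
    ⟨c, rfl, rfl, fun x => ⟨fun h => if_pos h, fun h => if_neg (by rw [h]; simp)⟩⟩,
    if_pos rfl, if_neg (by simp)⟩

/-- The point of the realisation of `X*` at a vertex of `X`. -/
noncomputable def pointVtx (W : X.VHStructure) (v : X.V) : W.simplexification.Realization :=
  W.simplexification.char (.vtx v) (vert (K := W.simplexification) (.vtx v) ⟨⟩)

theorem char_vert_vtx {σ : Cell W} {x : CellCorner W σ} {v : X.V} (h : cellNode W σ x = .vtx v) :
    W.simplexification.char σ (vert (K := W.simplexification) σ x) = W.pointVtx v :=
  char_vert (K := W.simplexification) (τ := .vtx v) (f := fun _ => x) h ⟨⟩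

theorem char_vert_ctr {σ : Cell W} {x : CellCorner W σ} {s : X.S} (h : cellNode W σ x = .ctr s) :
    W.simplexification.char σ (vert (K := W.simplexification) σ x) =
      W.simplexification.char (.ctr s) (vert (K := W.simplexification) (.ctr s) ⟨⟩) :=
  char_vert (K := W.simplexification) (τ := .ctr s) (f := fun _ => x) h ⟨⟩

theorem char_vert_mid {e : X.E} {F : Set (Label X)} (hF : W.IsBlock e F) (h : Label.mid ∈ F) :
    W.simplexification.char (.block e F hF) (vert (K := W.simplexification) (.block e F hF) ⟨_, h⟩) =
      W.simplexification.char (.block e {.mid} (isBlock_mid hF.vertical))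
        (vert (K := W.simplexification) (.block e {.mid} (isBlock_mid hF.vertical)) ⟨_, rfl⟩) :=
  char_vert (attach_inclusion (isBlock_mid hF.vertical) hF (Set.singleton_subset_iff.2 h)) ⟨_, rfl⟩

variable {z₀ : W.simplexification.Realization}

/-- Transport along the edge between two corners of a simplex of `X*`. -/
noncomputable abbrev cellMove (σ : Cell W) (x y : CellCorner W σ) (t : PathClass z₀) :
    PathClass z₀ :=
  edgeMove (K := W.simplexification) σ x y t

/-- Transport between two labels of a block. -/
noncomputable abbrev blockMove {e : X.E} {F : Set (Label X)} (hF : W.IsBlock e F) (a b : F)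
    (t : PathClass z₀) : PathClass z₀ :=
  cellMove (.block e F hF) a b t

theorem blockMove_mono {e : X.E} {F G : Set (Label X)} (hF : W.IsBlock e F) (hG : W.IsBlock e G)
    (h : F ⊆ G) (a b : F) (t : PathClass z₀) :
    blockMove hG ⟨a, h a.2⟩ ⟨b, h b.2⟩ t = blockMove hF a b t :=
  edgeMove_attach (attach_inclusion hF hG h) a b t

/-- Transport from one end of the vertical edge `e` to its midpoint. -/
noncomputable def toMid {e : X.E} (he : W.vertical e) (b : Bool) (t : PathClass z₀) :
    PathClass z₀ :=
  blockMove (isBlock_tip he b) ⟨.tip b, Or.inr rfl⟩ ⟨.mid, Or.inl rfl⟩ t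

open Classical in
/-- Transport along an edge of `X`, considered as a path in `X*`. -/
noncomputable def dartMove (d : X.E × Bool) (t : PathClass z₀) : PathClass z₀ :=
  if hd : W.vertical d.1 then
    blockMove (isBlock_tip hd (!d.2)) ⟨.mid, Or.inl rfl⟩ ⟨.tip (!d.2), Or.inr rfl⟩ (toMid hd d.2 t)
  else cellMove (.horiz d.1 hd) ⟨d.2⟩ ⟨!d.2⟩ t

/-- Transport from one end of the horizontal side `j` of the square `s` to its centre. -/
noncomputable def toCtr (s : X.S) (j : Fin 4) (hj : ¬ W.vertical (X.bdry s j).1) (c : Bool)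
    (t : PathClass z₀) : PathClass z₀ :=
  cellMove (.tri s j hj) (some ⟨c⟩) none t

theorem toMid_fst {e : X.E} (he : W.vertical e) {b : Bool} {t : PathClass z₀}
    (h : t.1 = W.pointVtx (X.endpt e b)) : (toMid he b t).1 =
      W.simplexification.char (.block e {.mid} (isBlock_mid he))
        (vert (K := W.simplexification) (.block e {.mid} (isBlock_mid he)) ⟨_, rfl⟩) :=
  (edgeMove_fst (h.trans (char_vert_vtx rfl).symm) _).trans (char_vert_mid _ _)

theorem toMid_dartMove {d : X.E × Bool} (hd : W.vertical d.1) {t : PathClass z₀}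
    (h : t.1 = W.pointVtx (X.src d)) : toMid hd (!d.2) (dartMove d t) = toMid hd d.2 t := by
  rw [dartMove, dif_pos hd, toMid]
  refine (edgeMove_trans ((toMid_fst hd h).trans ?_) _ _).trans (edgeMove_self _ _ _)
  exact (char_vert_mid _ _).symm

theorem dartMove_fst {d : X.E × Bool} {t : PathClass z₀} (h : t.1 = W.pointVtx (X.src d)) :
    (dartMove d t).1 = W.pointVtx (X.src (X.rev d)) := by
  by_cases hd : W.vertical d.1
  · rw [dartMove, dif_pos hd]
    refine (edgeMove_fst ((toMid_fst hd h).trans ?_) _).trans (char_vert_vtx rfl)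
    exact (char_vert_mid _ _).symm
  · rw [dartMove, dif_neg hd]
    exact (edgeMove_fst (h.trans (char_vert_vtx rfl).symm) _).trans (char_vert_vtx rfl)

theorem dartMove_rev {d : X.E × Bool} {t : PathClass z₀} (h : t.1 = W.pointVtx (X.src d)) :
    dartMove (X.rev d) (dartMove d t) = t := by
  obtain ⟨e, b⟩ := d
  by_cases hd : W.vertical e
  · have h1 : dartMove (X.rev (e, b)) (dartMove (e, b) t) =
        blockMove (isBlock_tip hd (!!b)) ⟨.mid, Or.inl rfl⟩ ⟨.tip (!!b), Or.inr rfl⟩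
          (toMid hd (!b) (dartMove (e, b) t)) := dif_pos hd
    rw [h1, toMid_dartMove (d := (e, b)) hd h]
    have h2 : ∀ c, c = b → blockMove (isBlock_tip hd c) ⟨.mid, Or.inl rfl⟩ ⟨.tip c, Or.inr rfl⟩
        (toMid hd b t) = t := by
      rintro _ rfl
      exact (edgeMove_trans (h.trans (char_vert_vtx rfl).symm) _ _).trans (edgeMove_self _ _ _)
    exact h2 _ (Bool.not_not b)
  · have h1 : dartMove (X.rev (e, b)) (dartMove (e, b) t) =
        cellMove (.horiz e hd) ⟨!b⟩ ⟨!!b⟩ (dartMove (e, b) t) := dif_neg hd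
    rw [h1, dartMove, dif_neg hd]
    simp only [Bool.not_not]
    exact (edgeMove_trans (h.trans (char_vert_vtx rfl).symm) _ _).trans (edgeMove_self _ _ _)

/-- Transport to the centre of a square through the ends of a horizontal side. -/
theorem toCtr_dartMove {s : X.S} {j : Fin 4} (hj : ¬ W.vertical (X.bdry s j).1) {t : PathClass z₀}
    (h : t.1 = W.pointVtx (X.corner s j)) :
    toCtr s j hj true (dartMove (X.bdry s j) t) = toCtr s j hj false t := by
  have hf : W.simplexification.Attach (.horiz (X.bdry s j).1 hj) (.tri s j hj)
      (fun b => some ⟨xor b.down (X.bdry s j).2⟩) := ⟨rfl, fun _ => rfl⟩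
  have h1 := edgeMove_attach hf ⟨(X.bdry s j).2⟩ ⟨!(X.bdry s j).2⟩ t
  simp only [bne_self_eq_false, Bool.not_bne_self] at h1
  rw [dartMove, dif_neg hj, toCtr, cellMove, cellMove, ← h1]
  exact edgeMove_trans (h.trans (char_vert_vtx (by simp [cellNode])).symm) _ _

/-- Transport to the centre of a square through the ends of a vertical side. -/
theorem toCtr_vertical {s : X.S} {k : Fin 4} (hk : W.vertical (X.bdry s k).1) {j : Fin 4}
    (hj : ¬ W.vertical (X.bdry s j).1) {c b : Bool} (hs : sideAt j c = k) (hb : tipAt X s j c = b)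
    {t : PathClass z₀} (h : t.1 = W.pointVtx (X.endpt (X.bdry s k).1 b)) (hF : W.IsBlock
      (X.bdry s k).1 {.mid, .sq s k}) :
    toCtr s j hj c t = blockMove hF ⟨.mid, Or.inl rfl⟩ ⟨.sq s k, Or.inr rfl⟩ (toMid hk b t) := by
  obtain ⟨f, hf, hf0, hf1⟩ := exists_attach_tri hj hs hb (isBlock_sq_tip hk b)
  have hG : W.IsBlock (X.bdry s k).1 {.mid, .sq s k, .tip b} := (isBlock_sq_tip hk b).insert_mid
  have h1 := edgeMove_attach hf ⟨.tip b, Or.inr rfl⟩ ⟨.sq s k, Or.inl rfl⟩ t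
  rw [hf0, hf1] at h1
  have h2 := blockMove_mono (isBlock_sq_tip hk b) hG (Set.subset_insert _ _)
    ⟨.tip b, Or.inr rfl⟩ ⟨.sq s k, Or.inl rfl⟩ t
  have h3 := blockMove_mono (isBlock_tip hk b) hG (by intro x hx; simp at hx ⊢; tauto)
    ⟨.tip b, Or.inr rfl⟩ ⟨.mid, Or.inl rfl⟩ t
  have h4 := blockMove_mono hF hG (by intro x hx; simp at hx ⊢; tauto)
    ⟨.mid, Or.inl rfl⟩ ⟨.sq s k, Or.inr rfl⟩ (toMid hk b t)
  refine h1.trans (h2.symm.trans (Eq.trans ?_ h4))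
  rw [toMid, ← h3]
  exact (edgeMove_trans (h.trans (char_vert_vtx rfl).symm) _ _).symm

theorem isBlock_mid_sq {s : X.S} {i : Fin 4} (hi : W.vertical (X.bdry s i).1) :
    W.IsBlock (X.bdry s i).1 {.mid, .sq s i} :=
  (isBlock_sq_tip hi true).insert_mid.mono (by intro x hx; simp at hx ⊢; tauto)
    (Or.inl (Or.inl rfl))

theorem toCtr_dartMove_vertical {s : X.S} {k : Fin 4} (hk : W.vertical (X.bdry s k).1)
    (hj : ¬ W.vertical (X.bdry s (k - 1)).1) (hj' : ¬ W.vertical (X.bdry s (k + 1)).1)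
    {t : PathClass z₀} (h : t.1 = W.pointVtx (X.corner s k)) :
    toCtr s (k + 1) hj' false (dartMove (X.bdry s k) t) = toCtr s (k - 1) hj true t := by
  rw [toCtr_vertical hk hj (sideAt_true k) (tipAt_true s k) h (isBlock_mid_sq hk),
    toCtr_vertical hk hj' (sideAt_false k) (tipAt_false s k) (dartMove_fst h) (isBlock_mid_sq hk),
    toMid_dartMove hk h]

theorem toCtr_injective {s : X.S} {j : Fin 4} (hj : ¬ W.vertical (X.bdry s j).1) {c : Bool}
    {t t' : PathClass z₀} (h : t.1 = W.pointVtx (X.corner s (if c then j + 1 else j)))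
    (h' : t'.1 = W.pointVtx (X.corner s (if c then j + 1 else j)))
    (htt : toCtr s j hj c t = toCtr s j hj c t') : t = t' := by
  have key : ∀ {t : PathClass z₀}, t.1 = W.pointVtx (X.corner s (if c then j + 1 else j)) →
      cellMove (.tri s j hj) none (some ⟨c⟩) (toCtr s j hj c t) = t := fun {t} h =>
    (edgeMove_trans (h.trans (char_vert_vtx rfl).symm) _ _).trans (edgeMove_self _ _ _)
  rw [← key h, htt, key h']

theorem vertical_sub_one (W : X.VHStructure) (s : X.S) (k : Fin 4) :
    W.vertical (X.bdry s k).1 ↔ ¬ W.vertical (X.bdry s (k - 1)).1 := by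
  have := W.alternating s (k - 1)
  rwa [sub_add_cancel] at this

theorem dartMove_bdry {s : X.S} {t : PathClass z₀} (h : t.1 = W.pointVtx (X.corner s 0)) :
    dartMove (X.bdry s 3) (dartMove (X.bdry s 2)
      (dartMove (X.bdry s 1) (dartMove (X.bdry s 0) t))) = t := by
  have step : ∀ {i} {t : PathClass z₀}, t.1 = W.pointVtx (X.corner s i) →
      (dartMove (X.bdry s i) t).1 = W.pointVtx (X.corner s (i + 1)) := fun {i t} h => by
    rw [corner_succ]; exact dartMove_fst h
  have h1 := step h
  have h2 := step h1
  have h3 := step h2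
  have h4 := step h3
  by_cases hv : W.vertical (X.bdry s 0).1
  · have v1 : ¬ W.vertical (X.bdry s 1).1 := fun h => (W.alternating s 0).1 h hv
    have v2 : W.vertical (X.bdry s 2).1 := (W.alternating s 1).2 v1
    have v3 : ¬ W.vertical (X.bdry s 3).1 := fun h => (W.alternating s 2).1 h v2
    refine toCtr_injective v3 (c := true) h4 h ?_
    exact (toCtr_dartMove v3 h3).trans ((toCtr_dartMove_vertical v2 v1 v3 h2).trans
      ((toCtr_dartMove v1 h1).trans (toCtr_dartMove_vertical hv v3 v1 h)))
  · have v1 : W.vertical (X.bdry s 1).1 := (W.alternating s 0).2 hv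
    have v2 : ¬ W.vertical (X.bdry s 2).1 := fun h => (W.alternating s 1).1 h v1
    have v3 : W.vertical (X.bdry s 3).1 := (W.alternating s 2).2 v2
    refine toCtr_injective hv (c := false) h4 h ?_
    exact (toCtr_dartMove_vertical v3 v2 hv h3).trans ((toCtr_dartMove v2 h2).trans
      ((toCtr_dartMove_vertical v1 hv v2 h1).trans (toCtr_dartMove hv h)))

open Classical in
/-- The extension to all vertices of `X*` of path classes chosen at the vertices of `X`. -/
noncomputable def onNode (W : X.VHStructure) {z₀ : W.simplexification.Realization}
    (u : X.V → PathClass z₀) : Node X → PathClass z₀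
  | .vtx v => u v
  | .mid e => if he : W.vertical e then toMid he false (u (X.endpt e false)) else
      u (X.endpt e false)
  | .ctr s => if h : W.vertical (X.bdry s 0).1 then
      toCtr s 1 (fun h' => (W.alternating s 0).1 h' h) false (u (X.corner s 1))
      else toCtr s 0 h false (u (X.corner s 0))

section

variable {u : X.V → PathClass z₀} (hu : ∀ v, (u v).1 = W.pointVtx v)
  (hd : ∀ d, u (X.src (X.rev d)) = dartMove d (u (X.src d)))
include hu hd

theorem onNode_mid {e : X.E} (he : W.vertical e) (b : Bool) :
    W.onNode u (.mid e) = toMid he b (u (X.endpt e b)) := by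
  have h1 : W.onNode u (.mid e) = toMid he false (u (X.endpt e false)) := dif_pos he
  cases b
  · exact h1
  · have h2 : u (X.endpt e true) = _ := hd (e, false)
    rw [h1, h2]
    exact (toMid_dartMove (d := (e, false)) he (hu _)).symm

theorem onNode_ctr {s : X.S} {j : Fin 4} (hj : ¬ W.vertical (X.bdry s j).1) (c : Bool) :
    W.onNode u (.ctr s) = toCtr s j hj c (u (X.corner s (if c then j + 1 else j))) := by
  have hs : ∀ i, u (X.corner s (i + 1)) = dartMove (X.bdry s i) (u (X.corner s i)) := fun i => by
    rw [corner_succ]; exact hd _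
  have hc : ∀ {j : Fin 4} (hj : ¬ W.vertical (X.bdry s j).1) (c : Bool),
      toCtr s j hj c (u (X.corner s (if c then j + 1 else j))) =
        toCtr s j hj false (u (X.corner s j)) := fun {j} hj c => by
    cases c
    · rfl
    · exact (congrArg (toCtr s j hj true) (hs j)).trans (toCtr_dartMove hj (hu _))
  have hv : ∀ {k : Fin 4} (hk : W.vertical (X.bdry s k).1)
      (hj : ¬ W.vertical (X.bdry s (k - 1)).1) (hj' : ¬ W.vertical (X.bdry s (k + 1)).1),
      toCtr s (k + 1) hj' false (u (X.corner s (k + 1))) =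
        toCtr s (k - 1) hj false (u (X.corner s (k - 1))) := fun {k} hk hj hj' => by
    rw [hs k, toCtr_dartMove_vertical hk hj hj' (hu _), ← hc hj true]
    simp
  rw [hc]
  have key : ∀ {i j : Fin 4} (hi : ¬ W.vertical (X.bdry s i).1)
      (hj : ¬ W.vertical (X.bdry s j).1),
      toCtr s i hi false (u (X.corner s i)) = toCtr s j hj false (u (X.corner s j)) := by
    intro i j hi hj
    have a0 := W.alternating s i
    have a1 := W.alternating s (i + 1)
    have a2 := W.alternating s (i + 2)
    rcases fin4_cases i j with rfl | rfl | rfl | rfl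
    · rfl
    · exact absurd (a0.2 hi) hj
    · have h1 : W.vertical (X.bdry s (i + 1)).1 := a0.2 hi
      have e1 : i + 1 - 1 = i := add_sub_cancel_right i 1
      have e2 : i + 1 + 1 = i + 2 := add_assoc i 1 1
      have := hv h1 (by rwa [e1]) (by rwa [e2])
      simp only [e1, e2] at this
      exact this.symm
    · refine absurd ?_ hj
      have e2 : i + 1 + 1 = i + 2 := add_assoc i 1 1
      have e3 : i + 2 + 1 = i + 3 := add_assoc i 2 1
      rw [e2] at a1
      rw [e3] at a2
      exact a2.2 fun h => a1.1 h (a0.2 hi)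
  rw [onNode]
  split
  · exact key _ _
  · exact key _ _

theorem onNode_fst (σ : Cell W) (x : CellCorner W σ) :
    (W.onNode u (cellNode W σ x)).1 =
      W.simplexification.char σ (vert (K := W.simplexification) σ x) := by
  cases hn : cellNode W σ x with
  | vtx v => exact (hu v).trans (char_vert_vtx hn).symm
  | ctr s =>
    obtain ⟨j, hj⟩ : ∃ j, ¬ W.vertical (X.bdry s j).1 := by
      by_cases h : W.vertical (X.bdry s 0).1
      · exact ⟨1, fun h' => (W.alternating s 0).1 h' h⟩
      · exact ⟨0, h⟩
    rw [char_vert_ctr hn, onNode_ctr hu hd hj false]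
    refine (edgeMove_fst ((hu _).trans (char_vert_vtx rfl).symm) _).trans (char_vert_ctr rfl)
  | mid e =>
    match σ, x, hn with
    | .horiz _ _, _, hn => cases hn
    | .tri _ _ _, none, hn => cases hn
    | .tri _ _ _, some _, hn => cases hn
    | .block e' F hF, ⟨.tip _, _⟩, hn => cases hn
    | .block e' F hF, ⟨.sq _ _, _⟩, hn => cases hn
    | .block e' F hF, ⟨.mid, hx⟩, hn =>
      cases hn
      rw [onNode_mid hu hd hF.vertical false, toMid_fst hF.vertical (hu _), char_vert_mid hF hx]

/-- Path classes that are transported along the edges of `X` are, after extension to the other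
vertices of `X*`, transported along its simplices. -/
theorem transported_onNode :
    GenSimplicialComplex.Transported (K := W.simplexification)
      (fun σ x => W.onNode u (cellNode W σ x)) where
  fst := onNode_fst hu hd
  attach hf x := congrArg (W.onNode u) (cellNode_of_attach W hf x)
  move := by
    -- it suffices to compare each corner with one fixed corner
    have star : ∀ (σ : Cell W) (z : CellCorner W σ),
        (∀ x, cellMove σ x z (W.onNode u (cellNode W σ x)) = W.onNode u (cellNode W σ z)) →
        ∀ x y, W.onNode u (cellNode W σ y) = cellMove σ x y (W.onNode u (cellNode W σ x)) := by
      intro σ z h x y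
      have hx := onNode_fst hu hd σ x
      have hy := onNode_fst hu hd σ y
      refine Eq.trans ?_ (edgeMove_trans hx z y)
      change _ = cellMove σ z y (cellMove σ x z _)
      rw [h x, ← h y]
      exact ((edgeMove_trans hy z y).trans (edgeMove_self _ _ _)).symm
    have block : ∀ {e : X.E} {F : Set (Label X)} (hF : W.IsBlock e F) (hm : .mid ∈ F) (x : F),
        blockMove hF x ⟨.mid, hm⟩ (W.onNode u (x.1.node e)) = W.onNode u (.mid e) := by
      rintro e F hF hm ⟨_ | b | ⟨s, i⟩, hx⟩
      · exact edgeMove_self _ _ _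
      · rw [onNode_mid hu hd hF.vertical b]
        exact blockMove_mono (isBlock_tip hF.vertical b) hF
          (by rintro y (rfl | rfl) <;> assumption) ⟨.tip b, Or.inr rfl⟩ ⟨.mid, Or.inl rfl⟩ _
      · obtain rfl := hF.adjacent s i hx
        have hk := hF.vertical
        have hj : ¬ W.vertical (X.bdry s (i + 1)).1 := fun h => (W.alternating s i).1 h hk
        have hn : u (X.corner s (i + 1)) = u (X.endpt (X.bdry s i).1 (!(X.bdry s i).2)) :=
          congrArg u (X.bdry_closed s i).symm
        have h1 : W.onNode u (.ctr s) = _ := onNode_ctr hu hd hj false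
        simp only [Bool.false_eq_true, if_false] at h1
        rw [hn, toCtr_vertical hk hj (sideAt_false i) (tipAt_false s i) (hu _)
          (isBlock_mid_sq hk), ← onNode_mid hu hd hk] at h1
        have h2 := blockMove_mono (isBlock_mid_sq hk) hF
          (by rintro y (rfl | rfl) <;> assumption) ⟨.sq s i, Or.inr rfl⟩ ⟨.mid, Or.inl rfl⟩
          (W.onNode u (.ctr s))
        refine h2.trans ?_
        rw [h1]
        have h3 := onNode_fst hu hd (.block _ _ (isBlock_mid_sq hk)) ⟨.mid, Or.inl rfl⟩
        exact (edgeMove_trans h3 _ _).trans (edgeMove_self _ _ _)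
    intro σ
    match σ with
    | .vtx v => exact star (.vtx v) ⟨⟩ fun _ => edgeMove_self _ _ _
    | .ctr s => exact star (.ctr s) ⟨⟩ fun _ => edgeMove_self _ _ _
    | .horiz h hh =>
      refine star (.horiz h hh) ⟨true⟩ fun ⟨b⟩ => ?_
      cases b
      · have h1 : u (X.endpt h true) = _ := hd (h, false)
        exact (h1.trans (dif_neg hh)).symm
      · exact edgeMove_self _ _ _
    | .tri s j hj =>
      refine star (.tri s j hj) none fun x => ?_
      rcases x with _ | ⟨⟨c⟩⟩
      · exact edgeMove_self _ _ _
      · exact (onNode_ctr hu hd hj c).symm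
    | .block e F hF =>
      intro x y
      have h1 := star (.block e _ hF.insert_mid) ⟨.mid, Set.mem_insert _ _⟩
        (block hF.insert_mid (Set.mem_insert _ _)) ⟨x.1, Or.inr x.2⟩ ⟨y.1, Or.inr y.2⟩
      exact h1.trans (blockMove_mono hF hF.insert_mid (Set.subset_insert _ _) x y _)

end

/-- The simplexification of a square complex with the universal property is simply connected. -/
theorem simplyConnectedSpace_simplexification (W : X.VHStructure) {v₀ : X.V}
    (h : X.HasSections v₀) : SimplyConnectedSpace W.simplexification.Realization := by
  obtain ⟨u, hu, hd⟩ := h (A := PathClass (W.pointVtx v₀)) (fun v t => t.1 = W.pointVtx v)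
    dartMove (fun _ _ => dartMove_fst) (fun _ _ => dartMove_rev) (fun _ _ => dartMove_bdry)
    (a₀ := ⟨_, Path.Homotopic.Quotient.refl _⟩) rfl
  exact (transported_onNode hu hd).simplyConnectedSpace

end SquareComplex.VHStructure

/-! ### Labelled simplicial complexes -/

namespace GenSimplicialComplex

/-- A labelling of the corners of the simplices of a complex by elements of `N` that exhibits it as
a simplicial complex in the usual sense with vertices in `N`: it is compatible with the attaching
maps, injective on each simplex, and a simplex is determined by its set of labels. -/
structure Labelling (L : GenSimplicialComplex.{u}) (N : Type u) where
  label : ∀ σ, L.Corner σ → N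
  label_attach : ∀ {τ σ} {f : L.Corner τ → L.Corner σ}, L.Attach τ σ f →
    ∀ x, label σ (f x) = label τ x
  injective : ∀ σ, Function.Injective (label σ)
  unique : ∀ {σ τ}, Set.range (label σ) = Set.range (label τ) → σ = τ

namespace Labelling

variable {L : GenSimplicialComplex.{u}} {N : Type u} (ν : L.Labelling N)

/-- Two labels occur in a common simplex. -/
def Joined (a b : N) : Prop := ∃ σ, a ∈ Set.range (ν.label σ) ∧ b ∈ Set.range (ν.label σ)

theorem exists_face {σ : L.Simplex} {S : Set N} (hS : S.Nonempty)
    (h : S ⊆ Set.range (ν.label σ)) : ∃ τ, L.IsFace τ σ ∧ Set.range (ν.label τ) = S := by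
  obtain ⟨⟨τ, f⟩, ⟨hf, hr⟩, -⟩ := L.existsUnique_face σ (ν.label σ ⁻¹' S) (by
    obtain ⟨a, ha⟩ := hS
    obtain ⟨x, rfl⟩ := h ha
    exact ⟨x, ha⟩)
  dsimp only at hf hr
  refine ⟨τ, ⟨f, hf⟩, ?_⟩
  have h1 : ν.label τ = ν.label σ ∘ f := funext fun x => (ν.label_attach hf x).symm
  rw [h1, Set.range_comp, hr, Set.image_preimage_eq_of_subset h]

theorem range_mono {τ σ : L.Simplex} (h : L.IsFace τ σ) :
    Set.range (ν.label τ) ⊆ Set.range (ν.label σ) := by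
  obtain ⟨f, hf⟩ := h
  rintro _ ⟨x, rfl⟩
  exact ⟨f x, ν.label_attach hf x⟩

theorem isFace_of_subset {τ σ : L.Simplex}
    (h : Set.range (ν.label τ) ⊆ Set.range (ν.label σ)) : L.IsFace τ σ := by
  obtain ⟨ρ, hρ, hr⟩ := ν.exists_face (Set.range_nonempty _) h
  obtain rfl := ν.unique hr
  exact hρ

theorem isVertex_iff {σ : L.Simplex} : L.IsVertex σ ↔ ∃ a, Set.range (ν.label σ) = {a} := by
  constructor
  · intro h
    obtain ⟨x⟩ := L.nonempty_corner σ
    have := h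
    refine ⟨ν.label σ x, Set.ext fun a => ⟨?_, ?_⟩⟩
    · rintro ⟨y, rfl⟩
      exact congrArg _ (h.elim y x)
    · rintro rfl
      exact ⟨x, rfl⟩
  · rintro ⟨a, ha⟩
    refine ⟨fun x y => ν.injective σ ?_⟩
    have hx : ν.label σ x ∈ ({a} : Set N) := ha ▸ ⟨x, rfl⟩
    have hy : ν.label σ y ∈ ({a} : Set N) := ha ▸ ⟨y, rfl⟩
    exact hx.trans hy.symm

/-- The label of a vertex. -/
noncomputable def vertexLabel (v : {v : L.Simplex // L.IsVertex v}) : N :=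
  (ν.isVertex_iff.1 v.2).choose

theorem range_label (v : {v : L.Simplex // L.IsVertex v}) :
    Set.range (ν.label v.1) = {ν.vertexLabel v} := (ν.isVertex_iff.1 v.2).choose_spec

theorem vertexLabel_injective : Function.Injective ν.vertexLabel := fun v w h =>
  Subtype.ext (ν.unique (by rw [range_label, range_label, h]))

theorem isFace_vertex {v : {v : L.Simplex // L.IsVertex v}} {σ : L.Simplex} :
    L.IsFace v.1 σ ↔ ν.vertexLabel v ∈ Set.range (ν.label σ) := by
  rw [← Set.singleton_subset_iff, ← range_label]
  exact ⟨ν.range_mono, ν.isFace_of_subset⟩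

theorem exists_vertex {σ : L.Simplex} {a : N} (h : a ∈ Set.range (ν.label σ)) :
    ∃ v, ν.vertexLabel v = a := by
  obtain ⟨v, -, hv⟩ := ν.exists_face (Set.singleton_nonempty a) (Set.singleton_subset_iff.2 h)
  refine ⟨⟨v, ν.isVertex_iff.2 ⟨a, hv⟩⟩, ?_⟩
  exact (Set.singleton_injective (hv.symm.trans (ν.range_label ⟨v, _⟩))).symm

theorem adj_iff {v w : {v : L.Simplex // L.IsVertex v}} :
    L.graph.Adj v w ↔ v ≠ w ∧ ν.Joined (ν.vertexLabel v) (ν.vertexLabel w) := by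
  refine and_congr_right fun hvw => ⟨?_, ?_⟩
  · rintro ⟨e, -, hv, hw⟩
    exact ⟨e, ν.isFace_vertex.1 hv, ν.isFace_vertex.1 hw⟩
  · rintro ⟨σ, hv, hw⟩
    obtain ⟨e, -, he⟩ := ν.exists_face (S := {ν.vertexLabel v, ν.vertexLabel w})
      (Set.insert_nonempty _ _) (by rintro a (rfl | rfl) <;> assumption)
    refine ⟨e, ?_, ν.isFace_vertex.2 (he ▸ Or.inl rfl), ν.isFace_vertex.2 (he ▸ Or.inr rfl)⟩
    rw [← Set.ncard_pair fun h => hvw (ν.vertexLabel_injective h), ← he, ← Set.image_univ,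
      Set.ncard_image_of_injective _ (ν.injective e), Set.ncard_univ]

theorem isSimple (ν : L.Labelling N) : L.IsSimple := by
  refine ⟨fun v σ f g _ hf hg => funext fun x => ν.injective σ ?_, fun σ τ h => ν.unique ?_⟩
  · rw [ν.label_attach hf, ν.label_attach hg]
  · have key : ∀ {σ τ}, L.vertices σ = L.vertices τ →
        Set.range (ν.label σ) ⊆ Set.range (ν.label τ) := by
      intro σ τ h a ha
      obtain ⟨v, rfl⟩ := ν.exists_vertex ha
      have h1 : v.1 ∈ L.vertices σ := ⟨v.2, ν.isFace_vertex.2 ha⟩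
      exact ν.isFace_vertex.1 (h ▸ h1).2
    exact (key h).antisymm (key h.symm)

/-- A labelled complex is flag if pairwise joined labels occur in a common simplex. -/
theorem isFlag (h : ∀ S : Set N, S.Finite → S.Nonempty → (∀ a ∈ S, ∀ b ∈ S, ν.Joined a b) →
    ∃ σ, S ⊆ Set.range (ν.label σ)) : L.IsFlag := by
  refine ⟨ν.isSimple, fun S hS hc => ?_⟩
  obtain ⟨σ, hσ⟩ := h (ν.vertexLabel '' S) (S.finite_toSet.image _) (hS.to_set.image _) (by
    rintro _ ⟨v, hv, rfl⟩ _ ⟨w, hw, rfl⟩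
    by_cases hvw : v = w
    · subst hvw
      have : ν.vertexLabel v ∈ Set.range (ν.label v.1) := by rw [range_label]; rfl
      exact ⟨v.1, this, this⟩
    · exact (ν.adj_iff.1 (hc hv hw hvw)).2)
  obtain ⟨τ, -, hτ⟩ := ν.exists_face (hS.to_set.image _) hσ
  refine ⟨τ, Set.ext fun v => ⟨?_, ?_⟩⟩
  · rintro ⟨hv, hvτ⟩
    have h1 := ν.isFace_vertex (v := ⟨v, hv⟩).1 hvτ
    rw [hτ] at h1
    obtain ⟨w, hw, hwv⟩ := h1
    exact ⟨w, hw, congrArg Subtype.val (ν.vertexLabel_injective hwv)⟩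
  · rintro ⟨v, hv, rfl⟩
    exact ⟨v.2, ν.isFace_vertex.2 (hτ ▸ ⟨v, hv, rfl⟩)⟩

theorem joined_of_embedding {n : ℕ} {G : SimpleGraph (Fin n)} (φ : G ↪g L.graph) {i j : Fin n}
    (h : G.Adj i j) : ν.Joined (ν.vertexLabel (φ i)) (ν.vertexLabel (φ j)) :=
  (ν.adj_iff.1 (φ.map_adj_iff.2 h)).2

theorem not_joined_of_embedding {n : ℕ} {G : SimpleGraph (Fin n)} (φ : G ↪g L.graph) {i j : Fin n}
    (hij : i ≠ j) (h : ¬ G.Adj i j) : ¬ ν.Joined (ν.vertexLabel (φ i)) (ν.vertexLabel (φ j)) :=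
  fun hJ => h (φ.map_adj_iff.1 (ν.adj_iff.2 ⟨fun h => hij (φ.injective h), hJ⟩))

end Labelling

/-- A relation without induced cycles of length `4` and `5`. -/
def NoInducedCycle {N : Type u} (J : N → N → Prop) : Prop :=
  (∀ a b c d, J a b → J b c → J c d → J d a → ¬ J a c → ¬ J b d → False) ∧
  ∀ a b c d e, J a b → J b c → J c d → J d e → J e a →
    ¬ J a c → ¬ J b d → ¬ J c e → ¬ J d a → ¬ J e b → False

theorem Labelling.isEmpty_cycle {L : GenSimplicialComplex.{u}} {N : Type u} (ν : L.Labelling N)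
    (h : NoInducedCycle ν.Joined) : IsEmpty (SimpleGraph.cycleGraph 4 ↪g L.graph) ∧
      IsEmpty (SimpleGraph.cycleGraph 5 ↪g L.graph) := by
  refine ⟨⟨fun φ => ?_⟩, ⟨fun φ => ?_⟩⟩
  · have hJ : ∀ i j, (SimpleGraph.cycleGraph 4).Adj i j → _ := fun i j => ν.joined_of_embedding φ
    have hN : ∀ i j, i ≠ j → ¬ (SimpleGraph.cycleGraph 4).Adj i j → _ :=
      fun i j => ν.not_joined_of_embedding φ
    exact h.1 _ _ _ _ (hJ 0 1 (by decide)) (hJ 1 2 (by decide)) (hJ 2 3 (by decide))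
      (hJ 3 0 (by decide)) (hN 0 2 (by decide) (by decide)) (hN 1 3 (by decide) (by decide))
  · have hJ : ∀ i j, (SimpleGraph.cycleGraph 5).Adj i j → _ := fun i j => ν.joined_of_embedding φ
    have hN : ∀ i j, i ≠ j → ¬ (SimpleGraph.cycleGraph 5).Adj i j → _ :=
      fun i j => ν.not_joined_of_embedding φ
    exact h.2 _ _ _ _ _ (hJ 0 1 (by decide)) (hJ 1 2 (by decide)) (hJ 2 3 (by decide))
      (hJ 3 4 (by decide)) (hJ 4 0 (by decide)) (hN 0 2 (by decide) (by decide))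
      (hN 1 3 (by decide) (by decide)) (hN 2 4 (by decide) (by decide))
      (hN 3 0 (by decide) (by decide)) (hN 4 1 (by decide) (by decide))

/-- A labelling of the link of the vertex `v`, given by a label for each ordered pair of corners
`x`, `y` of a simplex such that `x` is glued to `v`. -/
structure StarLabelling (K : GenSimplicialComplex.{u}) (v : K.Simplex) (N : Type u) where
  label : ∀ τ, K.Corner τ → K.Corner τ → N
  label_attach : ∀ {τ σ} {g : K.Corner τ → K.Corner σ}, K.Attach τ σ g →
    ∀ {x y}, K.Attach v τ (fun _ => x) → y ≠ x → label σ (g x) (g y) = label τ x y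
  injOn : ∀ {τ x}, K.Attach v τ (fun _ => x) → Set.InjOn (label τ x) {x}ᶜ
  unique : ∀ {τ σ x y}, K.Attach v τ (fun _ => x) → K.Attach v σ (fun _ => y) →
    (label τ x '' {x}ᶜ).Nonempty → label τ x '' {x}ᶜ = label σ y '' {y}ᶜ →
    (⟨τ, x⟩ : (τ : K.Simplex) × K.Corner τ) = ⟨σ, y⟩

namespace StarLabelling

variable {K : GenSimplicialComplex.{u}} {v : K.Simplex} {N : Type u} (ν : K.StarLabelling v N)

/-- The set of labels of the face opposite to `x`. -/
def star (τ : K.Simplex) (x : K.Corner τ) : Set N := ν.label τ x '' {x}ᶜ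

/-- Two labels occur in a common simplex of the link. -/
def Joined (a b : N) : Prop :=
  ∃ τ x, K.Attach v τ (fun _ => x) ∧ a ∈ ν.star τ x ∧ b ∈ ν.star τ x

variable (hv : K.IsVertex v)
include hv

theorem attach_link (p : (K.link v).Simplex) (o : K.Corner v) :
    K.Attach v p.1.1 (fun _ => p.1.2 o) := by
  have := hv
  have h : (fun _ => p.1.2 o) = p.1.2 := funext fun o' => congrArg _ (hv.elim _ _)
  rw [h]
  exact p.2.1

theorem range_link (p : (K.link v).Simplex) (o : K.Corner v) :
    Set.range p.1.2 = {p.1.2 o} := by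
  ext y
  constructor
  · rintro ⟨o', rfl⟩
    exact congrArg _ (hv.elim _ _)
  · rintro rfl
    exact ⟨o, rfl⟩

/-- The labelling of the link. -/
noncomputable def toLabelling : (K.link v).Labelling N where
  label p y := ν.label p.1.1 (p.1.2 (Classical.arbitrary _)) y.1
  label_attach := by
    rintro p q f ⟨g, hg, hgp, hh⟩ y
    have h1 : y.1 ≠ p.1.2 (Classical.arbitrary _) := fun h => y.2 ⟨_, h.symm⟩
    have h2 := ν.label_attach hg (attach_link hv p (Classical.arbitrary _)) h1
    refine Eq.trans ?_ h2
    exact congrArg₂ (ν.label q.1.1) (congrFun hgp _).symm (hh y)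
  injective p y z h := by
    have := ν.injOn (attach_link hv p (Classical.arbitrary _))
    refine Subtype.ext (this (fun h => y.2 ⟨_, h.symm⟩) (fun h => z.2 ⟨_, h.symm⟩) h)
  unique {p q} h := by
    have hr : ∀ p : (K.link v).Simplex, (Set.range fun y : (K.link v).Corner p =>
        ν.label p.1.1 (p.1.2 (Classical.arbitrary _)) y.1) =
        ν.label p.1.1 (p.1.2 (Classical.arbitrary _)) '' {p.1.2 (Classical.arbitrary _)}ᶜ := by
      intro p
      rw [← range_link hv p, Set.image_eq_range]
      rfl
    rw [hr, hr] at h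
    have h1 := ν.unique (attach_link hv p (Classical.arbitrary _))
      (attach_link hv q (Classical.arbitrary _)) (by
        rw [← hr]; exact Set.range_nonempty _) h
    obtain ⟨⟨τ, φ⟩, hp⟩ := p
    obtain ⟨⟨σ, ψ⟩, hq⟩ := q
    obtain rfl : τ = σ := congrArg Sigma.fst h1
    have h2 : φ (Classical.arbitrary _) = ψ (Classical.arbitrary _) := eq_of_heq (Sigma.mk.inj h1).2
    obtain rfl : φ = ψ := funext fun o => by
      rw [hv.elim o (Classical.arbitrary _), h2]
    rfl

theorem range_toLabelling (p : (K.link v).Simplex) :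
    Set.range ((ν.toLabelling hv).label p) =
      ν.star p.1.1 (p.1.2 (Classical.arbitrary _)) := by
  rw [star, ← range_link hv p, Set.image_eq_range]
  rfl

theorem exists_range_eq {τ : K.Simplex} {x : K.Corner τ} (hx : K.Attach v τ (fun _ => x))
    (h : (ν.star τ x).Nonempty) :
    ∃ p, Set.range ((ν.toLabelling hv).label p) = ν.star τ x := by
  obtain ⟨_, y, hy, -⟩ := h
  refine ⟨⟨⟨τ, fun _ => x⟩, hx, fun hs => ?_⟩, ν.range_toLabelling hv _⟩
  obtain ⟨o, ho⟩ := hs y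
  exact hy ho.symm

theorem joined_toLabelling {a b : N} : (ν.toLabelling hv).Joined a b ↔ ν.Joined a b := by
  constructor
  · rintro ⟨p, ha, hb⟩
    rw [range_toLabelling] at ha hb
    exact ⟨_, _, attach_link hv p _, ha, hb⟩
  · rintro ⟨τ, x, hx, ha, hb⟩
    obtain ⟨p, hp⟩ := ν.exists_range_eq hv hx ⟨a, ha⟩
    exact ⟨p, hp ▸ ha, hp ▸ hb⟩

/-- The conditions on the link of a vertex in a locally 6-large complex, in terms of labels. -/
theorem link_isFlag (h : ∀ S : Set N, S.Finite → S.Nonempty → (∀ a ∈ S, ∀ b ∈ S, ν.Joined a b) →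
      ∃ τ x, K.Attach v τ (fun _ => x) ∧ S ⊆ ν.star τ x) (h' : NoInducedCycle ν.Joined) :
    (K.link v).IsFlag ∧ IsEmpty (SimpleGraph.cycleGraph 4 ↪g (K.link v).graph) ∧
      IsEmpty (SimpleGraph.cycleGraph 5 ↪g (K.link v).graph) := by
  have hJ : (ν.toLabelling hv).Joined = ν.Joined :=
    funext fun a => funext fun b => propext (ν.joined_toLabelling hv)
  refine ⟨(ν.toLabelling hv).isFlag fun S hS hne hc => ?_,
    (ν.toLabelling hv).isEmpty_cycle (hJ ▸ h')⟩
  rw [hJ] at hc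
  obtain ⟨τ, x, hx, hsub⟩ := h S hS hne hc
  obtain ⟨p, hp⟩ := ν.exists_range_eq hv hx (hne.mono hsub)
  exact ⟨p, hp ▸ hsub⟩

end StarLabelling

end GenSimplicialComplex

/-! ### The links of the simplexification -/

namespace SquareComplex.VHStructure

open GenSimplicialComplex

variable {X : SquareComplex.{u}} {W : X.VHStructure}

/-- Two labels may occur together in a block of the edge `e`. -/
def Compat (e : X.E) (a b : Label X) : Prop :=
  (∀ s i, a = .sq s i ∨ b = .sq s i → (X.bdry s i).1 = e) ∧ ∀ t, ¬ (a = .tip t ∧ b = .tip !t)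

theorem IsBlock.compat {e : X.E} {F : Set (Label X)} (hF : W.IsBlock e F) {a b : Label X}
    (ha : a ∈ F) (hb : b ∈ F) : Compat e a b := by
  refine ⟨?_, ?_⟩
  · rintro s i (rfl | rfl)
    · exact hF.adjacent s i ha
    · exact hF.adjacent s i hb
  · rintro (_ | _) ⟨rfl, rfl⟩
    · exact hF.one_tip ⟨ha, hb⟩
    · exact hF.one_tip ⟨hb, ha⟩

theorem isBlock_of_compat {e : X.E} {F : Set (Label X)} (he : W.vertical e) (hf : F.Finite)
    (h : ∀ a ∈ F, ∀ b ∈ F, Compat e a b) (hn : .mid ∈ F ∨ F.Nontrivial) : W.IsBlock e F :=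
  ⟨he, hf, fun s i hi => (h _ hi _ hi).1 s i (Or.inl rfl),
    fun ht => (h _ ht.1 _ ht.2).2 false ⟨rfl, rfl⟩, hn⟩

theorem compat_insert {e : X.E} {F : Set (Label X)} (h : ∀ a ∈ F, ∀ b ∈ F, Compat e a b)
    {x : Label X} (hx : ∀ a ∈ F, Compat e x a) (hxx : Compat e x x) :
    ∀ a ∈ insert x F, ∀ b ∈ insert x F, Compat e a b := by
  rintro a (rfl | ha) b (rfl | hb)
  · exact hxx
  · exact hx b hb
  · refine ⟨fun s i h' => (hx a ha).1 s i h'.symm, fun t ht => (hx a ha).2 (!t) ?_⟩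
    rw [Bool.not_not]
    exact ht.symm
  · exact h a ha b hb

theorem Compat.of_not_tip {e : X.E} {a b : Label X} (ha : ∀ s i, a = .sq s i → (X.bdry s i).1 = e)
    (hb : ∀ s i, b = .sq s i → (X.bdry s i).1 = e) (h : ∀ t, a ≠ .tip t) : Compat e a b :=
  ⟨fun s i h => h.elim (ha s i) (hb s i), fun t ht => h t ht.1⟩

/-! #### The link of the midpoint of a vertical edge -/

theorem eq_of_attach_mid {e : X.E} {he : W.IsBlock e {.mid}} : ∀ {τ : Cell W} {x : CellCorner W τ},
    CellAttach W (.block e {.mid} he) τ (fun _ => x) → ∃ F hF hm,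
      (⟨τ, x⟩ : (τ : Cell W) × CellCorner W τ) = ⟨.block e F hF, ⟨.mid, hm⟩⟩
  | .vtx _, _, h => h.elim
  | .ctr _, _, h => h.elim
  | .horiz _ _, _, h => h.elim
  | .tri s j _, _, ⟨c, _, h, _⟩ => by
    have h1 : (.mid : Label X) ∈ ({.mid} : Set (Label X)) := rfl
    rw [h] at h1
    simp at h1
  | .block _ F hF, ⟨x, hx⟩, ⟨rfl, h⟩ => by
    obtain rfl : x = .mid := h ⟨.mid, rfl⟩
    exact ⟨F, hF, hx, rfl⟩

/-- The label of a corner `y` as seen from the midpoint of a vertical edge. -/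
def midLabel (W : X.VHStructure) : (τ : Cell W) → CellCorner W τ → CellCorner W τ → Label X
  | .block _ _ _, _, y => y.1
  | _, _, _ => .mid

theorem midLabel_image {e : X.E} {F : Set (Label X)} (hF : W.IsBlock e F) (hm : .mid ∈ F) :
    midLabel W (.block e F hF) ⟨.mid, hm⟩ '' {⟨.mid, hm⟩}ᶜ = F \ {.mid} := by
  ext a
  constructor
  · rintro ⟨y, hy, rfl⟩
    exact ⟨y.2, fun h => hy (Subtype.ext h)⟩
  · rintro ⟨ha, hne⟩
    exact ⟨⟨a, ha⟩, fun h => hne (congrArg Subtype.val h), rfl⟩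

/-- The labelling of the link of the midpoint of a vertical edge. -/
def midStar {e : X.E} (he : W.IsBlock e {.mid}) :
    W.simplexification.StarLabelling (.block e {.mid} he) (Label X) where
  label := midLabel W
  label_attach {τ σ g} hg x y hx hy := by
    obtain ⟨F, hF, hm, h⟩ := eq_of_attach_mid hx
    cases h
    match σ, g, hg with
    | .tri _ _ _, _, ⟨c, _, h, _⟩ =>
      rw [h] at hm
      simp at hm
    | .block _ _ _, _, ⟨rfl, hg⟩ => exact hg y
  injOn {τ x} hx := by
    obtain ⟨F, hF, hm, h⟩ := eq_of_attach_mid hx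
    cases h
    exact fun y _ z _ h => Subtype.ext h
  unique {τ σ x y} hx hy _ h := by
    obtain ⟨F, hF, hm, h1⟩ := eq_of_attach_mid hx
    obtain ⟨F', hF', hm', h2⟩ := eq_of_attach_mid hy
    cases h1
    cases h2
    have h3 : F \ {.mid} = F' \ {.mid} :=
      (midLabel_image hF hm).symm.trans (h.trans (midLabel_image hF' hm'))
    obtain rfl : F = F' := by
      rw [← Set.insert_eq_of_mem hm, ← Set.insert_sdiff_singleton, h3, Set.insert_sdiff_singleton,
        Set.insert_eq_of_mem hm']
    rfl

theorem midStar_star {e : X.E} (he : W.IsBlock e {.mid}) {F : Set (Label X)} (hF : W.IsBlock e F)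
    (hm : .mid ∈ F) : (midStar he).star (.block e F hF) ⟨.mid, hm⟩ = F \ {.mid} :=
  midLabel_image hF hm

theorem subset_midStar {e : X.E} (he : W.IsBlock e {.mid}) {S : Set (Label X)} (hS : S.Finite)
    (hm : .mid ∉ S) (h : ∀ a ∈ S, ∀ b ∈ S, Compat e a b) :
    ∃ τ x, W.simplexification.Attach (.block e {.mid} he) τ (fun _ => x) ∧
      S ⊆ (midStar he).star τ x := by
  have hF : W.IsBlock e (insert .mid S) := isBlock_of_compat he.vertical (hS.insert _)
    (compat_insert h (fun a ha => Compat.of_not_tip (by simp)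
      (fun s i hi => (h a ha a ha).1 s i (Or.inl hi)) (by simp))
      (Compat.of_not_tip (by simp) (by simp) (by simp))) (Or.inl (Set.mem_insert _ _))
  refine ⟨.block e _ hF, ⟨.mid, Set.mem_insert _ _⟩, ⟨rfl, fun y => y.2.symm⟩, ?_⟩
  rw [midStar_star]
  exact fun a ha => ⟨Or.inr ha, fun h => hm (h ▸ ha)⟩

theorem midStar_joined {e : X.E} (he : W.IsBlock e {.mid}) {a b : Label X} :
    (midStar he).Joined a b ↔ a ≠ .mid ∧ b ≠ .mid ∧ ∀ c ∈ ({a, b} : Set (Label X)),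
      ∀ d ∈ ({a, b} : Set (Label X)), Compat e c d := by
  constructor
  · rintro ⟨τ, x, hx, ha, hb⟩
    obtain ⟨F, hF, hm, h⟩ := eq_of_attach_mid hx
    cases h
    rw [midStar_star] at ha hb
    refine ⟨ha.2, hb.2, fun c hc d hd => hF.compat ?_ ?_⟩
    · rcases hc with rfl | rfl
      exacts [ha.1, hb.1]
    · rcases hd with rfl | rfl
      exacts [ha.1, hb.1]
  · rintro ⟨ha, hb, h⟩
    obtain ⟨τ, x, hx, hsub⟩ := subset_midStar he (Set.toFinite {a, b}) (by simp [ha.symm, hb.symm]) h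
    exact ⟨τ, x, hx, hsub (Or.inl rfl), hsub (Or.inr rfl)⟩

theorem compat_pair {e : X.E} {a b : Label X} (ha : ∀ s i, a = .sq s i → (X.bdry s i).1 = e)
    (hb : ∀ s i, b = .sq s i → (X.bdry s i).1 = e)
    (h : ∀ t, ¬ (a = .tip t ∧ b = .tip !t)) : ∀ c ∈ ({a, b} : Set (Label X)),
      ∀ d ∈ ({a, b} : Set (Label X)), Compat e c d := by
  have hs : ∀ c ∈ ({a, b} : Set (Label X)), ∀ s i, c = .sq s i → (X.bdry s i).1 = e := by
    rintro c (rfl | rfl)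
    exacts [ha, hb]
  refine fun c hc d hd => ⟨fun s i h' => h'.elim (hs c hc s i) (hs d hd s i), fun t ⟨h1, h2⟩ => ?_⟩
  subst h1 h2
  rcases hc with rfl | rfl <;> rcases hd with hd | hd
  · cases t <;> simp at hd
  · exact h t ⟨rfl, hd.symm⟩
  · exact h (!t) ⟨hd.symm, by simp⟩
  · cases t <;> simp at hd

/-- The only pairs of vertices that are not joined in the link of a midpoint are the two halves of
the edge, so there are no induced cycles. -/
theorem midStar_noInducedCycle {e : X.E} (he : W.IsBlock e {.mid}) :
    NoInducedCycle (midStar he).Joined := by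
  -- two vertices that are not joined are the ends of the edge
  have key : ∀ {a b x y}, (midStar he).Joined a x → (midStar he).Joined b y →
      ¬ (midStar he).Joined a b → ∃ t, a = .tip t ∧ b = .tip !t := by
    intro a b x y hax hby hab
    rw [midStar_joined] at hax hby hab
    by_contra hcon
    push Not at hcon
    exact hab ⟨hax.1, hby.1, compat_pair
      (fun s i h => (hax.2.2 a (Or.inl rfl) a (Or.inl rfl)).1 s i (Or.inl h))
      (fun s i h => (hby.2.2 b (Or.inl rfl) b (Or.inl rfl)).1 s i (Or.inl h))
      fun t ht => hcon t ht.1 ht.2⟩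
  have opp : ∀ {a b t}, (midStar he).Joined a b → a = .tip t → b ≠ .tip !t := by
    intro a b t h ha hb
    exact ((midStar_joined he).1 h).2.2 a (Or.inl rfl) b (Or.inr rfl) |>.2 t ⟨ha, hb⟩
  have main : ∀ {a b c d x y}, (midStar he).Joined a b → (midStar he).Joined b c →
      (midStar he).Joined c x → (midStar he).Joined d y →
      ¬ (midStar he).Joined a c → ¬ (midStar he).Joined b d → False := by
    intro a b c d x y hab hbc hcx hdy hac hbd
    obtain ⟨t, ha, hc⟩ := key hab hcx hac
    obtain ⟨r, hb, hd⟩ := key hbc hdy hbd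
    by_cases htr : t = r
    · subst htr
      exact opp hbc hb hc
    · refine opp hab ha (hb.trans ?_)
      cases t <;> cases r <;> simp_all
  exact ⟨fun a b c d hab hbc hcd hda hac hbd => main hab hbc hcd hda hac hbd,
    fun a b c d e hab hbc hcd hde _ hac hbd _ _ _ => main hab hbc hcd hde hac hbd⟩

theorem link_mid {e : X.E} (he : W.IsBlock e {.mid}) :
    (W.simplexification.link (.block e {.mid} he)).IsFlag ∧
      IsEmpty (SimpleGraph.cycleGraph 4 ↪g (W.simplexification.link (.block e {.mid} he)).graph) ∧
      IsEmpty (SimpleGraph.cycleGraph 5 ↪g (W.simplexification.link (.block e {.mid} he)).graph) := by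
  refine (midStar he).link_isFlag (inferInstanceAs (Subsingleton ({.mid} : Set (Label X))))
    (fun S hS _ hc => ?_) (midStar_noInducedCycle he)
  exact subset_midStar he hS (fun h => ((midStar_joined he).1 (hc _ h _ h)).1 rfl)
    fun a ha b hb => ((midStar_joined he).1 (hc a ha b hb)).2.2 a (Or.inl rfl) b (Or.inr rfl)

/-! #### The link of the centre of a square -/

theorem cellNode_eq_ctr {s : X.S} : ∀ {τ : Cell W} {x : CellCorner W τ},
    cellNode W τ x = .ctr s →
    ((⟨τ, x⟩ : (τ : Cell W) × CellCorner W τ) = ⟨.ctr s, ⟨⟩⟩) ∨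
    (∃ j hj, (⟨τ, x⟩ : (τ : Cell W) × CellCorner W τ) = ⟨.tri s j hj, none⟩) ∨
    ∃ i F hF hm, (⟨τ, x⟩ : (τ : Cell W) × CellCorner W τ) =
      ⟨.block (X.bdry s i).1 F hF, ⟨.sq s i, hm⟩⟩
  | .vtx _, _, h => by cases h
  | .ctr _, _, rfl => Or.inl rfl
  | .horiz _ _, _, h => by cases h
  | .tri _ j hj, none, rfl => Or.inr (Or.inl ⟨j, hj, rfl⟩)
  | .tri _ _ _, some _, h => by cases h
  | .block _ _ _, ⟨.mid, _⟩, h => by cases h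
  | .block _ _ _, ⟨.tip _, _⟩, h => by cases h
  | .block _ F hF, ⟨.sq _ i, hx⟩, rfl => by
    obtain rfl := hF.adjacent _ _ hx
    exact Or.inr (Or.inr ⟨i, F, hF, hx, rfl⟩)

/-- The side of a square at a label, with a junk value if the label is not a square. -/
def Label.side : Label X → Fin 4
  | .sq _ i => i
  | _ => 0

/-- The label of a corner `y` as seen from the centre of a square: the vertical side of the square
on whose block the edge from the centre to `y` lies, together with the label of `y` there. -/
def ctrLabel (W : X.VHStructure) :
    (τ : Cell W) → CellCorner W τ → CellCorner W τ → Fin 4 × Label X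
  | .block _ _ _, x, y => (x.1.side, y.1)
  | .tri s j _, _, some c => (sideAt j c.down, .tip (tipAt X s j c.down))
  | _, _, _ => (0, .mid)

theorem ctrLabel_block {s : X.S} {i : Fin 4} {F : Set (Label X)}
    (hF : W.IsBlock (X.bdry s i).1 F) (hm : .sq s i ∈ F) :
    ctrLabel W (.block (X.bdry s i).1 F hF) ⟨.sq s i, hm⟩ '' {⟨.sq s i, hm⟩}ᶜ =
      {p | p.1 = i ∧ p.2 ∈ F ∧ p.2 ≠ .sq s i} := by
  ext ⟨k, a⟩
  constructor
  · rintro ⟨y, hy, h⟩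
    cases h
    exact ⟨rfl, y.2, fun h => hy (Subtype.ext h)⟩
  · rintro ⟨rfl, ha, hne⟩
    exact ⟨⟨a, ha⟩, fun h => hne (congrArg Subtype.val h), rfl⟩

theorem ctrLabel_tri {s : X.S} {j : Fin 4} (hj : ¬ W.vertical (X.bdry s j).1) :
    ctrLabel W (.tri s j hj) none '' {none}ᶜ = {p | ∃ c, p = (sideAt j c, .tip (tipAt X s j c))} := by
  ext p
  constructor
  · rintro ⟨_ | ⟨⟨c⟩⟩, hy, rfl⟩
    · exact absurd rfl hy
    · exact ⟨c, rfl⟩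
  · rintro ⟨c, rfl⟩
    exact ⟨some ⟨c⟩, by simp, rfl⟩

theorem ctrLabel_ctr {s : X.S} :
    ctrLabel W (.ctr s) ⟨⟩ '' {⟨⟩}ᶜ = ∅ := by
  ext p
  simp

theorem sideAt_ne (j : Fin 4) : sideAt j true ≠ sideAt j false := by
  revert j; decide

theorem sideAt_injective (j : Fin 4) : Function.Injective (sideAt j) := by
  revert j; unfold Function.Injective; decide

theorem sideAt_tipAt_injective {s : X.S} {j j' : Fin 4} {c c' : Bool}
    (h : sideAt j c = sideAt j' c') (h' : tipAt X s j c = tipAt X s j' c') : j = j' ∧ c = c' := by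
  cases c <;> cases c' <;> simp only [sideAt, tipAt, Bool.false_eq_true, if_false, if_true] at h h'
  · exact ⟨sub_left_injective h, rfl⟩
  · rw [h] at h'
    simp at h'
  · rw [h] at h'
    simp at h'
  · exact ⟨add_left_injective 1 h, rfl⟩

theorem vertical_sideAt {s : X.S} {j : Fin 4} (hj : ¬ W.vertical (X.bdry s j).1) (c : Bool) :
    W.vertical (X.bdry s (sideAt j c)).1 := by
  cases c
  · by_contra h
    exact hj ((vertical_sub_one W s j).2 h)
  · exact (W.alternating s j).2 hj

theorem ctrLabel_attach {s : X.S} {τ σ : Cell W} {g : CellCorner W τ → CellCorner W σ}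
    (hg : CellAttach W τ σ g) {x y : CellCorner W τ} (hx : cellNode W τ x = .ctr s) (hy : y ≠ x) :
    ctrLabel W σ (g x) (g y) = ctrLabel W τ x y := by
  rcases cellNode_eq_ctr hx with h | ⟨j, hj, h⟩ | ⟨i, F, hF, hm, h⟩
  · cases h
    exact absurd rfl hy
  · cases h
    match σ, g, hg with
    | .tri _ _ _, _, ⟨rfl, rfl, hg⟩ =>
      rw [hg, hg]
  · cases h
    match σ, g, hg with
    | .block _ _ _, g, ⟨rfl, hg⟩ =>
      change ((g _).1.side, (g _).1) = _
      rw [hg, hg]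
      rfl
    | .tri s' j _, g, ⟨c, he, hF', hg⟩ =>
      have h1 : (Label.sq s i : Label X) = .sq s' (sideAt j c) := by
        have := hm
        rw [hF'] at this
        simpa using this
      cases h1
      have h2 : y.1 = .tip (tipAt X s j c) := by
        have h3 : y.1 ∈ ({.sq s (sideAt j c), .tip (tipAt X s j c)} : Set (Label X)) := hF' ▸ y.2
        exact h3.resolve_left fun h => hy (Subtype.ext h)
      rw [(hg ⟨_, hm⟩).1 rfl, (hg y).2 h2]
      exact Prod.ext rfl h2.symm

theorem ctrLabel_injOn {s : X.S} {τ : Cell W} {x : CellCorner W τ} (hx : cellNode W τ x = .ctr s) :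
    Set.InjOn (ctrLabel W τ x) {x}ᶜ := by
  rcases cellNode_eq_ctr hx with h | ⟨j, hj, h⟩ | ⟨i, F, hF, hm, h⟩
  · cases h
    exact fun y _ z _ _ => rfl
  · cases h
    rintro (_ | ⟨⟨c⟩⟩) hy (_ | ⟨⟨c'⟩⟩) hz h
    · rfl
    · exact absurd rfl hy
    · exact absurd rfl hz
    · obtain rfl : c = c' := sideAt_injective j (congrArg Prod.fst h)
      rfl
  · cases h
    exact fun y _ z _ h => Subtype.ext (congrArg Prod.snd h)

theorem ctrLabel_unique {s : X.S} {τ σ : Cell W} {x : CellCorner W τ} {y : CellCorner W σ}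
    (hx : cellNode W τ x = .ctr s) (hy : cellNode W σ y = .ctr s)
    (hne : (ctrLabel W τ x '' {x}ᶜ).Nonempty)
    (h : ctrLabel W τ x '' {x}ᶜ = ctrLabel W σ y '' {y}ᶜ) :
    (⟨τ, x⟩ : (τ : Cell W) × CellCorner W τ) = ⟨σ, y⟩ := by
  -- a block and a triangle have different sets of sides
  have hbt : ∀ {i : Fin 4} {F : Set (Label X)} (hF : W.IsBlock (X.bdry s i).1 F)
      (hm : .sq s i ∈ F) {j : Fin 4} (hj : ¬ W.vertical (X.bdry s j).1),
      ctrLabel W (.block (X.bdry s i).1 F hF) ⟨.sq s i, hm⟩ '' {⟨.sq s i, hm⟩}ᶜ ≠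
        ctrLabel W (.tri s j hj) none '' {none}ᶜ := by
    intro i F hF hm j hj h
    rw [ctrLabel_block, ctrLabel_tri] at h
    have h1 : ∀ c, sideAt j c = i := fun c => by
      have : (sideAt j c, Label.tip (tipAt X s j c)) ∈
          {p : Fin 4 × Label X | ∃ c, p = (sideAt j c, .tip (tipAt X s j c))} := ⟨c, rfl⟩
      rw [← h] at this
      exact this.1
    exact sideAt_ne j ((h1 _).trans (h1 _).symm)
  rcases cellNode_eq_ctr hx with h1 | ⟨j, hj, h1⟩ | ⟨i, F, hF, hm, h1⟩ <;>
    rcases cellNode_eq_ctr hy with h2 | ⟨j', hj', h2⟩ | ⟨i', F', hF', hm', h2⟩ <;>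
    cases h1 <;> cases h2
  · rfl
  · exact absurd ctrLabel_ctr hne.ne_empty
  · exact absurd ctrLabel_ctr hne.ne_empty
  · exact absurd (h.trans ctrLabel_ctr) hne.ne_empty
  · have h3 := (ctrLabel_tri hj).symm.trans (h.trans (ctrLabel_tri hj'))
    have h4 : (sideAt j true, Label.tip (tipAt X s j true)) ∈
        {p : Fin 4 × Label X | ∃ c, p = (sideAt j c, .tip (tipAt X s j c))} := ⟨true, rfl⟩
    rw [h3] at h4
    obtain ⟨c, hc⟩ := h4
    have h5 := sideAt_tipAt_injective (congrArg Prod.fst hc)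
      (Label.tip.inj (congrArg Prod.snd hc))
    obtain rfl := h5.1
    rfl
  · exact absurd h.symm (hbt hF' hm' hj)
  · exact absurd (h.trans ctrLabel_ctr) hne.ne_empty
  · exact absurd h (hbt hF hm hj')
  · have h3 := (ctrLabel_block hF hm).symm.trans (h.trans (ctrLabel_block hF' hm'))
    rw [ctrLabel_block hF hm] at hne
    obtain ⟨p, hp⟩ := hne
    have hp' := hp
    rw [h3] at hp'
    obtain rfl : i = i' := hp.1.symm.trans hp'.1
    obtain rfl : F = F' := by
      ext a
      by_cases ha : a = .sq s i
      · subst ha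
        exact ⟨fun _ => hm', fun _ => hm⟩
      · have h4 := Set.ext_iff.1 h3 (i, a)
        exact ⟨fun h => (h4.1 ⟨rfl, h, ha⟩).2.1, fun h => (h4.2 ⟨rfl, h, ha⟩).2.1⟩
    rfl

/-- The labelling of the link of the centre of a square. -/
def ctrStar (W : X.VHStructure) (s : X.S) :
    W.simplexification.StarLabelling (.ctr s) (Fin 4 × Label X) where
  label := ctrLabel W
  label_attach hg _ _ hx hy := ctrLabel_attach hg hx hy
  injOn hx := ctrLabel_injOn hx
  unique hx hy hne h := ctrLabel_unique hx hy hne h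

theorem ctrStar_block {s : X.S} {i : Fin 4} {F : Set (Label X)}
    (hF : W.IsBlock (X.bdry s i).1 F) (hm : .sq s i ∈ F) :
    (ctrStar W s).star (.block (X.bdry s i).1 F hF) ⟨.sq s i, hm⟩ =
      {p | p.1 = i ∧ p.2 ∈ F ∧ p.2 ≠ .sq s i} := ctrLabel_block hF hm

theorem ctrStar_tri {s : X.S} {j : Fin 4} (hj : ¬ W.vertical (X.bdry s j).1) :
    (ctrStar W s).star (.tri s j hj) none =
      {p | ∃ c, p = (sideAt j c, .tip (tipAt X s j c))} := ctrLabel_tri hj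

theorem ctrStar_ctr {s : X.S} : (ctrStar W s).star (.ctr s) ⟨⟩ = ∅ :=
  ctrLabel_ctr (W := W) (s := s)

/-- Compatible labels along a vertical side of `s` occur in a common block. -/
theorem subset_ctrStar {s : X.S} {i : Fin 4} (hi : W.vertical (X.bdry s i).1)
    {S : Set (Fin 4 × Label X)} (hS : S.Finite) (hne : S.Nonempty) (h : ∀ p ∈ S, p.1 = i)
    (hm : ∀ p ∈ S, p.2 ≠ .sq s i) (hc : ∀ p ∈ S, ∀ q ∈ S, Compat (X.bdry s i).1 p.2 q.2) :
    ∃ τ x, W.simplexification.Attach (.ctr s) τ (fun _ => x) ∧ S ⊆ (ctrStar W s).star τ x := by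
  have hsq : ∀ s' i', (.sq s i : Label X) = .sq s' i' → (X.bdry s' i').1 = (X.bdry s i).1 := by
    rintro s' i' h
    cases h
    rfl
  have hF : W.IsBlock (X.bdry s i).1 (insert (.sq s i) (Prod.snd '' S)) := by
    refine isBlock_of_compat hi ((hS.image _).insert _) (compat_insert ?_ ?_ ?_) (Or.inr ?_)
    · rintro _ ⟨p, hp, rfl⟩ _ ⟨q, hq, rfl⟩
      exact hc p hp q hq
    · rintro _ ⟨p, hp, rfl⟩
      exact Compat.of_not_tip hsq (fun s' i' h' => (hc p hp p hp).1 s' i' (Or.inl h')) (by simp)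
    · exact Compat.of_not_tip hsq hsq (by simp)
    · obtain ⟨p, hp⟩ := hne
      exact ⟨_, Or.inl rfl, _, Or.inr ⟨p, hp, rfl⟩, (hm p hp).symm⟩
  refine ⟨.block _ _ hF, ⟨.sq s i, Set.mem_insert _ _⟩, rfl, fun p hp => ?_⟩
  rw [ctrStar_block]
  exact ⟨h p hp, Or.inr ⟨p, hp, rfl⟩, hm p hp⟩

/-- Two labels at the centre of `s` are joined if they occur together in a block of a vertical side
of `s`, or if they are the two ends of a horizontal side. -/
theorem ctrStar_joined {s : X.S} {p q : Fin 4 × Label X} : (ctrStar W s).Joined p q ↔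
    (p.1 = q.1 ∧ W.vertical (X.bdry s p.1).1 ∧ p.2 ≠ .sq s p.1 ∧ q.2 ≠ .sq s p.1 ∧
      ∀ c ∈ ({p.2, q.2} : Set (Label X)), ∀ d ∈ ({p.2, q.2} : Set (Label X)),
        Compat (X.bdry s p.1).1 c d) ∨
    ∃ j c, ¬ W.vertical (X.bdry s j).1 ∧ p = (sideAt j c, .tip (tipAt X s j c)) ∧
      q = (sideAt j !c, .tip (tipAt X s j !c)) := by
  constructor
  · rintro ⟨τ, x, hx, hp, hq⟩
    rcases cellNode_eq_ctr hx with h | ⟨j, hj, h⟩ | ⟨i, F, hF, hm, h⟩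
    · cases h
      exact ((Set.ext_iff.1 ctrStar_ctr p).1 hp).elim
    · cases h
      rw [ctrStar_tri] at hp hq
      obtain ⟨c, rfl⟩ := hp
      obtain ⟨c', rfl⟩ := hq
      by_cases hcc : c = c'
      · subst hcc
        exact Or.inl ⟨rfl, vertical_sideAt hj c, by simp, by simp,
          compat_pair (by simp) (by simp) (by simp)⟩
      · obtain rfl : c' = !c := by cases c <;> cases c' <;> simp_all
        exact Or.inr ⟨j, c, hj, rfl, rfl⟩
    · cases h
      rw [ctrStar_block] at hp hq
      obtain ⟨rfl, hp, hp'⟩ := hp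
      obtain ⟨h1, hq, hq'⟩ := hq
      refine Or.inl ⟨h1.symm, hF.vertical, hp', hq', fun c hc d hd => hF.compat ?_ ?_⟩
      · rcases hc with rfl | rfl <;> assumption
      · rcases hd with rfl | rfl <;> assumption
  · rintro (⟨h1, h2, h3, h4, h5⟩ | ⟨j, c, hj, rfl, rfl⟩)
    · obtain ⟨τ, x, hx, hsub⟩ := subset_ctrStar h2 (Set.toFinite {p, q}) (Set.insert_nonempty _ _)
        (by rintro r (rfl | rfl) <;> simp_all) (by rintro r (rfl | rfl) <;> assumption)
        (by
          rintro r hr r' hr'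
          refine h5 _ ?_ _ ?_
          · rcases hr with rfl | rfl <;> simp
          · rcases hr' with rfl | rfl <;> simp)
      exact ⟨τ, x, hx, hsub (Or.inl rfl), hsub (Or.inr rfl)⟩
    · refine ⟨.tri s j hj, none, rfl, ?_, ?_⟩ <;> rw [ctrStar_tri]
      exacts [⟨_, rfl⟩, ⟨_, rfl⟩]

theorem ctrStar_side {s : X.S} {p q : Fin 4 × Label X} (h : (ctrStar W s).Joined p q) :
    W.vertical (X.bdry s p.1).1 ∧ p.2 ≠ .sq s p.1 ∧
      ∀ s' i, p.2 = .sq s' i → (X.bdry s' i).1 = (X.bdry s p.1).1 := by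
  rcases ctrStar_joined.1 h with ⟨-, h2, h3, -, h5⟩ | ⟨j, c, hj, rfl, -⟩
  · exact ⟨h2, h3, fun s' i hi => (h5 _ (Or.inl rfl) _ (Or.inl rfl)).1 s' i (Or.inl hi)⟩
  · exact ⟨vertical_sideAt hj c, by simp, by simp⟩

theorem ctrStar_cross {s : X.S} {p q : Fin 4 × Label X} (h : (ctrStar W s).Joined p q)
    (hpq : p.1 ≠ q.1) : ∃ j c, ¬ W.vertical (X.bdry s j).1 ∧
      p = (sideAt j c, .tip (tipAt X s j c)) ∧ q = (sideAt j !c, .tip (tipAt X s j !c)) :=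
  (ctrStar_joined.1 h).resolve_left fun h => hpq h.1

/-- A vertex of the link of `s` is joined to at most one vertex on another side of `s`. -/
theorem ctrStar_cross_unique {s : X.S} {p q q' : Fin 4 × Label X} (h : (ctrStar W s).Joined p q)
    (hpq : p.1 ≠ q.1) (h' : (ctrStar W s).Joined p q') (hpq' : p.1 ≠ q'.1) : q = q' := by
  obtain ⟨j, c, -, rfl, rfl⟩ := ctrStar_cross h hpq
  obtain ⟨j', c', -, h1, rfl⟩ := ctrStar_cross h' hpq'
  obtain ⟨rfl, rfl⟩ := sideAt_tipAt_injective (congrArg Prod.fst h1)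
    (Label.tip.inj (congrArg Prod.snd h1))
  rfl

theorem ctrStar_opp {s : X.S} {p q : Fin 4 × Label X} (h : (ctrStar W s).Joined p q)
    (hpq : p.1 = q.1) {t : Bool} (hp : p.2 = .tip t) : q.2 ≠ .tip !t := by
  rcases ctrStar_joined.1 h with ⟨-, -, -, -, h5⟩ | ⟨j, c, -, rfl, rfl⟩
  · exact fun hq => (h5 _ (Or.inl rfl) _ (Or.inr rfl)).2 t ⟨hp, hq⟩
  · exact absurd (sideAt_injective j hpq) (by simp)

/-- Two vertices on the same side of `s` that are not joined are the ends of this side. -/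
theorem ctrStar_not_joined {s : X.S} {p q x y : Fin 4 × Label X} (hp : (ctrStar W s).Joined p x)
    (hq : (ctrStar W s).Joined q y) (hpq : p.1 = q.1) (h : ¬ (ctrStar W s).Joined p q) :
    ∃ t, p.2 = .tip t ∧ q.2 = .tip !t := by
  by_contra hcon
  push Not at hcon
  obtain ⟨h1, h2, h3⟩ := ctrStar_side hp
  obtain ⟨-, h5, h6⟩ := ctrStar_side hq
  rw [← hpq] at h5 h6
  exact h (ctrStar_joined.2 (Or.inl ⟨hpq, h1, h2, h5,
    compat_pair h3 h6 fun t ht => hcon t ht.1 ht.2⟩))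

theorem ctrStar_same_side {s : X.S} {a b c d x y : Fin 4 × Label X}
    (hab : (ctrStar W s).Joined a b) (hbc : (ctrStar W s).Joined b c)
    (hcx : (ctrStar W s).Joined c x) (hdy : (ctrStar W s).Joined d y) (h1 : a.1 = b.1)
    (h2 : b.1 = c.1) (h3 : c.1 = d.1) (hac : ¬ (ctrStar W s).Joined a c)
    (hbd : ¬ (ctrStar W s).Joined b d) : False := by
  obtain ⟨t, ha, hc⟩ := ctrStar_not_joined hab hcx (h1.trans h2) hac
  obtain ⟨r, hb, -⟩ := ctrStar_not_joined hbc hdy (h2.trans h3) hbd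
  by_cases htr : t = r
  · subst htr
    exact ctrStar_opp hbc h2 hb hc
  · refine ctrStar_opp hab h1 ha (hb.trans ?_)
    cases t <;> cases r <;> simp_all

/-- If `a`, `b` is a step to another side of `s` along a cycle without diagonals, then the next
vertex is not the end of a side. -/
theorem ctrStar_after_cross {s : X.S} {a b c : Fin 4 × Label X} (hab : (ctrStar W s).Joined a b)
    (hbc : (ctrStar W s).Joined b c) (hac : ¬ (ctrStar W s).Joined a c) (h : a.1 ≠ b.1) :
    b.1 = c.1 ∧ ∀ t, c.2 ≠ .tip t := by
  obtain ⟨τ, x, hx, ha, hb⟩ := id hab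
  have h1 : b.1 = c.1 := by
    by_contra h1
    have hba : (ctrStar W s).Joined b a := ⟨τ, x, hx, hb, ha⟩
    obtain rfl := ctrStar_cross_unique hba (Ne.symm h) hbc h1
    exact hac ⟨τ, x, hx, ha, ha⟩
  refine ⟨h1, fun t ht => ?_⟩
  obtain ⟨j, k, -, -, rfl⟩ := ctrStar_cross hab h
  by_cases hk : tipAt X s j (!k) = t
  · obtain rfl : c = _ := Prod.ext h1.symm (ht.trans (congrArg _ hk.symm))
    exact hac hab
  · refine ctrStar_opp hbc h1 rfl (ht.trans (congrArg _ ?_))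
    generalize tipAt X s j (!k) = r at hk
    cases t <;> cases r <;> simp_all

theorem ctrStar_noInducedCycle {s : X.S} : NoInducedCycle (ctrStar W s).Joined := by
  have symm : ∀ {a b}, (ctrStar W s).Joined a b → (ctrStar W s).Joined b a :=
    fun ⟨τ, x, hx, ha, hb⟩ => ⟨τ, x, hx, hb, ha⟩
  have stay : ∀ {a b}, (ctrStar W s).Joined a b → (∀ t, a.2 ≠ .tip t) → a.1 = b.1 := by
    intro a b hab ha
    by_contra h
    obtain ⟨j, c, -, rfl, -⟩ := ctrStar_cross hab h
    exact ha _ rfl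
  have four : ∀ {a b c d}, (ctrStar W s).Joined a b → (ctrStar W s).Joined b c →
      (ctrStar W s).Joined c d → (ctrStar W s).Joined d a → ¬ (ctrStar W s).Joined a c →
      ¬ (ctrStar W s).Joined b d → a.1 = b.1 := by
    intro a b c d hab hbc hcd hda hac hbd
    by_contra h
    obtain ⟨h1, h2⟩ := ctrStar_after_cross hab hbc hac h
    obtain ⟨h3, -⟩ := ctrStar_after_cross (symm hab) (symm hda) hbd (Ne.symm h)
    exact h (h3.trans ((stay hcd h2).symm.trans h1.symm))
  have five : ∀ {a b c d e}, (ctrStar W s).Joined a b → (ctrStar W s).Joined b c →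
      (ctrStar W s).Joined c d → (ctrStar W s).Joined d e → (ctrStar W s).Joined e a →
      ¬ (ctrStar W s).Joined a c → ¬ (ctrStar W s).Joined e b → a.1 = b.1 := by
    intro a b c d e hab hbc hcd hde hea hac heb
    by_contra h
    obtain ⟨h1, h2⟩ := ctrStar_after_cross hab hbc hac h
    obtain ⟨h3, h4⟩ := ctrStar_after_cross (symm hab) (symm hea) (fun h => heb (symm h)) (Ne.symm h)
    exact h (h3.trans ((stay (symm hde) h4).trans ((stay hcd h2).symm.trans h1.symm)))
  refine ⟨fun a b c d hab hbc hcd hda hac hbd => ?_,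
    fun a b c d e hab hbc hcd hde hea hac hbd hce hda heb => ?_⟩
  · exact ctrStar_same_side hab hbc hcd hda (four hab hbc hcd hda hac hbd)
      (four hbc hcd hda hab hbd fun h => hac (symm h))
      (four hcd hda hab hbc (fun h => hac (symm h)) fun h => hbd (symm h)) hac hbd
  · exact ctrStar_same_side hab hbc hcd hde (five hab hbc hcd hde hea hac heb)
      (five hbc hcd hde hea hab hbd hac) (five hcd hde hea hab hbc hce hbd) hac hbd

theorem link_ctr (W : X.VHStructure) (s : X.S) :
    (W.simplexification.link (.ctr s)).IsFlag ∧
      IsEmpty (SimpleGraph.cycleGraph 4 ↪g (W.simplexification.link (.ctr s)).graph) ∧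
      IsEmpty (SimpleGraph.cycleGraph 5 ↪g (W.simplexification.link (.ctr s)).graph) := by
  refine (ctrStar W s).link_isFlag (inferInstanceAs (Subsingleton PUnit))
    (fun S hS hne hc => ?_) ctrStar_noInducedCycle
  obtain ⟨a, ha⟩ := hne
  by_cases hside : ∀ p ∈ S, p.1 = a.1
  · refine subset_ctrStar (ctrStar_side (hc a ha a ha)).1 hS ⟨a, ha⟩ hside
      (fun p hp => hside p hp ▸ (ctrStar_side (hc p hp p hp)).2.1) fun p hp q hq => ⟨?_, ?_⟩
    · rintro s' i (h | h)
      · exact hside p hp ▸ (ctrStar_side (hc p hp p hp)).2.2 s' i h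
      · exact hside q hq ▸ (ctrStar_side (hc q hq q hq)).2.2 s' i h
    · exact fun t ht => ctrStar_opp (hc p hp q hq) ((hside p hp).trans (hside q hq).symm) ht.1 ht.2
  · push Not at hside
    obtain ⟨b, hb, hba⟩ := hside
    obtain ⟨j, c, hj, h1, h2⟩ := ctrStar_cross (hc a ha b hb) (Ne.symm hba)
    refine ⟨.tri s j hj, none, rfl, fun p hp => ?_⟩
    rw [ctrStar_tri]
    by_cases hpa : p.1 = a.1
    · rw [ctrStar_cross_unique (hc b hb p hp) (fun h => hba (h.trans hpa)) (hc b hb a ha) hba]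
      exact ⟨c, h1⟩
    · rw [ctrStar_cross_unique (hc a ha p hp) (Ne.symm hpa) (hc a ha b hb) (Ne.symm hba)]
      exact ⟨!c, h2⟩

end SquareComplex.VHStructure

/-! #### The link of a vertex of the square complex -/

namespace SquareComplex

/-- No two corners of squares join the same pair of vertices of a link. -/
def NoBigons (X : SquareComplex.{u}) : Prop :=
  ∀ c c' d d', X.LinkJoins c d d' → X.LinkJoins c' d d' → c = c'

namespace VHStructure

open GenSimplicialComplex

variable {X : SquareComplex.{u}} {W : X.VHStructure}

/-- The vertices of the link of a vertex `v` in the simplexification: a directed edge starting at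
`v` stands for its midpoint if it is vertical, and for its other end if it is horizontal, and
`corner s i b` stands for the centre of the square `s`, seen from the end `b` of its vertical
side `i`. The label `other` does not occur at a vertex of the link; it is a value for pairs of
corners that are of no interest. -/
inductive LinkLabel (X : SquareComplex.{u}) : Type u
  | dart (d : X.E × Bool) : LinkLabel X
  | corner (s : X.S) (i : Fin 4) (b : Bool) : LinkLabel X
  | other : LinkLabel X

/-- The end of the edge at a label, if the label is a tip, with a junk value otherwise. -/
def Label.end : Label X → Bool
  | .tip b => b
  | _ => false

/-- A label of the block of the edge of `d`, seen from the start of the directed edge `d`. -/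
def Label.far (d : X.E × Bool) : Label X → LinkLabel X
  | .mid => .dart d
  | .tip _ => .other
  | .sq s i => .corner s i d.2

/-- The label of a block that a vertex of the link comes from. -/
def LinkLabel.near : LinkLabel X → Label X
  | .corner s i _ => .sq s i
  | _ => .mid

/-- The label of a corner `y` as seen from a corner `x` at a vertex of the square complex. -/
def vtxLabel (W : X.VHStructure) : (τ : Cell W) → CellCorner W τ → CellCorner W τ → LinkLabel X
  | .horiz h _, x, _ => .dart (h, x.down)
  | .tri s j _, some c, none => .corner s (sideAt j c.down) (tipAt X s j c.down)
  | .tri s j _, some c, some _ => .dart ((X.bdry s j).1, xor c.down (X.bdry s j).2)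
  | .block e _ _, x, y => y.1.far (e, x.1.end)
  | _, _, _ => .other

theorem cellNode_eq_vtx {v : X.V} : ∀ {τ : Cell W} {x : CellCorner W τ},
    cellNode W τ x = .vtx v →
    ((⟨τ, x⟩ : (τ : Cell W) × CellCorner W τ) = ⟨.vtx v, ⟨⟩⟩) ∨
    (∃ h hh b, X.endpt h b = v ∧ (⟨τ, x⟩ : (τ : Cell W) × CellCorner W τ) = ⟨.horiz h hh, ⟨b⟩⟩) ∨
    (∃ s j hj c, X.corner s (if c then j + 1 else j) = v ∧
      (⟨τ, x⟩ : (τ : Cell W) × CellCorner W τ) = ⟨.tri s j hj, some ⟨c⟩⟩) ∨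
    ∃ e b F hF hm, X.endpt e b = v ∧
      (⟨τ, x⟩ : (τ : Cell W) × CellCorner W τ) = ⟨.block e F hF, ⟨.tip b, hm⟩⟩
  | .vtx _, _, rfl => Or.inl rfl
  | .ctr _, _, h => by cases h
  | .horiz h hh, ⟨b⟩, rfl => Or.inr (Or.inl ⟨h, hh, b, rfl, rfl⟩)
  | .tri _ _ _, none, h => by cases h
  | .tri s j hj, some ⟨c⟩, rfl => Or.inr (Or.inr (Or.inl ⟨s, j, hj, c, rfl, rfl⟩))
  | .block _ _ _, ⟨.mid, _⟩, h => by cases h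
  | .block e F hF, ⟨.tip b, hm⟩, rfl => Or.inr (Or.inr (Or.inr ⟨e, b, F, hF, hm, rfl, rfl⟩))
  | .block _ _ _, ⟨.sq _ _, _⟩, h => by cases h

theorem vtxLabel_vtx {v : X.V} (a : LinkLabel X) : a ∉ vtxLabel W (.vtx v) ⟨⟩ '' {⟨⟩}ᶜ := by
  simp

theorem vtxLabel_horiz {h : X.E} (hh : ¬ W.vertical h) {b : Bool} {a : LinkLabel X} :
    a ∈ vtxLabel W (.horiz h hh) ⟨b⟩ '' {⟨b⟩}ᶜ ↔ a = .dart (h, b) := by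
  constructor
  · rintro ⟨y, -, rfl⟩
    rfl
  · rintro rfl
    refine ⟨⟨!b⟩, fun h => ?_, rfl⟩
    have := congrArg ULift.down h
    simp at this

theorem vtxLabel_tri {s : X.S} {j : Fin 4} (hj : ¬ W.vertical (X.bdry s j).1) {c : Bool}
    {a : LinkLabel X} : a ∈ vtxLabel W (.tri s j hj) (some ⟨c⟩) '' {some ⟨c⟩}ᶜ ↔
      a = .corner s (sideAt j c) (tipAt X s j c) ∨
      a = .dart ((X.bdry s j).1, xor c (X.bdry s j).2) := by
  constructor
  · rintro ⟨_ | ⟨⟨c'⟩⟩, -, rfl⟩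
    · exact Or.inl rfl
    · exact Or.inr rfl
  · rintro (rfl | rfl)
    · exact ⟨none, by simp, rfl⟩
    · refine ⟨some ⟨!c⟩, fun h => ?_, rfl⟩
      have := congrArg ULift.down (Option.some.inj h)
      simp at this

theorem IsBlock.eq_of_tip {e : X.E} {F : Set (Label X)} (hF : W.IsBlock e F) {b b' : Bool}
    (h : .tip b ∈ F) (h' : .tip b' ∈ F) : b' = b := by
  have := (hF.compat h h').2 b
  cases b <;> cases b' <;> simp_all

theorem vtxLabel_block {e : X.E} {F : Set (Label X)} (hF : W.IsBlock e F) {b : Bool}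
    (hm : .tip b ∈ F) {a : LinkLabel X} :
    a ∈ vtxLabel W (.block e F hF) ⟨.tip b, hm⟩ '' {⟨.tip b, hm⟩}ᶜ ↔
      (a = .dart (e, b) ∧ .mid ∈ F) ∨ ∃ s i, a = .corner s i b ∧ .sq s i ∈ F := by
  constructor
  · rintro ⟨⟨_ | b' | ⟨s, i⟩, hy⟩, hne, rfl⟩
    · exact Or.inl ⟨rfl, hy⟩
    · obtain rfl := hF.eq_of_tip hm hy
      exact absurd rfl hne
    · exact Or.inr ⟨s, i, rfl, hy⟩
  · rintro (⟨rfl, h⟩ | ⟨s, i, rfl, h⟩)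
    · exact ⟨⟨.mid, h⟩, by simp, rfl⟩
    · exact ⟨⟨.sq s i, h⟩, by simp, rfl⟩

theorem vtxLabel_attach {v : X.V} {τ σ : Cell W} {g : CellCorner W τ → CellCorner W σ}
    (hg : CellAttach W τ σ g) {x y : CellCorner W τ} (hx : cellNode W τ x = .vtx v) (hy : y ≠ x) :
    vtxLabel W σ (g x) (g y) = vtxLabel W τ x y := by
  rcases cellNode_eq_vtx hx with h | ⟨h, hh, b, -, h⟩ | ⟨s, j, hj, c, -, h⟩ |
    ⟨e, b, F, hF, hm, -, h⟩ <;> cases h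
  · exact absurd rfl hy
  · match σ, g, hg with
    | .horiz _ _, _, ⟨rfl, hg⟩ => rw [hg, hg]
    | .tri s j _, _, ⟨he, hg⟩ =>
      subst he
      obtain ⟨b'⟩ := y
      rw [hg, hg]
      simp [vtxLabel]
  · match σ, g, hg with
    | .tri _ _ _, _, ⟨rfl, rfl, hg⟩ => rw [hg, hg]
  · match σ, g, hg with
    | .block _ _ _, g, ⟨rfl, hg⟩ =>
      change (g _).1.far (e, (g _).1.end) = _
      rw [hg, hg]
      rfl
    | .tri s j _, g, ⟨c, he, hF', hg⟩ =>
      have h1 : b = tipAt X s j c := by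
        have := hm
        rw [hF'] at this
        simpa using this
      have h2 : y.1 = .sq s (sideAt j c) := by
        have h3 : y.1 ∈ ({.sq s (sideAt j c), .tip (tipAt X s j c)} : Set (Label X)) := hF' ▸ y.2
        exact h3.resolve_right fun h => hy (Subtype.ext (h.trans (congrArg _ h1.symm)))
      rw [(hg ⟨_, hm⟩).2 (congrArg _ h1), (hg y).1 h2]
      change _ = y.1.far (e, b)
      rw [h2, h1]
      rfl

theorem vtxLabel_injOn {v : X.V} {τ : Cell W} {x : CellCorner W τ}
    (hx : cellNode W τ x = .vtx v) : Set.InjOn (vtxLabel W τ x) {x}ᶜ := by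
  rcases cellNode_eq_vtx hx with h | ⟨h, hh, b, -, h⟩ | ⟨s, j, hj, c, -, h⟩ |
    ⟨e, b, F, hF, hm, -, h⟩ <;> cases h
  · exact fun y _ z _ _ => rfl
  · rintro ⟨y⟩ hy ⟨z⟩ hz -
    have hy' : y ≠ b := fun h => hy (congrArg _ h)
    have hz' : z ≠ b := fun h => hz (congrArg _ h)
    cases b <;> cases y <;> cases z <;> simp_all
  · rintro (_ | ⟨⟨y⟩⟩) hy (_ | ⟨⟨z⟩⟩) hz h
    · rfl
    · cases h
    · cases h
    · have hy' : y ≠ c := fun h => hy (congrArg (fun c => (some ⟨c⟩ : Option (ULift.{u} Bool))) h)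
      have hz' : z ≠ c := fun h => hz (congrArg (fun c => (some ⟨c⟩ : Option (ULift.{u} Bool))) h)
      cases c <;> cases y <;> cases z <;> simp_all
  · rintro ⟨_ | y | ⟨s, i⟩, hy⟩ hy' ⟨_ | z | ⟨s', i'⟩, hz⟩ hz' h
    · rfl
    · cases h
    · cases h
    · cases h
    · obtain rfl := hF.eq_of_tip hm hy
      exact absurd rfl hy'
    · cases h
    · cases h
    · cases h
    · cases h
      rfl

theorem vtxLabel_unique {v : X.V} {τ σ : Cell W} {x : CellCorner W τ} {y : CellCorner W σ}
    (hx : cellNode W τ x = .vtx v) (hy : cellNode W σ y = .vtx v)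
    (hne : (vtxLabel W τ x '' {x}ᶜ).Nonempty)
    (h : vtxLabel W τ x '' {x}ᶜ = vtxLabel W σ y '' {y}ᶜ) :
    (⟨τ, x⟩ : (τ : Cell W) × CellCorner W τ) = ⟨σ, y⟩ := by
  obtain ⟨a, ha⟩ := hne
  have h' := fun a => Set.ext_iff.1 h a
  have ha' := (h' a).1 ha
  clear h
  rcases cellNode_eq_vtx hx with h | ⟨h, hh, b, -, h⟩ | ⟨s, j, hj, c, -, h⟩ |
    ⟨e, b, F, hF, hm, -, h⟩ <;> cases h <;>
  rcases cellNode_eq_vtx hy with h | ⟨h₂, hh₂, b₂, -, h⟩ | ⟨s₂, j₂, hj₂, c₂, -, h⟩ |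
    ⟨e₂, b₂, F₂, hF₂, hm₂, -, h⟩ <;> cases h
  · rfl
  · exact absurd ha (vtxLabel_vtx a)
  · exact absurd ha (vtxLabel_vtx a)
  · exact absurd ha (vtxLabel_vtx a)
  · exact absurd ha' (vtxLabel_vtx a)
  · rw [vtxLabel_horiz] at ha ha'
    cases ha.symm.trans ha'
    rfl
  · have h1 := (h' _).2 ((vtxLabel_tri hj₂).2 (Or.inl rfl))
    rw [vtxLabel_horiz] at h1
    cases h1
  · rw [vtxLabel_horiz] at ha
    subst ha
    rcases (vtxLabel_block hF₂ hm₂).1 ha' with ⟨h1, -⟩ | ⟨_, _, h1, -⟩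
    · cases h1
      exact absurd hF₂.vertical hh
    · cases h1
  · exact absurd ha' (vtxLabel_vtx a)
  · have h1 := (h' _).1 ((vtxLabel_tri hj).2 (Or.inl rfl))
    rw [vtxLabel_horiz] at h1
    cases h1
  · have h1 := (h' _).1 ((vtxLabel_tri hj).2 (Or.inl rfl))
    rw [vtxLabel_tri] at h1
    rcases h1 with h1 | h1
    · obtain ⟨rfl, h2, h3⟩ := LinkLabel.corner.inj h1
      obtain ⟨rfl, rfl⟩ := sideAt_tipAt_injective h2 h3
      rfl
    · cases h1
  · have h1 := (h' _).1 ((vtxLabel_tri hj).2 (Or.inr rfl))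
    rcases (vtxLabel_block hF₂ hm₂).1 h1 with ⟨h1, -⟩ | ⟨_, _, h1, -⟩
    · have h2 := congrArg Prod.fst (LinkLabel.dart.inj h1)
      exact absurd (h2 ▸ hF₂.vertical) hj
    · cases h1
  · exact absurd ha' (vtxLabel_vtx a)
  · rw [vtxLabel_horiz] at ha'
    subst ha'
    rcases (vtxLabel_block hF hm).1 ha with ⟨h1, -⟩ | ⟨_, _, h1, -⟩
    · cases h1
      exact absurd hF.vertical hh₂
    · cases h1
  · have h1 := (h' _).2 ((vtxLabel_tri hj₂).2 (Or.inr rfl))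
    rcases (vtxLabel_block hF hm).1 h1 with ⟨h1, -⟩ | ⟨_, _, h1, -⟩
    · have h2 := congrArg Prod.fst (LinkLabel.dart.inj h1)
      exact absurd (h2 ▸ hF.vertical) hj₂
    · cases h1
  · have h' := fun a => (vtxLabel_block hF hm).symm.trans ((h' a).trans (vtxLabel_block hF₂ hm₂))
    rw [vtxLabel_block hF hm] at ha
    rw [vtxLabel_block hF₂ hm₂] at ha'
    obtain ⟨rfl, rfl⟩ : e = e₂ ∧ b = b₂ := by
      rcases ha with ⟨rfl, -⟩ | ⟨s, i, rfl, hs⟩ <;> rcases ha' with ⟨h1, -⟩ | ⟨s', i', h1, hs'⟩ <;>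
        cases h1
      · exact ⟨rfl, rfl⟩
      · exact ⟨(hF.adjacent _ _ hs).symm.trans (hF₂.adjacent _ _ hs'), rfl⟩
    obtain rfl : F = F₂ := by
      ext (_ | t | ⟨s, i⟩)
      · simpa using h' (.dart (e, b))
      · exact ⟨fun h => hF.eq_of_tip hm h ▸ hm₂, fun h => hF₂.eq_of_tip hm₂ h ▸ hm⟩
      · simpa using h' (.corner s i b)
    rfl

/-- The labelling of the link of a vertex of the square complex. -/
def vtxStar (W : X.VHStructure) (v : X.V) :
    W.simplexification.StarLabelling (.vtx v) (LinkLabel X) where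
  label := vtxLabel W
  label_attach hg _ _ hx hy := vtxLabel_attach hg hx hy
  injOn hx := vtxLabel_injOn hx
  unique hx hy hne h := vtxLabel_unique hx hy hne h

/-- The label occurs in the block of the vertical edge starting with `d`. -/
def InBlock (d : X.E × Bool) (a : LinkLabel X) : Prop :=
  a = .dart d ∨ ∃ s i, a = .corner s i d.2 ∧ (X.bdry s i).1 = d.1

/-- The label is a horizontal edge. -/
def LinkLabel.IsHoriz (W : X.VHStructure) (a : LinkLabel X) : Prop :=
  ∃ d, a = .dart d ∧ ¬ W.vertical d.1

theorem InBlock.eq {d d' : X.E × Bool} {a : LinkLabel X} (h : InBlock d a) (h' : InBlock d' a) :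
    d = d' := by
  rcases h with rfl | ⟨s, i, rfl, h⟩ <;> rcases h' with h1 | ⟨s', i', h1, h'⟩
  · exact LinkLabel.dart.inj h1
  · cases h1
  · cases h1
  · obtain ⟨rfl, rfl, h2⟩ := LinkLabel.corner.inj h1
    exact Prod.ext (h.symm.trans h') h2

theorem InBlock.not_isHoriz {d : X.E × Bool} {a : LinkLabel X} (h : InBlock d a)
    (hd : W.vertical d.1) : ¬ a.IsHoriz W := by
  rintro ⟨d', rfl, hd'⟩
  rcases h with h | ⟨s, i, h, -⟩
  · cases h
    exact hd' hd
  · cases h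

/-- The vertical side of a square at the end `c` of its horizontal side `j`, directed away from
this end. -/
def vertDart (X : SquareComplex.{u}) (s : X.S) (j : Fin 4) (c : Bool) : X.E × Bool :=
  ((X.bdry s (sideAt j c)).1, tipAt X s j c)

/-- The horizontal side `j` of a square, directed away from its end `c`. -/
def horizDart (X : SquareComplex.{u}) (s : X.S) (j : Fin 4) (c : Bool) : X.E × Bool :=
  ((X.bdry s j).1, xor c (X.bdry s j).2)

theorem src_vertDart (s : X.S) (j : Fin 4) (c : Bool) :
    X.src (vertDart X s j c) = X.corner s (if c then j + 1 else j) := by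
  cases c
  · have := X.bdry_closed s (j - 1)
    rw [sub_add_cancel] at this
    exact this
  · rfl

theorem linkJoins_dart (s : X.S) (j : Fin 4) (c : Bool) :
    X.LinkJoins (s, if c then j + 1 else j) (vertDart X s j c) (horizDart X s j c) := by
  cases c
  · refine Or.inr ⟨?_, rfl⟩
    simp [horizDart]
  · refine Or.inl ⟨rfl, ?_⟩
    simp [horizDart, rev]

theorem inBlock_vertDart (s : X.S) (j : Fin 4) (c : Bool) :
    InBlock (vertDart X s j c) (.corner s (sideAt j c) (tipAt X s j c)) :=
  Or.inr ⟨s, sideAt j c, rfl, rfl⟩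

/-- Labels of the same block occur in a common simplex. -/
theorem subset_vtxStar {d : X.E × Bool} (hd : W.vertical d.1) {S : Set (LinkLabel X)}
    (hS : S.Finite) (hne : S.Nonempty) (h : ∀ a ∈ S, InBlock d a) :
    ∃ τ x, W.simplexification.Attach (.vtx (X.src d)) τ (fun _ => x) ∧
      S ⊆ (vtxStar W (X.src d)).star τ x := by
  have hnear : ∀ a t, LinkLabel.near a ≠ (.tip t : Label X) := by
    rintro (_ | _ | _) t h <;> cases h
  have hF : W.IsBlock d.1 (insert (.tip d.2) (LinkLabel.near '' S)) := by
    refine ⟨hd, (hS.image _).insert _, ?_, ?_, Or.inr ?_⟩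
    · rintro s i (h1 | ⟨a, ha, h1⟩)
      · cases h1
      · rcases h a ha with rfl | ⟨s', i', rfl, h2⟩
        · cases h1
        · cases h1
          exact h2
    · rintro ⟨h1 | ⟨a, -, h1⟩, h2 | ⟨a', -, h2⟩⟩
      · cases h1.trans h2.symm
      · exact hnear _ _ h2
      · exact hnear _ _ h1
      · exact hnear _ _ h2
    · obtain ⟨a, ha⟩ := hne
      exact ⟨_, Or.inl rfl, _, Or.inr ⟨a, ha, rfl⟩, (hnear a _).symm⟩
  refine ⟨.block _ _ hF, ⟨.tip d.2, Set.mem_insert _ _⟩, rfl, fun a ha => ?_⟩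
  refine (vtxLabel_block hF _).2 ?_
  rcases h a ha with rfl | ⟨s, i, rfl, -⟩
  · exact Or.inl ⟨rfl, Or.inr ⟨_, ha, rfl⟩⟩
  · exact Or.inr ⟨s, i, rfl, Or.inr ⟨_, ha, rfl⟩⟩

/-- Two labels are joined only if they belong to the block of a vertical edge, or are equal to the
same horizontal edge, or belong to the triangle over a horizontal side of a square. -/
theorem vtxStar_joined {v : X.V} {a b : LinkLabel X} (h : (vtxStar W v).Joined a b) :
    (∃ d, W.vertical d.1 ∧ X.src d = v ∧ InBlock d a ∧ InBlock d b) ∨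
    (a = b ∧ a.IsHoriz W) ∨
    ∃ s j c, ¬ W.vertical (X.bdry s j).1 ∧ X.src (vertDart X s j c) = v ∧
      (a = .corner s (sideAt j c) (tipAt X s j c) ∧ b = .dart (horizDart X s j c) ∨
       b = .corner s (sideAt j c) (tipAt X s j c) ∧ a = .dart (horizDart X s j c)) := by
  obtain ⟨τ, x, hx, ha, hb⟩ := h
  rcases cellNode_eq_vtx hx with h | ⟨h, hh, b, -, h⟩ | ⟨s, j, hj, c, hv, h⟩ |
    ⟨e, b, F, hF, hm, hv, h⟩ <;> cases h
  · exact absurd ha (vtxLabel_vtx (W := W) (v := v) a)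
  · obtain rfl := (vtxLabel_horiz hh).1 ha
    obtain rfl := (vtxLabel_horiz hh).1 hb
    exact Or.inr (Or.inl ⟨rfl, _, rfl, hh⟩)
  · have hv' := (src_vertDart s j c).trans hv
    have hvert := vertical_sideAt hj c
    rcases (vtxLabel_tri hj).1 ha with rfl | rfl <;> rcases (vtxLabel_tri hj).1 hb with rfl | rfl
    · exact Or.inl ⟨vertDart X s j c, hvert, hv', inBlock_vertDart s j c, inBlock_vertDart s j c⟩
    · exact Or.inr (Or.inr ⟨s, j, c, hj, hv', Or.inl ⟨rfl, rfl⟩⟩)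
    · exact Or.inr (Or.inr ⟨s, j, c, hj, hv', Or.inr ⟨rfl, rfl⟩⟩)
    · exact Or.inr (Or.inl ⟨rfl, _, rfl, hj⟩)
  · have key : ∀ {a}, a ∈ (vtxStar W v).star (.block e F hF) ⟨.tip b, hm⟩ → InBlock (e, b) a := by
      intro a ha
      rcases (vtxLabel_block hF hm).1 ha with ⟨rfl, -⟩ | ⟨s, i, rfl, hs⟩
      · exact Or.inl rfl
      · exact Or.inr ⟨s, i, rfl, hF.adjacent s i hs⟩
    exact Or.inl ⟨(e, b), hF.vertical, hv, key ha, key hb⟩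

theorem vtxStar_inBlock {v : X.V} {a b : LinkLabel X} (h : (vtxStar W v).Joined a b)
    (ha : ¬ a.IsHoriz W) (hb : ¬ b.IsHoriz W) :
    ∃ d, W.vertical d.1 ∧ X.src d = v ∧ InBlock d a ∧ InBlock d b := by
  rcases vtxStar_joined h with h | ⟨-, h⟩ | ⟨s, j, c, hj, -, ⟨-, rfl⟩ | ⟨-, rfl⟩⟩
  · exact h
  · exact absurd h ha
  · exact absurd ⟨_, rfl, hj⟩ hb
  · exact absurd ⟨_, rfl, hj⟩ ha

/-- A joined pair of a horizontal edge and another label comes from a triangle. -/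
theorem vtxStar_tri {v : X.V} {a b : LinkLabel X} (h : (vtxStar W v).Joined a b)
    (ha : ¬ a.IsHoriz W) (hb : b.IsHoriz W) :
    ∃ s j c, ¬ W.vertical (X.bdry s j).1 ∧ X.src (vertDart X s j c) = v ∧
      a = .corner s (sideAt j c) (tipAt X s j c) ∧ b = .dart (horizDart X s j c) := by
  rcases vtxStar_joined h with ⟨d, hd, -, -, h⟩ | ⟨rfl, -⟩ | ⟨s, j, c, hj, hv, h | ⟨-, rfl⟩⟩
  · exact absurd hb (h.not_isHoriz hd)
  · exact absurd hb ha
  · exact ⟨s, j, c, hj, hv, h⟩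
  · exact absurd ⟨_, rfl, hj⟩ ha

theorem vtxStar_isHoriz {v : X.V} {a b : LinkLabel X} (h : (vtxStar W v).Joined a b)
    (ha : a.IsHoriz W) (hb : b.IsHoriz W) : a = b := by
  rcases vtxStar_joined h with ⟨d, hd, -, h, -⟩ | ⟨rfl, h⟩ | ⟨s, j, c, hj, hv, ⟨rfl, -⟩ | ⟨rfl, -⟩⟩
  · exact absurd ha (h.not_isHoriz hd)
  · rfl
  · obtain ⟨_, h, -⟩ := ha
    cases h
  · obtain ⟨_, h, -⟩ := hb
    cases h

/-- Exactly one of three consecutive vertices of an induced cycle in the link of a vertex is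
horizontal, which excludes cycles whose length is not divisible by `3`. -/
theorem vtxStar_noInducedCycle {v : X.V} : NoInducedCycle (vtxStar W v).Joined := by
  have refl : ∀ {a b}, (vtxStar W v).Joined a b → (vtxStar W v).Joined a a :=
    fun ⟨τ, x, hx, ha, _⟩ => ⟨τ, x, hx, ha, ha⟩
  have symm : ∀ {a b}, (vtxStar W v).Joined a b → (vtxStar W v).Joined b a :=
    fun ⟨τ, x, hx, ha, hb⟩ => ⟨τ, x, hx, hb, ha⟩
  have key : ∀ {p q r}, (vtxStar W v).Joined p q → (vtxStar W v).Joined q r →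
      ¬ (vtxStar W v).Joined p r →
      (p.IsHoriz W ∨ q.IsHoriz W ∨ r.IsHoriz W) ∧ ¬ (p.IsHoriz W ∧ q.IsHoriz W) ∧
      ¬ (q.IsHoriz W ∧ r.IsHoriz W) ∧ ¬ (p.IsHoriz W ∧ r.IsHoriz W) := by
    intro p q r hpq hqr hpr
    have h1 : ¬ (p.IsHoriz W ∧ q.IsHoriz W) := fun h => by
      obtain rfl := vtxStar_isHoriz hpq h.1 h.2
      exact hpr hqr
    have h2 : ¬ (q.IsHoriz W ∧ r.IsHoriz W) := fun h => by
      obtain rfl := vtxStar_isHoriz hqr h.1 h.2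
      exact hpr hpq
    refine ⟨?_, h1, h2, fun h => ?_⟩
    · by_contra hcon
      push Not at hcon
      obtain ⟨d, hd, rfl, hp, hq⟩ := vtxStar_inBlock hpq hcon.1 hcon.2.1
      obtain ⟨d', -, -, hq', hr⟩ := vtxStar_inBlock hqr hcon.2.1 hcon.2.2
      obtain rfl := hq.eq hq'
      obtain ⟨τ, x, hx, hsub⟩ := subset_vtxStar hd (Set.toFinite {p, r}) (Set.insert_nonempty _ _)
        (by rintro a (rfl | rfl) <;> assumption)
      exact hpr ⟨τ, x, hx, hsub (Or.inl rfl), hsub (Or.inr rfl)⟩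
    · have hq : ¬ q.IsHoriz W := fun hq => h1 ⟨h.1, hq⟩
      obtain ⟨s, j, c, -, -, rfl, rfl⟩ := vtxStar_tri (symm hpq) hq h.1
      obtain ⟨s', j', c', -, -, h3, rfl⟩ := vtxStar_tri hqr hq h.2
      obtain ⟨rfl, h4, h5⟩ := LinkLabel.corner.inj h3
      obtain ⟨rfl, rfl⟩ := sideAt_tipAt_injective h4 h5
      exact hpr (refl hpq)
  refine ⟨fun a b c d hab hbc hcd hda hac hbd => ?_,
    fun a b c d e hab hbc hcd hde hea hac hbd hce hda heb => ?_⟩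
  · have h1 := key hab hbc hac
    have h2 := key hbc hcd hbd
    have h3 := key hcd hda fun h => hac (symm h)
    have h4 := key hda hab fun h => hbd (symm h)
    clear key hac hbd
    generalize a.IsHoriz W = A, b.IsHoriz W = B, c.IsHoriz W = C, d.IsHoriz W = D at *
    grind
  · have h1 := key hab hbc hac
    have h2 := key hbc hcd hbd
    have h3 := key hcd hde hce
    have h4 := key hde hea hda
    have h5 := key hea hab heb
    clear key hac hbd hce hda heb
    generalize a.IsHoriz W = A, b.IsHoriz W = B, c.IsHoriz W = C, d.IsHoriz W = D,
      e.IsHoriz W = E at *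
    grind

/-- The link of a vertex of the square complex: this is where bigons in the links of the square
complex are excluded, as they would give cliques that do not span a simplex. -/
theorem link_vtx (W : X.VHStructure) (hX : X.NoBigons) (v : X.V) :
    (W.simplexification.link (.vtx v)).IsFlag ∧
      IsEmpty (SimpleGraph.cycleGraph 4 ↪g (W.simplexification.link (.vtx v)).graph) ∧
      IsEmpty (SimpleGraph.cycleGraph 5 ↪g (W.simplexification.link (.vtx v)).graph) := by
  refine (vtxStar W v).link_isFlag (inferInstanceAs (Subsingleton PUnit))
    (fun S hS hne hc => ?_) vtxStar_noInducedCycle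
  by_cases hH : ∃ h ∈ S, h.IsHoriz W
  · obtain ⟨h, hh, hH⟩ := hH
    by_cases hs : ∃ a ∈ S, a ≠ h
    · obtain ⟨a, ha, hah⟩ := hs
      have hnot : ∀ a ∈ S, a ≠ h → ¬ a.IsHoriz W := fun a ha hah haH =>
        hah (vtxStar_isHoriz (hc a ha h hh) haH hH)
      obtain ⟨τ, x, hx, hxa, hxh⟩ := hc a ha h hh
      refine ⟨τ, x, hx, fun a' ha' => ?_⟩
      by_cases hah' : a' = h
      · rwa [hah']
      obtain ⟨s, j, c, hj, -, h1, rfl⟩ := vtxStar_tri (hc a ha h hh) (hnot a ha hah) hH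
      obtain ⟨s', j', c', hj', -, h1', h2⟩ :=
        vtxStar_tri (hc a' ha' _ hh) (hnot a' ha' hah') hH
      obtain ⟨d, -, -, hd, hd'⟩ :=
        vtxStar_inBlock (hc a ha a' ha') (hnot a ha hah) (hnot a' ha' hah')
      rw [h1] at hd
      rw [h1'] at hd'
      have h3 := (inBlock_vertDart s j c).eq hd
      have h4 := (inBlock_vertDart s' j' c').eq hd'
      have h5 := linkJoins_dart s' j' c'
      rw [h4, ← h3, ← LinkLabel.dart.inj h2] at h5
      have h6 := hX _ _ _ _ (linkJoins_dart s j c) h5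
      obtain rfl : s = s' := congrArg Prod.fst h6
      have h7 : (if c then j + 1 else j) = if c' then j' + 1 else j' := congrArg Prod.snd h6
      suffices h : a' = a by rwa [h]
      cases c <;> cases c' <;> simp only [Bool.false_eq_true, if_false, if_true] at h7
      · subst h7
        rw [h1, h1']
      · subst h7
        exact absurd ((W.alternating s j').2 hj') hj
      · subst h7
        exact absurd ((W.alternating s j).2 hj) hj'
      · obtain rfl := add_left_injective 1 h7
        rw [h1, h1']
    · push Not at hs
      obtain ⟨τ, x, hx, hxh, -⟩ := hc h hh h hh
      exact ⟨τ, x, hx, fun a ha => hs a ha ▸ hxh⟩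
  · push Not at hH
    obtain ⟨a, ha⟩ := id hne
    obtain ⟨d, hd, rfl, hda, -⟩ := vtxStar_inBlock (hc a ha a ha) (hH a ha) (hH a ha)
    refine subset_vtxStar hd hS hne fun b hb => ?_
    obtain ⟨d', -, -, hda', hdb⟩ := vtxStar_inBlock (hc a ha b hb) (hH a ha) (hH b hb)
    rwa [hda.eq hda']

theorem isLocally6Large (W : X.VHStructure) (hX : X.NoBigons) :
    W.simplexification.IsLocally6Large := by
  intro σ hσ
  match σ, hσ with
  | .vtx v, _ => exact link_vtx W hX v
  | .ctr s, _ => exact link_ctr W s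
  | .horiz _ _, h => exact absurd (congrArg ULift.down (h.elim ⟨true⟩ ⟨false⟩)) (by simp)
  | .tri _ _ _, h => exact absurd (h.elim none (some ⟨false⟩)) (by simp)
  | .block e F hF, h =>
    have hs : F.Subsingleton := (Set.subsingleton_coe F).1 h
    obtain rfl : F = {.mid} := hs.eq_singleton_of_mem
      (hF.essential.resolve_right (Set.not_nontrivial_iff.2 hs))
    exact link_mid hF

theorem isSystolic (W : X.VHStructure) (hX : X.NoBigons)
    (h : SimplyConnectedSpace W.simplexification.Realization) : W.simplexification.IsSystolic :=
  ⟨inferInstance, h, isLocally6Large W hX⟩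

end VHStructure

end SquareComplex

/-! ### Bigons in links, and coverings -/

namespace SquareComplex

variable {X : SquareComplex.{u}}

theorem LinkJoins.src_eq {c : X.S × Fin 4} {d d' : X.E × Bool} (h : X.LinkJoins c d d') :
    X.src d = X.corner c.1 c.2 := by
  rcases h with ⟨rfl, -⟩ | ⟨-, rfl⟩
  · rfl
  · have := corner_succ (X := X) c.1 (c.2 - 1)
    rw [sub_add_cancel] at this
    exact this.symm

theorem LinkJoins.symm {c : X.S × Fin 4} {d d' : X.E × Bool} (h : X.LinkJoins c d d') :
    X.LinkJoins c d' d := Or.symm h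

theorem LinkJoins.map {Y : SquareComplex.{u}} (p : Y.Hom X) {c : Y.S × Fin 4} {d d' : Y.E × Bool}
    (h : Y.LinkJoins c d d') :
    X.LinkJoins (p.onS c.1, c.2) (p.onE d.1, d.2) (p.onE d'.1, d'.2) := by
  rcases h with ⟨rfl, rfl⟩ | ⟨rfl, rfl⟩ <;> simp [LinkJoins, p.bdry_onS, rev]

namespace VHStructure

theorem vertical_linkJoins (W : X.VHStructure) {c : X.S × Fin 4} {d d' : X.E × Bool}
    (h : X.LinkJoins c d d') : W.vertical d.1 ↔ ¬ W.vertical d'.1 := by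
  have h1 := W.alternating c.1 (c.2 - 1)
  rw [sub_add_cancel] at h1
  rcases h with ⟨rfl, rfl⟩ | ⟨rfl, rfl⟩
  · exact h1
  · change W.vertical (X.bdry c.1 (c.2 - 1)).1 ↔ _
    tauto

theorem noBigons (W : X.VHStructure) (hX : X.NonpositivelyCurved) : X.NoBigons := by
  intro c c' d d' h h'
  by_contra hcc
  have hdd : d ≠ d' := by
    rintro rfl
    have := W.vertical_linkJoins h
    tauto
  refine hX (X.src d) 1 (by norm_num) ⟨![d, d'], ![c, c'], ?_, ?_, ?_, ?_⟩
  · intro i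
    fin_cases i
    · rfl
    · exact h.symm.src_eq.trans h.src_eq.symm
  · intro i j hij
    fin_cases i <;> fin_cases j <;> simp_all [eq_comm]
  · intro i j hij
    fin_cases i <;> fin_cases j <;> simp_all [eq_comm]
  · intro i
    fin_cases i
    · exact h
    · exact h'.symm

end VHStructure

namespace LocalSystem

variable {L : LocalSystem X}

theorem cornerPt_injective {s : X.S} (i : Fin 4) : ∀ {x x' : L.T}, L.pr x = X.corner s 0 →
    L.pr x' = X.corner s 0 → L.cornerPt s x i = L.cornerPt s x' i → x = x' := by
  refine fin4_induction (P := fun i => ∀ {x x' : L.T}, L.pr x = X.corner s 0 →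
    L.pr x' = X.corner s 0 → L.cornerPt s x i = L.cornerPt s x' i → x = x') (fun _ _ h => h)
    (fun i ih x x' hx hx' h => ih hx hx' ?_) i
  rw [← act_cornerPt hx, ← act_cornerPt hx'] at h
  rw [← L.act_rev (pr_cornerPt hx i), h, L.act_rev (pr_cornerPt hx' i)]

theorem eq_of_corner {s s' : L.total.S} (h : s.1.1 = s'.1.1) {i : Fin 4}
    (hc : L.total.corner s i = L.total.corner s' i) : s = s' := by
  obtain ⟨⟨s, x⟩, hx⟩ := s
  obtain ⟨⟨s', x'⟩, hx'⟩ := s'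
  obtain rfl : s = s' := h
  rw [total_corner, total_corner] at hc
  obtain rfl := cornerPt_injective i hx hx' hc
  rfl

theorem noBigons (hX : X.NoBigons) : L.total.NoBigons := by
  intro c c' d d' h h'
  have h1 := hX _ _ _ _ (h.map L.proj) (h'.map L.proj)
  have h2 : c.2 = c'.2 := (Prod.mk.inj h1).2
  refine Prod.ext (eq_of_corner (i := c.2) (Prod.mk.inj h1).1 ?_) h2
  rw [← h.src_eq, h2]
  exact h'.src_eq

end LocalSystem

namespace VHStructure

open GenSimplicialComplex

/-! ### Functoriality of the simplexification -/

section Functoriality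

variable {Y : SquareComplex.{u}} {f : Y.Hom X}

/-- The map of labels induced by a combinatorial map. -/
def Label.map (f : Y.Hom X) : Label Y → Label X
  | .mid => .mid
  | .tip b => .tip b
  | .sq s i => .sq (f.onS s) i

/-- The map of vertices of the simplexifications induced by a combinatorial map. -/
def Node.map (f : Y.Hom X) : Node Y → Node X
  | .vtx v => .vtx (f.onV v)
  | .mid e => .mid (f.onE e)
  | .ctr s => .ctr (f.onS s)

theorem Label.map_injective (hf : Function.Injective f.onS) : Function.Injective (Label.map f)
  | .mid, .mid, _ => rfl
  | .tip _, .tip _, h => by cases h; rfl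
  | .sq _ _, .sq _ _, h => by
    obtain ⟨h1, rfl⟩ := Label.sq.inj h
    rw [hf h1]
  | .mid, .tip _, h | .mid, .sq _ _, h | .tip _, .mid, h | .tip _, .sq _ _, h | .sq _ _, .mid, h
  | .sq _ _, .tip _, h => by cases h

theorem Label.node_map (e : Y.E) : ∀ a : Label Y, (a.map f).node (f.onE e) = (a.node e).map f
  | .mid => rfl
  | .tip b => congrArg Node.vtx (f.endpt_onE e b)
  | .sq _ _ => rfl

variable {U : Y.VHStructure} {W : X.VHStructure} (hU : ∀ e, W.vertical (f.onE e) ↔ U.vertical e)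
  (hf : Function.Injective f.onS)

include hU hf in
theorem IsBlock.map {e : Y.E} {F : Set (Label Y)} (hF : U.IsBlock e F) :
    W.IsBlock (f.onE e) (Label.map f '' F) := by
  refine ⟨(hU e).2 hF.vertical, hF.finite.image _, ?_, ?_, ?_⟩
  · rintro s i ⟨_ | _ | ⟨s', i'⟩, ha, h⟩ <;> cases h
    rw [f.bdry_onS, hF.adjacent _ _ ha]
  · rintro ⟨⟨_ | _ | _, ha, h⟩, ⟨_ | _ | _, ha', h'⟩⟩ <;> cases h <;> cases h'
    exact hF.one_tip ⟨ha, ha'⟩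
  · exact hF.essential.imp (fun h => ⟨_, h, rfl⟩) fun h => h.image (Label.map_injective hf)

include hU in
theorem not_vertical_onS {s : Y.S} {j : Fin 4} (hj : ¬ U.vertical (Y.bdry s j).1) :
    ¬ W.vertical (X.bdry (f.onS s) j).1 := by
  rw [f.bdry_onS]
  exact fun h => hj ((hU _).1 h)

/-- The map of simplices induced by a combinatorial map that is injective on squares. -/
def mapCell : Cell U → Cell W
  | .vtx v => .vtx (f.onV v)
  | .ctr s => .ctr (f.onS s)
  | .horiz h hh => .horiz (f.onE h) fun h' => hh ((hU h).1 h')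
  | .tri s j hj => .tri (f.onS s) j (not_vertical_onS hU hj)
  | .block e F hF => .block (f.onE e) (Label.map f '' F) (hF.map hU hf)

/-- The map of corners of simplices induced by a combinatorial map. -/
def mapCorner : (σ : Cell U) → CellCorner U σ → CellCorner W (mapCell hU hf σ)
  | .vtx _, x => x
  | .ctr _, x => x
  | .horiz _ _, x => x
  | .tri _ _ _, x => x
  | .block _ _ _, x => ⟨x.1.map f, x.1, x.2, rfl⟩

theorem mapCorner_bijective : ∀ σ, Function.Bijective (mapCorner hU hf σ)
  | .vtx _ => Function.bijective_id
  | .ctr _ => Function.bijective_id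
  | .horiz _ _ => Function.bijective_id
  | .tri _ _ _ => Function.bijective_id
  | .block _ _ _ => ⟨fun _ _ h => Subtype.ext (Label.map_injective hf (congrArg Subtype.val h)),
      fun ⟨_, y, hy, h⟩ => ⟨⟨y, hy⟩, Subtype.ext h⟩⟩

theorem cellNode_map : ∀ (σ : Cell U) (x : CellCorner U σ),
    cellNode W (mapCell hU hf σ) (mapCorner hU hf σ x) = (cellNode U σ x).map f
  | .vtx _, _ => rfl
  | .ctr _, _ => rfl
  | .horiz h _, x => congrArg Node.vtx (f.endpt_onE h x.down)
  | .tri _ _ _, none => rfl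
  | .tri s j _, some b => congrArg Node.vtx (f.corner_onS s (if b.down then j + 1 else j))
  | .block e _ _, x => Label.node_map e x.1

theorem sideAt_onS (s : Y.S) (j : Fin 4) (c : Bool) :
    (X.bdry (f.onS s) (sideAt j c)).1 = f.onE (Y.bdry s (sideAt j c)).1 := by
  rw [f.bdry_onS]

theorem tipAt_onS (s : Y.S) (j : Fin 4) (c : Bool) : tipAt X (f.onS s) j c = tipAt Y s j c := by
  simp [tipAt, f.bdry_onS]

theorem mapCell_attach : ∀ {τ σ : Cell U} {g : CellCorner U τ → CellCorner U σ}
    {g' : CellCorner W (mapCell hU hf τ) → CellCorner W (mapCell hU hf σ)},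
    CellAttach U τ σ g → (∀ x, g' (mapCorner hU hf τ x) = mapCorner hU hf σ (g x)) →
    CellAttach W (mapCell hU hf τ) (mapCell hU hf σ) g'
  | .vtx v, σ, g, g', h, hg => by
    change cellNode W _ (g' (mapCorner hU hf (.vtx v) ⟨⟩)) = .vtx (f.onV v)
    rw [hg, cellNode_map]
    exact congrArg (Node.map f) h
  | .ctr s, σ, g, g', h, hg => by
    change cellNode W _ (g' (mapCorner hU hf (.ctr s) ⟨⟩)) = .ctr (f.onS s)
    rw [hg, cellNode_map]
    exact congrArg (Node.map f) h
  | .horiz _ _, .horiz _ _, g, g', ⟨rfl, h⟩, hg => ⟨rfl, fun x => (hg x).trans (h x)⟩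
  | .horiz _ _, .tri s j _, g, g', ⟨rfl, h⟩, hg => by
    refine ⟨congrArg Prod.fst (f.bdry_onS s j), fun b => (hg ⟨b⟩).trans ((h b).trans ?_)⟩
    rw [f.bdry_onS]
  | .tri _ _ _, .tri _ _ _, g, g', ⟨rfl, rfl, h⟩, hg => ⟨rfl, rfl, fun x => (hg x).trans (h x)⟩
  | .block _ F _, .tri s j _, g, g', ⟨c, he, hF, h⟩, hg => by
    subst he
    refine ⟨c, sideAt_onS s j c, ?_, ?_⟩
    · rw [hF, Set.image_pair, tipAt_onS]
      rfl
    · rintro ⟨_, y, hy, rfl⟩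
      rw [tipAt_onS]
      refine ⟨fun hx => (hg ⟨y, hy⟩).trans ((h ⟨y, hy⟩).1 (Label.map_injective hf hx)),
        fun hx => (hg ⟨y, hy⟩).trans ((h ⟨y, hy⟩).2 (Label.map_injective hf hx))⟩
  | .block _ _ _, .block _ _ _, g, g', ⟨rfl, h⟩, hg => by
    refine ⟨rfl, ?_⟩
    rintro ⟨_, y, hy, rfl⟩
    exact (congrArg Subtype.val (hg ⟨y, hy⟩)).trans (congrArg (Label.map f) (h ⟨y, hy⟩))

/-- The simplicial map induced by a combinatorial map that is injective on squares. -/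
noncomputable def mapHom : U.simplexification.Hom W.simplexification where
  toFun := mapCell hU hf
  corner := mapCorner hU hf
  bijective_corner := mapCorner_bijective hU hf
  map_attach {τ σ g} hg :=
    let b := Equiv.ofBijective _ (mapCorner_bijective hU hf τ)
    ⟨mapCorner hU hf σ ∘ g ∘ b.symm,
      mapCell_attach hU hf hg fun x => congrArg (fun x => mapCorner hU hf σ (g x))
        (b.symm_apply_apply x),
      funext fun x => congrArg (fun x => mapCorner hU hf σ (g x)) (b.symm_apply_apply x)⟩

end Functoriality

theorem sigma_block_ext {U : X.VHStructure} {A : Type u} {e e' : X.E} {F F' : Set (Label X)}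
    {hF : U.IsBlock e F} {hF' : U.IsBlock e' F'} {f : A → CellCorner U (.block e F hF)}
    {f' : A → CellCorner U (.block e' F' hF')} (he : e = e') (h : F = F')
    (hff : ∀ x, (f x).1 = (f' x).1) :
    (⟨_, f⟩ : (τ : Cell U) × (A → CellCorner U τ)) = ⟨_, f'⟩ := by
  subst he h
  congr 1
  exact funext fun x => Subtype.ext (hff x)

theorem block_ext {U : X.VHStructure} {e e' : X.E} {F F' : Set (Label X)}
    {hF : U.IsBlock e F} {hF' : U.IsBlock e' F'} (he : e = e') (h : F = F') :
    (Cell.block e F hF : Cell U) = .block e' F' hF' := by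
  subst he h
  rfl

end VHStructure

end SquareComplex

namespace GenSimplicialComplex

theorem Hom.ext_sigma {K L : GenSimplicialComplex.{u}} {φ ψ : K.Hom L}
    (h : ∀ σ, (⟨φ.toFun σ, φ.corner σ⟩ : (τ : L.Simplex) × (K.Corner σ → L.Corner τ)) =
      ⟨ψ.toFun σ, ψ.corner σ⟩) : φ = ψ := by
  have h1 : φ.toFun = ψ.toFun := funext fun σ => congrArg Sigma.fst (h σ)
  refine Hom.ext h1 (Function.hfunext rfl fun σ τ hστ => ?_)
  obtain rfl := eq_of_heq hστ
  exact (Sigma.mk.inj (h σ)).2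

theorem IsGeometric.comp_mulEquiv {G H : Type*} [Group G] [Group H] {K : GenSimplicialComplex.{u}}
    {ρ : G →* K.Hom K} (h : IsGeometric ρ) (φ : H ≃* G) : IsGeometric (ρ.comp φ.toMonoidHom) := by
  obtain ⟨h1, F, hF, h2⟩ := h
  refine ⟨fun σ τ => Set.Finite.preimage (f := φ) φ.injective.injOn (h1 σ τ), F, hF, fun σ => ?_⟩
  obtain ⟨g, τ, hτ, h⟩ := h2 σ
  refine ⟨φ.symm g, τ, hτ, ?_⟩
  change (ρ (φ (φ.symm g))).toFun τ = σ
  rwa [φ.apply_symm_apply]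

/-- An action is cocompact if its orbits are distinguished by an invariant with finitely many
values. -/
theorem exists_finite_of_invariant {G I : Type*} [Group G] [Finite I] {K : GenSimplicialComplex.{u}}
    (ρ : G →* K.Hom K) (inv : K.Simplex → I)
    (h : ∀ σ τ, inv σ = inv τ → ∃ g, (ρ g).toFun σ = τ) :
    ∃ F : Set K.Simplex, F.Finite ∧ ∀ σ : K.Simplex, ∃ g : G, ∃ τ ∈ F, (ρ g).toFun τ = σ := by
  refine ⟨Set.range fun i : Set.range inv => i.2.choose, Set.finite_range _, fun σ => ?_⟩
  obtain ⟨g, hg⟩ := h _ σ (Exists.choose_spec (⟨σ, rfl⟩ : inv σ ∈ Set.range inv))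
  exact ⟨g, _, ⟨⟨inv σ, σ, rfl⟩, rfl⟩, hg⟩

end GenSimplicialComplex

/-! ### The action on the simplexification of a covering -/

namespace SquareComplex

open GenSimplicialComplex VHStructure

variable {X : SquareComplex.{u}}

namespace LocalSystem

variable (L : LocalSystem X) (W : X.VHStructure)

theorem deck_onS_injective (g : L.aut) : Function.Injective (L.deck g).onS := fun s s' h => by
  have h1 := congrArg Subtype.val h
  exact Subtype.ext (Prod.ext (Prod.mk.inj h1).1 (g.1.injective (Prod.mk.inj h1).2))

/-- The action of the automorphisms of a local system on the simplexification of its total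
complex. -/
noncomputable def simplicialAction :
    L.aut →* (W.pullback L.proj).simplexification.Hom (W.pullback L.proj).simplexification where
  toFun g := mapHom (f := L.deck g) (fun _ => Iff.rfl) (L.deck_onS_injective g)
  map_one' := by
    refine Hom.ext_sigma fun σ => ?_
    match σ with
    | .vtx _ | .ctr _ | .horiz _ _ | .tri _ _ _ => rfl
    | .block e F hF =>
      have h : ∀ a, Label.map (L.deck 1) a = a := by rintro (_ | _ | _) <;> rfl
      exact sigma_block_ext rfl ((Set.image_congr fun a _ => h a).trans (Set.image_id' F))
        fun x => h x.1
  map_mul' g g' := by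
    refine Hom.ext_sigma fun σ => ?_
    match σ with
    | .vtx _ | .ctr _ | .horiz _ _ | .tri _ _ _ => rfl
    | .block e F hF =>
      have h : ∀ a, Label.map (L.deck (g * g')) a = Label.map (L.deck g) (Label.map (L.deck g') a) := by
        rintro (_ | _ | _) <;> rfl
      refine sigma_block_ext rfl ?_ fun x => h x.1
      rw [Set.image_image]
      exact Set.image_congr fun a _ => h a

theorem simplicialAction_extends (g : L.aut) :
    (W.pullback L.proj).Extends (L.simplicialAction W g) (L.deck g) := by
  refine ⟨fun _ => rfl, fun _ => rfl, fun e he => ⟨isBlock_mid he.vertical, ?_⟩⟩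
  exact block_ext rfl Set.image_singleton

variable {L}

/-- The element of the local system that encodes the position of a vertex of the
simplexification. -/
def nodePt : Node L.total → L.T
  | .vtx v => v
  | .mid e => e.1.2
  | .ctr s => s.1.2

theorem nodePt_map (g : L.aut) : ∀ n : Node L.total, nodePt (n.map (L.deck g)) = g.1 (nodePt n)
  | .vtx _ => rfl
  | .mid _ => rfl
  | .ctr _ => rfl

/-- A vertex of a simplex sits at one of its corners. -/
theorem exists_nodePt {σ v : (W.pullback L.proj).simplexification.Simplex}
    (h : v ∈ (W.pullback L.proj).simplexification.vertices σ) :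
    ∃ x, nodePt (cellNode (W.pullback L.proj) v (Classical.choice (nonempty_cellCorner _ v))) =
      nodePt (cellNode (W.pullback L.proj) σ x) := by
  obtain ⟨-, f, hf⟩ := h
  exact ⟨f _, congrArg nodePt (cellNode_of_attach _ hf _).symm⟩

theorem finite_setOf_meet (hf : ∀ (g : L.aut) x, g.1 x = x → g = 1)
    (σ τ : (W.pullback L.proj).simplexification.Simplex) :
    {g : L.aut | ((W.pullback L.proj).simplexification.vertices
      ((L.simplicialAction W g).toFun σ) ∩
        (W.pullback L.proj).simplexification.vertices τ).Nonempty}.Finite := by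
  have := finite_cellCorner (W.pullback L.proj) σ
  have := finite_cellCorner (W.pullback L.proj) τ
  refine Set.Finite.subset (Set.finite_iUnion fun p : CellCorner (W.pullback L.proj) σ ×
    CellCorner (W.pullback L.proj) τ => Set.Subsingleton.finite (s := {g : L.aut |
      g.1 (nodePt (cellNode _ σ p.1)) = nodePt (cellNode _ τ p.2)}) fun g hg g' hg' => ?_) ?_
  · have h1 : (g'⁻¹ * g).1 (nodePt (cellNode _ σ p.1)) = nodePt (cellNode _ σ p.1) :=
      (congrArg (g'⁻¹).1 (hg.trans hg'.symm)).trans (Equiv.symm_apply_apply g'.1 _)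
    exact (inv_mul_eq_one.1 (hf _ _ h1)).symm
  · rintro g ⟨v, hv, hv'⟩
    obtain ⟨y, hy⟩ := exists_nodePt W hv
    obtain ⟨x', hx'⟩ := exists_nodePt W hv'
    obtain ⟨x, rfl⟩ := ((L.simplicialAction W g).bijective_corner σ).2 y
    refine Set.mem_iUnion.2 ⟨(x, x'), ?_⟩
    refine Eq.trans ?_ (hy.symm.trans hx')
    exact ((congrArg nodePt (cellNode_map _ _ σ x)).trans (nodePt_map g _)).symm

/-- The combinatorial type of the image in `X` of a simplex of the simplexification. -/
def cellType : Cell (W.pullback L.proj) →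
    X.V ⊕ X.S ⊕ X.E ⊕ (X.S × Fin 4) ⊕ (X.E × Set (Label X))
  | .vtx v => .inl (L.pr v)
  | .ctr s => .inr (.inl s.1.1)
  | .horiz h _ => .inr (.inr (.inl h.1.1))
  | .tri s j _ => .inr (.inr (.inr (.inl (s.1.1, j))))
  | .block e F _ => .inr (.inr (.inr (.inr (e.1.1, Label.map L.proj '' F))))

theorem block_subset {e : L.total.E} {F F' : Set (Label L.total)}
    (hF : (W.pullback L.proj).IsBlock e F) (hF' : (W.pullback L.proj).IsBlock e F')
    (h : Label.map L.proj '' F ⊆ Label.map L.proj '' F') : F ⊆ F' := by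
  intro a ha
  obtain ⟨a', ha', haa⟩ := h ⟨a, ha, rfl⟩
  suffices h : a' = a by rwa [← h]
  match a, a', ha, ha', haa with
  | .mid, .mid, _, _, _ => rfl
  | .tip _, .tip _, _, _, h => cases h; rfl
  | .mid, .tip _, _, _, h | .mid, .sq _ _, _, _, h | .tip _, .mid, _, _, h
  | .tip _, .sq _ _, _, _, h | .sq _ _, .mid, _, _, h | .sq _ _, .tip _, _, _, h => cases h
  | .sq s i, .sq s' i', ha, ha', h =>
    obtain ⟨h1, hi⟩ := Label.sq.inj h
    subst hi
    have h2 : L.total.bdry s' i' = L.total.bdry s i' :=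
      Prod.ext ((hF'.adjacent _ _ ha').trans (hF.adjacent _ _ ha).symm)
        (congrArg (fun s => (X.bdry s i').2) h1)
    rw [eq_of_corner h1 (congrArg L.total.src h2)]

theorem exists_simplicialAction_eq (ht : ∀ x y, L.pr x = L.pr y → ∃ g : L.aut, g.1 x = y)
    (σ τ : Cell (W.pullback L.proj)) (h : cellType W σ = cellType W τ) :
    ∃ g, (L.simplicialAction W g).toFun σ = τ := by
  have hS : ∀ s s' : L.total.S, s.1.1 = s'.1.1 → ∃ g, (L.deck g).onS s = s' := by
    rintro ⟨⟨s, x⟩, hx⟩ ⟨⟨s', x'⟩, hx'⟩ h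
    obtain rfl : s = s' := h
    obtain ⟨g, rfl⟩ := ht x x' (hx.trans hx'.symm)
    exact ⟨g, rfl⟩
  have hE : ∀ e e' : L.total.E, e.1.1 = e'.1.1 → ∃ g, (L.deck g).onE e = e' := by
    rintro ⟨⟨e, x⟩, hx⟩ ⟨⟨e', x'⟩, hx'⟩ h
    obtain rfl : e = e' := h
    obtain ⟨g, rfl⟩ := ht x x' (hx.trans hx'.symm)
    exact ⟨g, rfl⟩
  match σ, τ, h with
  | .vtx v, .vtx v', h =>
    obtain ⟨g, rfl⟩ := ht v v' (Sum.inl.inj h)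
    exact ⟨g, rfl⟩
  | .ctr s, .ctr s', h =>
    obtain ⟨g, rfl⟩ := hS s s' (Sum.inl.inj (Sum.inr.inj h))
    exact ⟨g, rfl⟩
  | .horiz e _, .horiz e' _, h =>
    obtain ⟨g, rfl⟩ := hE e e' (Sum.inl.inj (Sum.inr.inj (Sum.inr.inj h)))
    exact ⟨g, rfl⟩
  | .tri s j _, .tri s' j' _, h =>
    have h1 := Sum.inl.inj (Sum.inr.inj (Sum.inr.inj (Sum.inr.inj h)))
    obtain rfl : j = j' := congrArg Prod.snd h1
    obtain ⟨g, rfl⟩ := hS s s' (Prod.mk.inj h1).1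
    exact ⟨g, rfl⟩
  | .block e F hF, .block e' F' hF', h =>
    have h1 := Sum.inr.inj (Sum.inr.inj (Sum.inr.inj (Sum.inr.inj h)))
    obtain ⟨g, rfl⟩ := hE e e' (Prod.mk.inj h1).1
    have hmap : Label.map L.proj '' (Label.map (L.deck g) '' F) = Label.map L.proj '' F' := by
      rw [Set.image_image, ← (Prod.mk.inj h1).2]
      refine Set.image_congr fun a _ => ?_
      rcases a with _ | _ | _ <;> rfl
    have hgF := hF.map (W := W.pullback L.proj) (fun _ => Iff.rfl) (L.deck_onS_injective g)
    exact ⟨g, block_ext rfl ((block_subset W hgF hF' hmap.subset).antisymm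
      (block_subset W hF' hgF hmap.symm.subset))⟩

theorem isGeometric_simplicialAction [CompactSpace X.Realization]
    (ht : ∀ x y, L.pr x = L.pr y → ∃ g : L.aut, g.1 x = y)
    (hf : ∀ (g : L.aut) x, g.1 x = x → g = 1) : IsGeometric (L.simplicialAction W) := by
  have hfin := finite_index (X := X)
  have : Finite X.V := Finite.of_injective (β := X.V ⊕ X.E ⊕ X.S) Sum.inl Sum.inl_injective
  have : Finite X.E := Finite.of_injective (β := X.V ⊕ X.E ⊕ X.S) _
    (Sum.inr_injective.comp Sum.inl_injective)
  have : Finite X.S := Finite.of_injective (β := X.V ⊕ X.E ⊕ X.S) _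
    (Sum.inr_injective.comp Sum.inr_injective)
  have : Finite (Label X) := Finite.of_surjective (α := Unit ⊕ Bool ⊕ (X.S × Fin 4))
    (fun | .inl _ => .mid | .inr (.inl b) => .tip b | .inr (.inr p) => .sq p.1 p.2) (by
      rintro (_ | b | ⟨s, i⟩)
      exacts [⟨.inl (), rfl⟩, ⟨.inr (.inl b), rfl⟩, ⟨.inr (.inr (s, i)), rfl⟩])
  exact ⟨finite_setOf_meet W hf, exists_finite_of_invariant _ (cellType W)
    (exists_simplicialAction_eq W ht)⟩

end LocalSystem

theorem nonempty_vertex (x : X.Realization) : Nonempty X.V := by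
  induction x using Quot.ind with | mk c => ?_
  rcases c with ⟨v, -⟩ | ⟨e, -⟩ | ⟨s, -⟩
  exacts [⟨v⟩, ⟨X.endpt e false⟩, ⟨X.corner s 0⟩]

end SquareComplex

theorem corollary2p4 (X : SquareComplex.{u}) (W : X.VHStructure) (hX : X.NonpositivelyCurved)
    [CompactSpace X.Realization] [ConnectedSpace X.Realization] (x : X.Realization) :
    IsSystolicGroup (FundamentalGroup X.Realization x) ∧
    ∃ (Y : SquareComplex.{u}) (p : Y.Hom X), p.IsUniversalCover ∧
      (W.pullback p).simplexification.IsSystolic ∧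
      -- the fundamental group as the group of deck transformations of the universal cover,
      -- and its action on the simplexification
      ∃ (D : FundamentalGroup X.Realization x →* Y.Hom Y)
        (ρ : FundamentalGroup X.Realization x →*
          (W.pullback p).simplexification.Hom (W.pullback p).simplexification),
        Function.Injective D ∧ (∀ f : Y.Hom Y, f ∈ Set.range D ↔ p.comp f = p) ∧
        (∀ g, (W.pullback p).Extends (ρ g) (D g)) ∧
        GenSimplicialComplex.IsGeometric ρ := by
  obtain ⟨v₀⟩ := SquareComplex.nonempty_vertex x
  obtain ⟨φ⟩ := SquareComplex.universal.nonempty_fundamentalGroup_mulEquiv (v₀ := v₀) x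
  have hsys : (W.pullback (SquareComplex.universal v₀).proj).simplexification.IsSystolic :=
    SquareComplex.VHStructure.isSystolic _ (SquareComplex.LocalSystem.noBigons (W.noBigons hX))
      (SquareComplex.VHStructure.simplyConnectedSpace_simplexification _
        SquareComplex.universal.hasSections)
  have hgeo := (SquareComplex.LocalSystem.isGeometric_simplicialAction W
    SquareComplex.universal.exists_aut
    SquareComplex.universal.aut_free).comp_mulEquiv φ
  refine ⟨⟨_, _, hsys, hgeo⟩, (SquareComplex.universal v₀).total, (SquareComplex.universal v₀).proj,
    SquareComplex.universal.isUniversalCover, hsys,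
    (SquareComplex.universal v₀).deck.comp φ.toMonoidHom, _,
    SquareComplex.LocalSystem.deck_injective.comp φ.injective, fun f => ?_,
    fun g => SquareComplex.LocalSystem.simplicialAction_extends _ W (φ g), hgeo⟩
  rw [← SquareComplex.universal.mem_range_deck_iff]
  exact iff_of_eq (congrArg (f ∈ ·) (φ.surjective.range_comp (SquareComplex.universal v₀).deck))
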